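/- **Setting.** Let $d\in\mathbb N$, $T>0$, $c\in\mathbb C$ and $0<q\le p\le\infty$. Let $h_\alpha$, $\alpha\in\mathbb N^d$, be the Hermite functions on $\mathbb R^d$, and let $\Sigma_1(\mathbb R^d)$ and $\Sigma_1'(\mathbb R^d)$ be the Gelfand–Shilov space of Beurling type of order $1$ and its distribution space, i.e. the sets of Hermite series $f=\sum_\alpha c_h(f,\alpha)h_\alpha$ with $|c_h(f,\alpha)|\lesssim e^{-r|\alpha|^{1/2}}$ for every $r>0$, respectively $|c_h(f,\alpha)|\lesssim e^{r|\alpha|^{1/2}}$ for some $r>0$, with the pairing $(f,g)=\sum_\alpha c_h(f,\alpha)\overline{c_h(g,\alpha)}$. For $H_{x,c}=|x|^2-\Delta_x+c$ let $$(Ef)(t)=e^{-itH_{x,c}}f=\sum_\alpha e^{-it(2|\alpha|+d+c)}c_h(f,\alpha)h_\alpha .$$ Let $\omega>0$ be a weight on $\mathbb R^{2d}$ (i.e. $\omega,1/\omega\in L^\infty_{loc}$) which is moderate ($\omega(X+Y)\le C\omega(X)v(Y)$ for all $X,Y\in\mathbb R^{2d}$, for some constant $C$ and some positive $v\in L^\infty_{loc}$)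 and radially symmetric in each pair $(x_j,\xi_j)$, i.e. $\omega(x,\xi)=\omega_0(x_1^2+\xi_1^2,\dots,x_d^2+\xi_d^2)$ for some weight $\omega_0$ on $\mathbb R^d$. With $\phi(x)=\pi^{-d/4}e^{-|x|^2/2}$ and $V_\phi f(x,\xi)=(2\pi)^{-d/2}(f,\phi(\cdot-x)e^{i\langle\cdot,\xi\rangle})$, let $M^{p,q}_{(\omega)}$ and $W^{p,q}_{(\omega)}$ be the spaces of all $f\in\Sigma_1'(\mathbb R^d)$ with $$\|f\|_{M^{p,q}_{(\omega)}}=\Big\|\,\xi\mapsto\|(V_\phi f\cdot\omega)(\cdot,\xi)\|_{L^p}\Big\|_{L^q}<\infty,\qquad \|f\|_{W^{p,q}_{(\omega)}}=\Big\|\,x\mapsto\|(V_\phi f\cdot\omega)(x,\cdot)\|_{L^q}\Big\|_{L^p}<\infty ,$$ respectively. Let $M^{p,q}_{(\omega)}+W^{q,p}_{(\omega)}$ carry the quasi-norm $\|f\|=\inf_{f=f_1+f_2}(\|f_1\|_{M^{p,q}_{(\omega)}}+\|f_2\|_{W^{q,p}_{(\omega)}})$. For a space $\mathcal B\subseteq\Sigma_1'(\mathbb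 R^d)$ with quasi-norm $\|\cdot\|_{\mathcal B}$ and $r\in(0,\infty]$, $L^r([0,T];\mathcal B)$ and $L^r_{\mathrm w}([0,T];\mathcal B)$ consist of those $u$ on $[0,T]$ with $u(t)\in\mathcal B$ for a.e. $t$, with measurable Hermite coefficients and measurable $t\mapsto\|u(t)\|_{\mathcal B}$, for which this function belongs to $L^r[0,T]$, respectively to weak $L^r[0,T]$ (weak $L^\infty$ being $L^\infty$). **Theorem.** (1) Let $r_0\in(0,\infty]$ satisfy $\frac1{r_0}=d\big(\frac1q-\frac1p\big)$. Then $\Sigma_1(\mathbb R^d)\subseteq M^{p,q}_{(\omega)}+W^{q,p}_{(\omega)}$, and $E$ on $\Sigma_1(\mathbb R^d)$ is uniquely extendable to a continuous map $$E:\ M^{p,q}_{(\omega)}+W^{q,p}_{(\omega)}\to L^{r_0}_{\mathrm w}([0,T];M^{q,p}_{(\omega)})\cap L^{r_0}_{\mathrm w}([0,T];W^{p,q}_{(\omega)}).$$ The extension is $f\mapsto(t\mapsto e^{-itH_{x,c}}f)$, and there is a constant $C\ge0$, independent of $f$, with $$\|Ef\|_{L^{r_0}_{\mathrm w}([0,T];M^{q,p}_{(\omega)})}+\|Ef\|_{L^{r_0}_{\mathrm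 w}([0,T];W^{p,q}_{(\omega)})}\le C\,\|f\|_{M^{p,q}_{(\omega)}+W^{q,p}_{(\omega)}},\qquad f\in M^{p,q}_{(\omega)}+W^{q,p}_{(\omega)}.$$ Here the extension is continuous for the quasi-norms and, at almost every time, sequentially continuous for the weak* topology of $\Sigma_1'(\mathbb R^d)$. Up to null sets of times it is the only extension into the displayed target space with the latter continuity property and, if $p<\infty$, also the only one which is continuous for the quasi-norms. (2) If $r_0\in(0,\infty]$ instead satisfies $\frac1{r_0}>d\big(\frac1q-\frac1p\big)$, then everything in (1) holds with $L^{r_0}$ in place of $L^{r_0}_{\mathrm w}$. -/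

import Mathlib

open MeasureTheory Filter
open scoped ENNReal NNReal Topology ComplexConjugate

/-! ### Hermite functions and (ultra-)distributions as Hermite series -/

/-- The one-dimensional Hermite function
`h_n(x) = π^(-1/4) (-1)^n (2^n n!)^(-1/2) e^(x²/2) (d/dx)^n e^(-x²)`. -/
noncomputable def hermiteFunctionOne (n : ℕ) (x : ℝ) : ℝ :=
  Real.pi ^ (-(1 / 4) : ℝ) * (-1) ^ n * (2 ^ n * (n.factorial : ℝ)) ^ (-(1 / 2) : ℝ)
    * Real.exp (x ^ 2 / 2) * iteratedDeriv n (fun y : ℝ => Real.exp (-y ^ 2)) x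

/-- The Hermite function `h_α` on `ℝ^d`; it is the tensor product of one-dimensional ones. -/
noncomputable def hermiteFunction {d : ℕ} (α : Fin d → ℕ) (x : Fin d → ℝ) : ℝ :=
  ∏ j, hermiteFunctionOne (α j) (x j)

/-- The length `|α|` of a multi-index. -/
def multiLength {d : ℕ} (α : Fin d → ℕ) : ℕ := ∑ j, α j

/-- Formal Hermite series `∑_α c(α) h_α` on `ℝ^d`, represented by their coefficients. -/
abbrev HermiteSeries (d : ℕ) : Type := (Fin d → ℕ) → ℂ

/-- The Gelfand-Shilov space `Σ₁(ℝ^d)` of Beurling type, which is the space of all Hermite series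
with coefficients that are `O(e^(-r |α|^(1/2)))` for every `r > 0`. -/
def sigmaOne (d : ℕ) : Set (HermiteSeries d) :=
  {f | ∀ r : ℝ, 0 < r → ∃ C : ℝ, ∀ α, ‖f α‖ ≤ C * Real.exp (-r * √(multiLength α : ℝ))}

/-- The Gelfand-Shilov distribution space `Σ₁'(ℝ^d)`, which is the space of all Hermite series
with coefficients that are `O(e^(r |α|^(1/2)))` for some `r > 0`. -/
def sigmaOneDual (d : ℕ) : Set (HermiteSeries d) :=
  {f | ∃ r : ℝ, 0 < r ∧ ∃ C : ℝ, ∀ α, ‖f α‖ ≤ C * Real.exp (r * √(multiLength α : ℝ))}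

/-- The Hermite coefficients `(g, h_α)_{L²}` of a function `g` on `ℝ^d`. -/
noncomputable def hermiteCoeff {d : ℕ} (g : (Fin d → ℝ) → ℂ) : HermiteSeries d :=
  fun α => ∫ y, g y * (hermiteFunction α y : ℂ)

/-- The extension `(f, g) = ∑_α c(f, α) conj c(g, α)` of the `L²` scalar product, in particular
to `f ∈ Σ₁'` and `g ∈ Σ₁`. -/
noncomputable def hermitePairing {d : ℕ} (f g : HermiteSeries d) : ℂ :=
  ∑' α, f α * conj (g α)

/-- Sequential convergence in the weak* topology of `Σ₁'`. -/
def WeakStarTendsto {d : ℕ} (u : ℕ → HermiteSeries d) (f : HermiteSeries d) : Prop :=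
  ∀ g ∈ sigmaOne d, Tendsto (fun n => hermitePairing (u n) g) atTop (𝓝 (hermitePairing f g))

/-- The propagator `e^(-itH)` of `H = |x|² - Δ + c`, where `H h_α = (2|α| + d + c) h_α`. As a
function of `f` and `t` it is the operator `E`, i.e. `(E f)(t) = e^(-itH) f`. -/
noncomputable def oscPropagator {d : ℕ} (c : ℂ) (f : HermiteSeries d) (t : ℝ) : HermiteSeries d :=
  fun α => Complex.exp (-Complex.I * t * (2 * (multiLength α : ℂ) + d + c)) * f α

/-! ### Weights -/

/-- `ω ∈ L^∞_loc`. -/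
def MemLinftyLoc {E : Type*} [TopologicalSpace E] [MeasureSpace E] (ω : E → ℝ) : Prop :=
  ∀ K : Set E, IsCompact K → MemLp ω ∞ (volume.restrict K)

/-- Weights: positive functions `ω` with `ω, 1/ω ∈ L^∞_loc`. -/
structure IsWeight {E : Type*} [TopologicalSpace E] [MeasureSpace E] (ω : E → ℝ) : Prop where
  pos : ∀ x, 0 < ω x
  locBdd : MemLinftyLoc ω
  locBdd_inv : MemLinftyLoc (fun x => (ω x)⁻¹)

/-- `ω(x + y) ≲ ω(x) v(y)` for some positive `v ∈ L^∞_loc`. -/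
def IsModerate {E : Type*} [TopologicalSpace E] [MeasureSpace E] [Add E] (ω : E → ℝ) : Prop :=
  ∃ v : E → ℝ, (∀ y, 0 < v y) ∧ MemLinftyLoc v ∧
    ∃ C : ℝ, 0 < C ∧ ∀ x y, ω (x + y) ≤ C * (ω x * v y)

/-- Moderate weights on `ℝ^{2d}` which are radially symmetric in each phase space variable
`(x_j, ξ_j)`, i.e. `ω(x, ξ) = ω₀(ρ)` with `ρ_j = x_j² + ξ_j²` for some weight `ω₀` on `ℝ^d`. -/
structure IsModerateRadialWeight {d : ℕ} (ω : (Fin d → ℝ) × (Fin d → ℝ) → ℝ) : Prop where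
  isWeight : IsWeight ω
  isModerate : IsModerate ω
  radial : ∃ ω₀ : (Fin d → ℝ) → ℝ, IsWeight ω₀ ∧
    ∀ x ξ, ω (x, ξ) = ω₀ (fun j => x j ^ 2 + ξ j ^ 2)

/-! ### Short-time Fourier transform, modulation spaces and Wiener amalgam spaces -/

/-- The Gaussian window `φ(x) = π^(-d/4) e^(-|x|²/2)`. -/
noncomputable def gaussWindow {d : ℕ} (x : Fin d → ℝ) : ℝ :=
  Real.pi ^ (-(d / 4) : ℝ) * Real.exp (-(∑ j, x j ^ 2) / 2)

/-- The time-frequency shift `y ↦ φ(y - x) e^(i⟨y, ξ⟩)` of the window. -/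
noncomputable def shiftedWindow {d : ℕ} (x ξ y : Fin d → ℝ) : ℂ :=
  (gaussWindow (y - x) : ℂ) * Complex.exp (Complex.I * ((∑ j, y j * ξ j : ℝ) : ℂ))

/-- The short-time Fourier transform
`V_φ f(x, ξ) = (2π)^(-d/2) (f, φ(· - x) e^(i⟨·, ξ⟩))`. -/
noncomputable def stft {d : ℕ} (f : HermiteSeries d) (z : (Fin d → ℝ) × (Fin d → ℝ)) : ℂ :=
  ((2 * Real.pi) ^ (-(d / 2) : ℝ) : ℝ) * hermitePairing f (hermiteCoeff (shiftedWindow z.1 z.2))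

/-- The quasi-norm of `L^{p,q}`: first `L^p` in `x`, then `L^q` in `ξ`. -/
noncomputable def mixedNorm {d : ℕ} (p q : ℝ≥0∞) (F : (Fin d → ℝ) × (Fin d → ℝ) → ℂ) : ℝ≥0∞ :=
  eLpNorm (fun ξ => eLpNorm (fun x => F (x, ξ)) p volume) q volume

/-- The quasi-norm of `L^{p,q}_*`: first `L^q` in `ξ`, then `L^p` in `x`. -/
noncomputable def mixedNormStar {d : ℕ} (p q : ℝ≥0∞) (F : (Fin d → ℝ) × (Fin d → ℝ) → ℂ) :
    ℝ≥0∞ :=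
  eLpNorm (fun x => eLpNorm (fun ξ => F (x, ξ)) q volume) p volume

/-- The quasi-norm of `M^{p,q}_{(ω)}(ℝ^d)`, with value `∞` outside the space. -/
noncomputable def modNorm {d : ℕ} (ω : (Fin d → ℝ) × (Fin d → ℝ) → ℝ) (p q : ℝ≥0∞)
    (f : HermiteSeries d) : ℝ≥0∞ :=
  mixedNorm p q (fun z => stft f z * (ω z : ℂ))

/-- The quasi-norm of `W^{p,q}_{(ω)}(ℝ^d)`, with value `∞` outside the space. -/
noncomputable def wienerNorm {d : ℕ} (ω : (Fin d → ℝ) × (Fin d → ℝ) → ℝ) (p q : ℝ≥0∞)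
    (f : HermiteSeries d) : ℝ≥0∞ :=
  mixedNormStar p q (fun z => stft f z * (ω z : ℂ))

/-- The subspace of `Σ₁'` on which the quasi-norm `N` is finite. (For `f ∈ Σ₁'` the function
`V_φ f` is continuous, so measurability of `V_φ f · ω` is automatic.) -/
def finiteNormSpace {d : ℕ} (N : HermiteSeries d → ℝ≥0∞) : Set (HermiteSeries d) :=
  {f | f ∈ sigmaOneDual d ∧ N f < ∞}

/-- The modulation space `M^{p,q}_{(ω)}(ℝ^d)`. -/
def modSpace {d : ℕ} (ω : (Fin d → ℝ) × (Fin d → ℝ) → ℝ) (p q : ℝ≥0∞) : Set (HermiteSeries d) :=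
  finiteNormSpace (modNorm ω p q)

/-- The Wiener amalgam space `W^{p,q}_{(ω)}(ℝ^d)`. -/
def wienerSpace {d : ℕ} (ω : (Fin d → ℝ) × (Fin d → ℝ) → ℝ) (p q : ℝ≥0∞) :
    Set (HermiteSeries d) :=
  finiteNormSpace (wienerNorm ω p q)

/-- The space `M^{p,q}_{(ω)} + W^{q,p}_{(ω)}`. -/
def sumSpace {d : ℕ} (ω : (Fin d → ℝ) × (Fin d → ℝ) → ℝ) (p q : ℝ≥0∞) : Set (HermiteSeries d) :=
  {f | ∃ f₁ ∈ modSpace ω p q, ∃ f₂ ∈ wienerSpace ω q p, f = f₁ + f₂}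

/-- The quasi-norm of `M^{p,q}_{(ω)} + W^{q,p}_{(ω)}`, the infimum of `‖f₁‖ + ‖f₂‖` over all
decompositions `f = f₁ + f₂`. -/
noncomputable def sumNorm {d : ℕ} (ω : (Fin d → ℝ) × (Fin d → ℝ) → ℝ) (p q : ℝ≥0∞)
    (f : HermiteSeries d) : ℝ≥0∞ :=
  ⨅ (f₁ ∈ modSpace ω p q) (f₂ ∈ wienerSpace ω q p) (_ : f = f₁ + f₂),
    (modNorm ω p q f₁ + wienerNorm ω q p f₂)

/-! ### Lebesgue and weak Lebesgue spaces on `[0, T]` with values in a space of distributions -/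

/-- Lebesgue measure on `[0, T]`. -/
noncomputable def timeMeasure (T : ℝ) : Measure ℝ := volume.restrict (Set.Icc 0 T)

/-- The `L^r[0, T]` quasi-norm of a function `a ≥ 0`. -/
noncomputable def strongTimeNorm (T : ℝ) (r : ℝ≥0∞) (a : ℝ → ℝ≥0∞) : ℝ≥0∞ :=
  eLpNorm a r (timeMeasure T)

/-- The weak `L^r[0, T]` quasi-norm `sup_{s > 0} s |{a > s}|^(1/r)` of a function `a ≥ 0`; weak
`L^∞` is `L^∞`. -/
noncomputable def weakTimeNorm (T : ℝ) (r : ℝ≥0∞) (a : ℝ → ℝ≥0∞) : ℝ≥0∞ :=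
  if r = ∞ then essSup a (timeMeasure T)
  else ⨆ s : ℝ≥0, (s : ℝ≥0∞) * timeMeasure T {t | (s : ℝ≥0∞) < a t} ^ (1 / r.toReal)

/-- `u` belongs to the space of functions on `[0, T]` with values in the space given by the
quasi-norm `N`, with respect to the quasi-norm `L` in the time variable. Measurability of `u` means
that all its Hermite coefficients and its `N`-quasi-norm are measurable functions of time. -/
structure MemTimeSpace {d : ℕ} (T : ℝ) (L : (ℝ → ℝ≥0∞) → ℝ≥0∞) (N : HermiteSeries d → ℝ≥0∞)
    (u : ℝ → HermiteSeries d) : Prop where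
  measurable_coeff : ∀ α, AEMeasurable (fun t => u t α) (timeMeasure T)
  measurable_norm : AEMeasurable (fun t => N (u t)) (timeMeasure T)
  mem : ∀ᵐ t ∂timeMeasure T, u t ∈ finiteNormSpace N
  finite : L (fun t => N (u t)) < ∞

/-- `𝓔` maps `M^{p,q}_{(ω)} + W^{q,p}_{(ω)}` into
`L([0,T]; M^{q,p}_{(ω)}) ∩ L([0,T]; W^{p,q}_{(ω)})` and agrees with `E` on `Σ₁`. -/
structure IsPropagatorExtension {d : ℕ} (c : ℂ) (T : ℝ)
    (ω : (Fin d → ℝ) × (Fin d → ℝ) → ℝ) (p q : ℝ≥0∞) (L : (ℝ → ℝ≥0∞) → ℝ≥0∞)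
    (𝓔 : HermiteSeries d → ℝ → HermiteSeries d) : Prop where
  mapsTo_mod : ∀ f ∈ sumSpace ω p q, MemTimeSpace T L (modNorm ω q p) (𝓔 f)
  mapsTo_wiener : ∀ f ∈ sumSpace ω p q, MemTimeSpace T L (wienerNorm ω p q) (𝓔 f)
  eq_on_sigmaOne : ∀ f ∈ sigmaOne d, ∀ᵐ t ∂timeMeasure T, 𝓔 f t = oscPropagator c f t

/-- Continuity of `𝓔` from `M^{p,q}_{(ω)} + W^{q,p}_{(ω)}` to
`L([0,T]; M^{q,p}_{(ω)}) ∩ L([0,T]; W^{p,q}_{(ω)})` with respect to the quasi-norms. -/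
def IsNormContinuous {d : ℕ} (ω : (Fin d → ℝ) × (Fin d → ℝ) → ℝ) (p q : ℝ≥0∞)
    (L : (ℝ → ℝ≥0∞) → ℝ≥0∞) (𝓔 : HermiteSeries d → ℝ → HermiteSeries d) : Prop :=
  ∀ f ∈ sumSpace ω p q, ∀ ε : ℝ≥0∞, 0 < ε → ∃ δ : ℝ≥0∞, 0 < δ ∧
    ∀ g ∈ sumSpace ω p q, sumNorm ω p q (g - f) < δ →
      L (fun t => modNorm ω q p (𝓔 g t - 𝓔 f t))
        + L (fun t => wienerNorm ω p q (𝓔 g t - 𝓔 f t)) < ε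

/-- Sequential continuity of `𝓔` on `M^{p,q}_{(ω)} + W^{q,p}_{(ω)}` with respect to the weak*
topology of `Σ₁'`, at almost every time. -/
def IsWeakStarContinuous {d : ℕ} (T : ℝ) (ω : (Fin d → ℝ) × (Fin d → ℝ) → ℝ) (p q : ℝ≥0∞)
    (𝓔 : HermiteSeries d → ℝ → HermiteSeries d) : Prop :=
  ∀ (u : ℕ → HermiteSeries d) (f : HermiteSeries d),
    (∀ n, u n ∈ sumSpace ω p q) → f ∈ sumSpace ω p q → WeakStarTendsto u f →
      ∀ᵐ t ∂timeMeasure T, WeakStarTendsto (fun n => 𝓔 (u n) t) (𝓔 f t)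

/-- The operator `E` on `Σ₁` is uniquely extendable to a continuous map from
`M^{p,q}_{(ω)} + W^{q,p}_{(ω)}` to `L([0,T]; M^{q,p}_{(ω)}) ∩ L([0,T]; W^{p,q}_{(ω)})`, and the
extension is `f ↦ e^(-itH) f`. Uniqueness holds among the weak* continuous extensions and, if
`p < ∞`, also among the extensions which are continuous with respect to the quasi-norms.
(If `p = ∞`, then `Σ₁` is not dense with respect to the quasi-norm.) -/
structure StrichartzExtension {d : ℕ} (c : ℂ) (T : ℝ)
    (ω : (Fin d → ℝ) × (Fin d → ℝ) → ℝ) (p q : ℝ≥0∞) (L : (ℝ → ℝ≥0∞) → ℝ≥0∞) : Prop where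
  sigmaOne_subset : sigmaOne d ⊆ sumSpace ω p q
  isExtension : IsPropagatorExtension c T ω p q L (oscPropagator c)
  estimate : ∃ C : ℝ≥0, ∀ f ∈ sumSpace ω p q,
    L (fun t => modNorm ω q p (oscPropagator c f t))
      + L (fun t => wienerNorm ω p q (oscPropagator c f t)) ≤ C * sumNorm ω p q f
  normContinuous : IsNormContinuous ω p q L (oscPropagator c)
  weakStarContinuous : IsWeakStarContinuous T ω p q (oscPropagator c)
  unique_weakStar : ∀ 𝓔 : HermiteSeries d → ℝ → HermiteSeries d,
    IsPropagatorExtension c T ω p q L 𝓔 → IsWeakStarContinuous T ω p q 𝓔 →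
      ∀ f ∈ sumSpace ω p q, ∀ᵐ t ∂timeMeasure T, 𝓔 f t = oscPropagator c f t
  unique_norm : p ≠ ∞ → ∀ 𝓔 : HermiteSeries d → ℝ → HermiteSeries d,
    IsPropagatorExtension c T ω p q L 𝓔 → IsNormContinuous ω p q L 𝓔 →
      ∀ f ∈ sumSpace ω p q, ∀ᵐ t ∂timeMeasure T, 𝓔 f t = oscPropagator c f t

/-! The theorem is read off in phase space. Up to a common factor of modulus e^(-|z|²/4), the
Hermite coefficients of a Gaussian centred at z = (x, ξ) are the normalized monomials in the complex
variables x_j + iξ_j (`hermiteCoeff_shiftedWindow`, `coherentCoeff_eq`). So |V_φ f| is e^(-|z|²/4)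
times the modulus of a power series in their conjugates, and multiplying the coefficient with index
α by the power |α| of conj a amounts to the complex dilation z ↦ az (`norm_stft_dilate`). The
propagator has a = e^(2it): up to the factor e^(t Im c), |V_φ (Ef)(t)| is |V_φ f| rotated by the
angle 2t in every plane (x_j, ξ_j), and the weight is invariant under this rotation.

What remains concerns mixed norms under linear maps. Composition with a map of determinant ±1 and
lower left entry k sends L^{p,q} to L^{q,p} with norm at most |k|^(-d(1/q-1/p)), by a substitution
and Minkowski's inequality with exponent p/q ≥ 1 (`mixNorm_comp_phaseMap_le`). Passing between M and
W interchanges x and ξ, so k is ±sin 2t or ±cos 2t, and in all cases |k| ≥ |sin 4t|/2. The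
fixed-time bound is thus a multiple of (|sin 4t|/2)^(-d(1/q-1/p)) (`phaseNorm_oscPropagator_le`).
Since sin 4t has simple zeros, this kernel belongs to weak L^{r₀}[0,T] at the endpoint and to
L^{r₀}[0,T] in the case of strict inequality. The rest of the argument treats both time norms at
once through `IsDispersiveTimeNorm`.

Uniqueness among weak* continuous extensions holds because Hermite truncations lie in Σ₁ and
converge weakly*. For the quasi-norms and p < ∞, Σ₁ is dense: the Mehler factors r^|α| dilate phase
space by r and gain a Gaussian (`tendsto_phaseNorm_mehler_sub`). Smallness of the time norm forces
smallness in measure, and an element of Σ₁' with vanishing short-time Fourier transform is zero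
(`eq_zero_of_stft_eq_zero`), so two continuous extensions agree at almost every time. -/

/-! ### Mixed norms of functions with values in `[0, ∞]` -/

section MixedNorm

variable {α β : Type*} [MeasurableSpace α] [MeasurableSpace β]

/-- The mixed norm of a function on a product: `L^p` in the first variable, then `L^q` in the
second one. -/
noncomputable def mixNorm (μ : Measure α) (ν : Measure β) (p q : ℝ≥0∞) (G : α × β → ℝ≥0∞) :
    ℝ≥0∞ :=
  eLpNorm (fun y => eLpNorm (fun x => G (x, y)) p μ) q ν

theorem eLpNorm_mono_ennreal {μ : Measure α} {p : ℝ≥0∞} {f g : α → ℝ≥0∞} (h : f ≤ᵐ[μ] g) :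
    eLpNorm f p μ ≤ eLpNorm g p μ :=
  eLpNorm_mono_enorm_ae (by filter_upwards [h] with x hx using by simpa using hx)

theorem eLpNorm_eq_lintegral_ennreal {μ : Measure α} {p : ℝ≥0∞} (hp : p ≠ 0) (hp' : p ≠ ∞)
    (f : α → ℝ≥0∞) : eLpNorm f p μ = (∫⁻ x, f x ^ p.toReal ∂μ) ^ (1 / p.toReal) := by
  simp [eLpNorm_eq_lintegral_rpow_enorm_toReal hp hp']

theorem eLpNorm_top_ennreal {μ : Measure α} (f : α → ℝ≥0∞) : eLpNorm f ∞ μ = essSup f μ := by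
  simp [eLpNorm_exponent_top, eLpNormEssSup]

theorem eLpNorm_const_mul_ennreal {μ : Measure α} (p : ℝ≥0∞) {C : ℝ≥0∞} (hC : C ≠ ∞)
    (f : α → ℝ≥0∞) : eLpNorm (fun x => C * f x) p μ = C * eLpNorm f p μ := by
  rcases eq_or_ne p 0 with rfl | hp
  · simp
  rcases eq_or_ne p ∞ with rfl | hp'
  · simp only [eLpNorm_top_ennreal, ENNReal.essSup_const_mul]
  have hpos := ENNReal.toReal_pos hp hp'
  rw [eLpNorm_eq_lintegral_ennreal hp hp', eLpNorm_eq_lintegral_ennreal hp hp']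
  simp_rw [ENNReal.mul_rpow_of_nonneg _ _ hpos.le]
  rw [lintegral_const_mul' _ _ (by finiteness), ENNReal.mul_rpow_of_nonneg _ _ (by positivity),
    ← ENNReal.rpow_mul, mul_one_div_cancel hpos.ne', ENNReal.rpow_one]

theorem eLpNorm_eq_zero_ennreal {μ : Measure α} {p : ℝ≥0∞} (hp : p ≠ 0) {f : α → ℝ≥0∞}
    (hf : AEMeasurable f μ) (h : eLpNorm f p μ = 0) : f =ᵐ[μ] 0 := by
  rcases eq_or_ne p ∞ with rfl | hp'
  · rwa [eLpNorm_top_ennreal, ENNReal.essSup_eq_zero_iff] at h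
  have hpos := ENNReal.toReal_pos hp hp'
  rw [eLpNorm_eq_lintegral_ennreal hp hp', ENNReal.rpow_eq_zero_iff_of_pos (by positivity),
    lintegral_eq_zero_iff' (hf.pow_const _)] at h
  filter_upwards [h] with x hx
  simpa [ENNReal.rpow_eq_zero_iff_of_pos hpos] using hx

/-- An essential supremum is at most a exactly when the section of {f > a} is a null set, and
measures of sections depend measurably on the parameter. -/
theorem measurable_essSup_prod {μ : Measure α} [SFinite μ] {f : α × β → ℝ≥0∞}
    (hf : Measurable f) : Measurable (fun y => essSup (fun x => f (x, y)) μ) := by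
  refine measurable_of_Iic fun a => ?_
  have h1 : (fun y => essSup (fun x => f (x, y)) μ) ⁻¹' Set.Iic a =
      (fun y => μ ((fun x => (x, y)) ⁻¹' {z | a < f z})) ⁻¹' {0} := by
    ext y
    simp only [Set.mem_preimage, Set.mem_Iic, Set.mem_singleton_iff, Set.preimage_ofPred_eq]
    constructor
    · intro h
      have := ENNReal.ae_le_essSup (μ := μ) (fun x => f (x, y))
      rw [ae_iff] at this
      refine measure_mono_null ?_ this
      intro x hx
      simp only [Set.mem_ofPred_eq, not_le] at hx ⊢
      exact h.trans_lt hx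
    · intro h
      refine essSup_le_of_ae_le a ?_
      rw [Filter.EventuallyLE, ae_iff]
      simpa using h
  rw [h1]
  exact measurable_measure_prodMk_right (measurableSet_lt measurable_const hf)
    (measurableSet_singleton 0)

theorem measurable_eLpNorm_prod {μ : Measure α} [SFinite μ] (p : ℝ≥0∞) {f : α × β → ℝ≥0∞}
    (hf : Measurable f) : Measurable (fun y => eLpNorm (fun x => f (x, y)) p μ) := by
  rcases eq_or_ne p 0 with rfl | hp
  · simp
  rcases eq_or_ne p ∞ with rfl | hp'
  · simpa only [eLpNorm_top_ennreal] using measurable_essSup_prod hf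
  simp only [eLpNorm_eq_lintegral_ennreal hp hp']
  exact (Measurable.lintegral_prod_left (hf.pow_const _)).pow_const _

variable {μ : Measure α} {ν : Measure β} {p q : ℝ≥0∞} {F G : α × β → ℝ≥0∞}

/-- `mixNorm` takes the norm in the first variable first, so null sets of the product have to be
sliced in the order opposite to the usual one. -/
theorem ae_ae_of_ae_prod_swap [SFinite μ] [SFinite ν] {P : α × β → Prop}
    (h : ∀ᵐ z ∂μ.prod ν, P z) : ∀ᵐ y ∂ν, ∀ᵐ x ∂μ, P (x, y) := by
  have h' : ∀ᵐ z ∂ν.prod μ, P z.swap :=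
    (Measure.measurePreserving_swap (μ := ν) (ν := μ)).quasiMeasurePreserving.ae h
  exact Measure.ae_ae_of_ae_prod h'

theorem mixNorm_mono_ae_ae (h : ∀ᵐ y ∂ν, ∀ᵐ x ∂μ, F (x, y) ≤ G (x, y)) :
    mixNorm μ ν p q F ≤ mixNorm μ ν p q G := by
  refine eLpNorm_mono_ennreal ?_
  filter_upwards [h] with y hy using eLpNorm_mono_ennreal hy

theorem mixNorm_mono_ae [SFinite μ] [SFinite ν] (h : F ≤ᵐ[μ.prod ν] G) :
    mixNorm μ ν p q F ≤ mixNorm μ ν p q G :=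
  mixNorm_mono_ae_ae (ae_ae_of_ae_prod_swap h)

theorem mixNorm_mono (h : ∀ z, F z ≤ G z) : mixNorm μ ν p q F ≤ mixNorm μ ν p q G :=
  mixNorm_mono_ae_ae (.of_forall fun _ => .of_forall fun _ => h _)

theorem mixNorm_congr_ae [SFinite μ] [SFinite ν] (h : F =ᵐ[μ.prod ν] G) :
    mixNorm μ ν p q F = mixNorm μ ν p q G :=
  le_antisymm (mixNorm_mono_ae h.le) (mixNorm_mono_ae h.symm.le)

theorem mixNorm_const_mul {C : ℝ≥0∞} (hC : C ≠ ∞) :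
    mixNorm μ ν p q (fun z => C * G z) = C * mixNorm μ ν p q G := by
  simp only [mixNorm, eLpNorm_const_mul_ennreal _ hC]

/-- The constants `LpAddConst` account for exponents below 1. Measurable representatives are used so
that the inner norms are measurable in the outer variable. -/
theorem mixNorm_add_le [SFinite μ] [SFinite ν] (hF : AEMeasurable F (μ.prod ν))
    (hG : AEMeasurable G (μ.prod ν)) :
    mixNorm μ ν p q (fun z => F z + G z) ≤
      ENNReal.LpAddConst p * ENNReal.LpAddConst q * (mixNorm μ ν p q F + mixNorm μ ν p q G) := by
  have key : ∀ F G : α × β → ℝ≥0∞, Measurable F → Measurable G →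
      mixNorm μ ν p q (fun z => F z + G z) ≤
        ENNReal.LpAddConst p * ENNReal.LpAddConst q * (mixNorm μ ν p q F + mixNorm μ ν p q G) := by
    intro F G hF hG
    calc mixNorm μ ν p q (fun z => F z + G z)
        ≤ eLpNorm (fun y => ENNReal.LpAddConst p * (eLpNorm (fun x => F (x, y)) p μ +
            eLpNorm (fun x => G (x, y)) p μ)) q ν := by
          refine eLpNorm_mono_ennreal (.of_forall fun y => ?_)
          exact eLpNorm_add_le' (hF.comp measurable_prodMk_right).aestronglyMeasurable
            (hG.comp measurable_prodMk_right).aestronglyMeasurable p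
      _ = ENNReal.LpAddConst p * eLpNorm (fun y => (eLpNorm (fun x => F (x, y)) p μ +
            eLpNorm (fun x => G (x, y)) p μ)) q ν :=
          eLpNorm_const_mul_ennreal _ (ENNReal.LpAddConst_lt_top p).ne _
      _ ≤ ENNReal.LpAddConst p *
          (ENNReal.LpAddConst q * (mixNorm μ ν p q F + mixNorm μ ν p q G)) := by
          gcongr
          exact eLpNorm_add_le' (measurable_eLpNorm_prod p hF).aestronglyMeasurable
            (measurable_eLpNorm_prod p hG).aestronglyMeasurable q
      _ = _ := by rw [mul_assoc]
  rw [mixNorm_congr_ae hF.ae_eq_mk, mixNorm_congr_ae hG.ae_eq_mk,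
    show mixNorm μ ν p q (fun z => F z + G z) =
      mixNorm μ ν p q (fun z => hF.mk F z + hG.mk G z) from
      mixNorm_congr_ae (hF.ae_eq_mk.add hG.ae_eq_mk)]
  exact key _ _ hF.measurable_mk hG.measurable_mk

theorem mixNorm_eq_zero [SFinite μ] [SFinite ν] (hp : p ≠ 0) (hq : q ≠ 0)
    (hG : AEMeasurable G (μ.prod ν)) (h : mixNorm μ ν p q G = 0) : G =ᵐ[μ.prod ν] 0 := by
  rw [mixNorm_congr_ae hG.ae_eq_mk] at h
  refine hG.ae_eq_mk.trans ?_
  have hm := hG.measurable_mk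
  have h1 := eLpNorm_eq_zero_ennreal hq (measurable_eLpNorm_prod p hm).aemeasurable h
  have h2 : ∀ᵐ y ∂ν, ∀ᵐ x ∂μ, hG.mk G (x, y) = 0 := by
    filter_upwards [h1] with y hy
    exact eLpNorm_eq_zero_ennreal hp (hm.comp measurable_prodMk_right).aemeasurable hy
  have h3 : ∀ᵐ z ∂ν.prod μ, hG.mk G z.swap = 0 :=
    (Measure.ae_prod_iff_ae_ae (measurableSet_eq_fun (hm.comp measurable_swap)
      measurable_const)).2 h2
  exact (Measure.measurePreserving_swap (μ := μ) (ν := ν)).quasiMeasurePreserving.ae h3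

theorem measurable_mixNorm {γ : Type*} [MeasurableSpace γ] [SFinite μ] [SFinite ν]
    {H : γ × (α × β) → ℝ≥0∞} (hH : Measurable H) :
    Measurable (fun t => mixNorm μ ν p q (fun z => H (t, z))) := by
  refine measurable_eLpNorm_prod (μ := ν) q (f := fun yt : β × γ =>
    eLpNorm (fun x => H (yt.2, (x, yt.1))) p μ) ?_
  exact measurable_eLpNorm_prod (μ := μ) p (f := fun z : α × (β × γ) => H (z.2.2, (z.1, z.2.1)))
    (hH.comp (by fun_prop))

/-- Monotone convergence from above for the p-th powers. It needs p < ∞, and this is the origin of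
the restriction p < ∞ in the density of Σ₁. -/
theorem tendsto_eLpNorm_of_antitone {μ : Measure α} {p : ℝ≥0∞} (hp : p ≠ 0) (hp' : p ≠ ∞)
    {f : ℕ → α → ℝ≥0∞} (hf : ∀ n, AEMeasurable (f n) μ)
    (hanti : ∀ᵐ x ∂μ, Antitone fun n => f n x) (hfin : eLpNorm (f 0) p μ ≠ ∞)
    (hlim : ∀ᵐ x ∂μ, Tendsto (fun n => f n x) atTop (𝓝 0)) :
    Tendsto (fun n => eLpNorm (f n) p μ) atTop (𝓝 0) := by
  have hpos := ENNReal.toReal_pos hp hp'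
  simp only [eLpNorm_eq_lintegral_ennreal hp hp'] at hfin ⊢
  have h0 : ∫⁻ x, f 0 x ^ p.toReal ∂μ ≠ ∞ := by
    intro h
    simp [h, hpos] at hfin
  have h1 : Tendsto (fun n => ∫⁻ x, f n x ^ p.toReal ∂μ) atTop (𝓝 (∫⁻ _, 0 ∂μ)) := by
    refine lintegral_tendsto_of_tendsto_of_antitone (fun n => (hf n).pow_const _) ?_ h0 ?_
    · filter_upwards [hanti] with x hx m n hmn
      exact ENNReal.rpow_le_rpow (hx hmn) hpos.le
    · filter_upwards [hlim] with x hx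
      simpa [hpos, Function.comp_def] using
        (ENNReal.continuous_rpow_const (y := p.toReal)).continuousAt.tendsto.comp hx
  have h2 := (ENNReal.continuous_rpow_const (y := 1 / p.toReal)).continuousAt.tendsto.comp h1
  simpa [Function.comp_def, hpos] using h2

theorem eLpNorm_ne_top_ae {μ : Measure α} {p : ℝ≥0∞} (hp : p ≠ 0)
    {f : α → ℝ≥0∞} (hf : AEMeasurable f μ) (h : eLpNorm f p μ ≠ ∞) : ∀ᵐ x ∂μ, f x ≠ ∞ := by
  rcases eq_or_ne p ∞ with rfl | hp'
  · rw [eLpNorm_top_ennreal] at h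
    filter_upwards [ENNReal.ae_le_essSup (μ := μ) f] with x hx
    exact (hx.trans_lt h.lt_top).ne
  have hpos := ENNReal.toReal_pos hp hp'
  rw [eLpNorm_eq_lintegral_ennreal hp hp'] at h
  have h0 : ∫⁻ x, f x ^ p.toReal ∂μ ≠ ∞ := by
    intro h'
    simp [h', hpos] at h
  filter_upwards [ae_lt_top' (hf.pow_const _) h0] with x hx hx'
  simp [hx', hpos] at hx

/-- The mixed norms of a decreasing sequence of functions with limit zero tend to zero. -/
theorem tendsto_mixNorm_of_antitone [SFinite μ] [SFinite ν] (hp : p ≠ 0) (hp' : p ≠ ∞)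
    (hq : q ≠ 0) (hq' : q ≠ ∞) {f : ℕ → α × β → ℝ≥0∞} (hf : ∀ n, AEMeasurable (f n) (μ.prod ν))
    (hanti : ∀ z, Antitone fun n => f n z) (hfin : mixNorm μ ν p q (f 0) ≠ ∞)
    (hlim : ∀ z, Tendsto (fun n => f n z) atTop (𝓝 0)) :
    Tendsto (fun n => mixNorm μ ν p q (f n)) atTop (𝓝 0) := by
  have hmk : ∀ᵐ z ∂μ.prod ν, ∀ n, f n z = (hf n).mk (f n) z :=
    ae_all_iff.2 fun n => (hf n).ae_eq_mk
  have hmk' := ae_ae_of_ae_prod_swap hmk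
  have hinner : ∀ n, AEMeasurable (fun y => eLpNorm (fun x => f n (x, y)) p μ) ν := by
    intro n
    refine ⟨_, measurable_eLpNorm_prod (μ := μ) p (hf n).measurable_mk, ?_⟩
    filter_upwards [hmk'] with y hy
    refine eLpNorm_congr_ae ?_
    filter_upwards [hy] with x hx using hx n
  have hin : ∀ n, ∀ᵐ y ∂ν, AEMeasurable (fun x => f n (x, y)) μ := by
    intro n
    filter_upwards [hmk'] with y hy
    refine ⟨_, (hf n).measurable_mk.comp (measurable_prodMk_right (y := y)), ?_⟩
    filter_upwards [hy] with x hx using hx n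
  refine tendsto_eLpNorm_of_antitone hq hq' hinner (.of_forall fun y m n hmn => ?_) hfin ?_
  · exact eLpNorm_mono_ennreal (.of_forall fun x => hanti _ hmn)
  -- A finite outer norm makes almost every inner norm finite, which is what convergence from above
  -- requires in the inner variable.
  · filter_upwards [eLpNorm_ne_top_ae hq (hinner 0) hfin, ae_all_iff.2 hin] with y hy hy'
    exact tendsto_eLpNorm_of_antitone hp hp' hy' (.of_forall fun x => hanti _) hy
      (.of_forall fun x => hlim _)

/-- Minkowski's integral inequality. -/
theorem lintegral_lintegral_rpow_le [SigmaFinite μ] [SFinite ν] {P : ℝ} (hP : 1 ≤ P)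
    {f : α × β → ℝ≥0∞} (hf : Measurable f) :
    (∫⁻ x, (∫⁻ y, f (x, y) ∂ν) ^ P ∂μ) ^ (1 / P) ≤
      ∫⁻ y, (∫⁻ x, f (x, y) ^ P ∂μ) ^ (1 / P) ∂ν := by
  rcases hP.eq_or_lt with rfl | hP
  · simp only [ENNReal.rpow_one, div_one]
    exact (lintegral_lintegral_swap (f := fun x y => f (x, y)) hf.aemeasurable).le
  have hP0 : 0 < P := by linarith
  set S : α → ℝ≥0∞ := fun x => ∫⁻ y, f (x, y) ∂ν with hS
  have hSm : Measurable S := hf.lintegral_prod_right'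
  set R := ∫⁻ y, (∫⁻ x, f (x, y) ^ P ∂μ) ^ (1 / P) ∂ν with hR
  -- S is cut off in height and to sets of finite measure, so that the integral I below is finite
  -- and a power of it can be cancelled.
  let g : ℕ → α → ℝ≥0∞ := fun n => (spanningSets μ n).indicator fun x => min (S x) n
  have hgm : ∀ n, Measurable (g n) := fun n =>
    (hSm.min measurable_const).indicator (measurableSet_spanningSets μ n)
  have hgS : ∀ n x, g n x ≤ S x := fun n x => by
    by_cases hx : x ∈ spanningSets μ n <;> simp [g, hx]
  have hfin : ∀ n, ∫⁻ x, g n x ^ P ∂μ ≠ ∞ := by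
    intro n
    refine ne_of_lt (lt_of_le_of_lt (b := ∫⁻ x, (spanningSets μ n).indicator
      (fun _ => (n : ℝ≥0∞) ^ P) x ∂μ) (lintegral_mono fun x => ?_) ?_)
    · by_cases hx : x ∈ spanningSets μ n
      · simpa [g, hx] using ENNReal.rpow_le_rpow (min_le_right (S x) n) hP0.le
      · simp [g, hx, hP0]
    · rw [lintegral_indicator_const (measurableSet_spanningSets μ n)]
      exact ENNReal.mul_lt_top (by finiteness) (measure_spanningSets_lt_top μ n)
  have hc : P.HolderConjugate (P / (P - 1)) := Real.HolderConjugate.conjExponent hP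
  have hstep : ∀ n, (∫⁻ x, g n x ^ P ∂μ) ^ (1 / P) ≤ R := by
    intro n
    set I := ∫⁻ x, g n x ^ P ∂μ with hI
    rcases eq_or_ne I 0 with h0 | h0
    · simp [h0, hP0]
    -- Duality: one factor g is replaced by S, the order of integration is exchanged, and Hölder is
    -- applied in x for each y. The conjugate power of g^(P-1) is again g^P.
    have h1 : I ≤ R * I ^ (1 / (P / (P - 1))) := by
      calc I ≤ ∫⁻ x, S x * g n x ^ (P - 1) ∂μ := by
            refine lintegral_mono fun x => ?_
            rcases eq_or_ne (g n x) 0 with hx | hx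
            · simp [hx, hP0]
            have hx' : g n x ≠ ∞ := by
              refine ne_of_lt (lt_of_le_of_lt (b := (n : ℝ≥0∞)) ?_ (by simp))
              by_cases hx : x ∈ spanningSets μ n <;> simp [g, hx]
            calc g n x ^ P = g n x * g n x ^ (P - 1) := by
                  conv_rhs => lhs; rw [← ENNReal.rpow_one (g n x)]
                  rw [← ENNReal.rpow_add _ _ hx hx']
                  congr 1; ring
              _ ≤ _ := by gcongr; exact hgS n x
        _ = ∫⁻ x, ∫⁻ y, f (x, y) * g n x ^ (P - 1) ∂ν ∂μ := by
            refine lintegral_congr fun x => ?_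
            exact (lintegral_mul_const _ (hf.comp measurable_prodMk_left)).symm
        _ = ∫⁻ y, ∫⁻ x, f (x, y) * g n x ^ (P - 1) ∂μ ∂ν :=
            lintegral_lintegral_swap (f := fun x y => f (x, y) * g n x ^ (P - 1))
              (hf.mul (((hgm n).comp measurable_fst).pow_const _)).aemeasurable
        _ ≤ ∫⁻ y, (∫⁻ x, f (x, y) ^ P ∂μ) ^ (1 / P) * I ^ (1 / (P / (P - 1))) ∂ν := by
            refine lintegral_mono fun y => ?_
            refine (ENNReal.lintegral_mul_le_Lp_mul_Lq μ hc
              (hf.comp measurable_prodMk_right).aemeasurable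
              ((hgm n).pow_const (P - 1)).aemeasurable).trans_eq ?_
            congr 2
            refine lintegral_congr fun x => ?_
            rw [← ENNReal.rpow_mul]
            congr 1
            field_simp [sub_ne_zero.2 hP.ne']
        _ = R * I ^ (1 / (P / (P - 1))) := by
            rw [lintegral_mul_const'' _ ?_]
            exact ((hf.pow_const P).lintegral_prod_left'.pow_const _).aemeasurable
    have h2 : I ^ (1 / P) * I ^ (1 / (P / (P - 1))) = I := by
      rw [← ENNReal.rpow_add _ _ h0 (hfin n)]
      conv_rhs => rw [← ENNReal.rpow_one I]
      congr 1
      field_simp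
      ring
    have hP1 : 0 ≤ 1 / (P / (P - 1)) := by
      have := sub_pos.2 hP
      positivity
    have h3 : I ^ (1 / (P / (P - 1))) ≠ 0 := by
      rw [Ne, ENNReal.rpow_eq_zero_iff]
      rintro (h | h)
      · exact h0 h.1
      · exact hfin n h.1
    have h4 : I ^ (1 / (P / (P - 1))) ≠ ∞ := ENNReal.rpow_ne_top_of_nonneg hP1 (hfin n)
    exact (ENNReal.mul_le_mul_iff_left h3 h4).1 (h2.trans_le h1)
  have hlim : ∀ x, Tendsto (fun n => g n x ^ P) atTop (𝓝 (S x ^ P)) := by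
    intro x
    refine (ENNReal.continuous_rpow_const (y := P)).continuousAt.tendsto.comp ?_
    have h1 : Tendsto (fun n : ℕ => min (S x) n) atTop (𝓝 (min (S x) ∞)) :=
      tendsto_const_nhds.min ENNReal.tendsto_nat_nhds_top
    rw [min_eq_left le_top] at h1
    refine h1.congr' ?_
    obtain ⟨n, hn⟩ := Set.mem_iUnion.1 ((iUnion_spanningSets μ).symm ▸ Set.mem_univ x)
    filter_upwards [eventually_ge_atTop n] with m hm
    simp [g, monotone_spanningSets μ hm hn]
  -- Fatou's lemma removes the cut-off.
  have h5 : ∫⁻ x, S x ^ P ∂μ ≤ R ^ P := by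
    calc ∫⁻ x, S x ^ P ∂μ = ∫⁻ x, liminf (fun n => g n x ^ P) atTop ∂μ :=
          lintegral_congr fun x => (hlim x).liminf_eq.symm
      _ ≤ liminf (fun n => ∫⁻ x, g n x ^ P ∂μ) atTop :=
          lintegral_liminf_le fun n => (hgm n).pow_const _
      _ ≤ liminf (fun _ : ℕ => R ^ P) atTop := by
          refine liminf_le_liminf (.of_forall fun n => ?_)
          have := ENNReal.rpow_le_rpow (hstep n) hP0.le
          rwa [← ENNReal.rpow_mul, one_div_mul_cancel hP0.ne', ENNReal.rpow_one] at this
      _ = R ^ P := by simp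
  have := ENNReal.rpow_le_rpow h5 (z := 1 / P) (by positivity)
  rwa [← ENNReal.rpow_mul, mul_one_div_cancel hP0.ne', ENNReal.rpow_one] at this

end MixedNorm

/-! ### Linear changes of variables in mixed norms -/

section ChangeOfVariables

variable {d : ℕ}

/-- Since `p⁻¹.toReal` is 0 for p = ∞ and for p = 0, a single formula covers all exponents. -/
theorem eLpNorm_comp_affine {c : ℝ} (hc : c ≠ 0) (v : Fin d → ℝ) (p : ℝ≥0∞)
    {f : (Fin d → ℝ) → ℝ≥0∞} (hf : Measurable f) :
    eLpNorm (fun x => f (c • x + v)) p volume =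
      ENNReal.ofReal |c| ^ (-(d * p⁻¹.toReal)) * eLpNorm f p volume := by
  have hpos : 0 < ENNReal.ofReal |c| := by simpa using hc
  have hfac : ENNReal.ofReal |(c ^ Module.finrank ℝ (Fin d → ℝ))⁻¹| =
      ENNReal.ofReal |c| ^ (-(d : ℝ)) := by
    rw [Module.finrank_fin_fun, abs_inv, abs_pow, ENNReal.ofReal_inv_of_pos (by positivity),
      ENNReal.ofReal_pow (abs_nonneg c), ENNReal.rpow_neg, ENNReal.rpow_natCast]
  have h1 : eLpNorm (fun x => f (c • x + v)) p volume =
      eLpNorm (fun x => f (x + v)) p (Measure.map (c • ·) volume) := by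
    exact (eLpNorm_map_measure (g := fun x => f (x + v)) (f := fun x : Fin d → ℝ => c • x)
      (hf.comp (measurable_add_const v)).aestronglyMeasurable
      (measurable_const_smul c).aemeasurable).symm
  have h2 : eLpNorm (fun x => f (x + v)) p volume = eLpNorm f p volume :=
    eLpNorm_comp_measurePreserving hf.aestronglyMeasurable (measurePreserving_add_right volume v)
  rw [h1, Measure.map_addHaar_smul _ hc, hfac, eLpNorm_smul_measure_of_ne_zero _, h2, smul_eq_mul,
    ← ENNReal.rpow_mul, one_div, neg_mul]
  simp [ENNReal.rpow_eq_zero_iff, hc]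

/-- The linear map on phase space with real coefficients `a, b, c, e`, which acts in the same way
on all pairs `(x_j, ξ_j)`. -/
def phaseMap (a b c e : ℝ) (z : (Fin d → ℝ) × (Fin d → ℝ)) : (Fin d → ℝ) × (Fin d → ℝ) :=
  (a • z.1 + b • z.2, c • z.1 + e • z.2)

/-- An explicit left inverse shows that the determinant of the map on phase space is nonzero, so its
value is never needed. -/
theorem quasiMeasurePreserving_phaseMap {a b c e : ℝ} (h : a * e - b * c ≠ 0) :
    Measure.QuasiMeasurePreserving (phaseMap (d := d) a b c e) volume volume := by
  let lin : ℝ → ℝ → ℝ → ℝ → (((Fin d → ℝ) × (Fin d → ℝ)) →ₗ[ℝ] ((Fin d → ℝ) × (Fin d → ℝ))) :=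
    fun a b c e => LinearMap.prod (a • LinearMap.fst ℝ _ _ + b • LinearMap.snd ℝ _ _)
      (c • LinearMap.fst ℝ _ _ + e • LinearMap.snd ℝ _ _)
  have hcomp : lin (e / (a * e - b * c)) (-b / (a * e - b * c)) (-c / (a * e - b * c))
      (a / (a * e - b * c)) * lin a b c e = 1 := by
    apply LinearMap.ext
    intro z
    change phaseMap _ _ _ _ (phaseMap a b c e z) = z
    ext j
    · calc _ = (a * e - b * c) / (a * e - b * c) * z.1 j := by
            simp only [phaseMap, Pi.add_apply, Pi.smul_apply, smul_eq_mul]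
            ring
        _ = z.1 j := by rw [div_self h, one_mul]
    · calc _ = (a * e - b * c) / (a * e - b * c) * z.2 j := by
            simp only [phaseMap, Pi.add_apply, Pi.smul_apply, smul_eq_mul]
            ring
        _ = z.2 j := by rw [div_self h, one_mul]
  have hdet : LinearMap.det (lin a b c e) ≠ 0 := by
    intro h0
    have := congrArg LinearMap.det hcomp
    rw [map_mul, h0, mul_zero, map_one] at this
    exact zero_ne_one this
  have : (volume : Measure ((Fin d → ℝ) × (Fin d → ℝ))).IsAddHaarMeasure :=
    Measure.prod.instIsAddHaarMeasure _ _
  exact Measure.LinearMap.quasiMeasurePreserving volume (lin a b c e) hdet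

/-- G is bounded by S, its essential supremum in x, as a function of ξ alone. Along a line of fixed
second variable y the new second coordinate is cx + ey, so the L^q norm of S is only rescaled, by a
factor independent of y. The determinant serves to pull back null sets. -/
theorem mixNorm_comp_phaseMap_top_le (q : ℝ≥0∞) {a b c e : ℝ}
    (hc : c ≠ 0) (hD : a * e - b * c ≠ 0) {G : (Fin d → ℝ) × (Fin d → ℝ) → ℝ≥0∞}
    (hG : Measurable G) :
    mixNorm volume volume q ∞ (fun z => G (phaseMap a b c e z)) ≤
      ENNReal.ofReal |c| ^ (-(d * q⁻¹.toReal)) * mixNorm volume volume ∞ q G := by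
  obtain ⟨S, hS⟩ : ∃ S : (Fin d → ℝ) → ℝ≥0∞,
    S = fun y => eLpNorm (fun x => G (x, y)) ∞ volume := ⟨_, rfl⟩
  have hSm : Measurable S := hS ▸ measurable_eLpNorm_prod ∞ hG
  have h1 : ∀ᵐ y : Fin d → ℝ, ∀ᵐ x : Fin d → ℝ, G (x, y) ≤ S y := by
    refine .of_forall fun y => ?_
    simp only [hS, eLpNorm_top_ennreal]
    exact ENNReal.ae_le_essSup _
  have h2 : ∀ᵐ z : (Fin d → ℝ) × (Fin d → ℝ), G z ≤ S z.2 := by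
    have h3 : ∀ᵐ z : (Fin d → ℝ) × (Fin d → ℝ), G z.swap ≤ S z.swap.2 :=
      (Measure.ae_prod_iff_ae_ae (measurableSet_le (hG.comp measurable_swap)
        (hSm.comp (measurable_snd.comp measurable_swap)))).2 h1
    exact (Measure.measurePreserving_swap (μ := (volume : Measure (Fin d → ℝ)))
      (ν := (volume : Measure (Fin d → ℝ)))).quasiMeasurePreserving.ae h3
  have h4 := (quasiMeasurePreserving_phaseMap (d := d) hD).ae h2
  have h5 := ae_ae_of_ae_prod_swap (μ := (volume : Measure (Fin d → ℝ)))
    (ν := (volume : Measure (Fin d → ℝ))) h4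
  have h6 : mixNorm volume volume ∞ q G = eLpNorm S q volume := by rw [hS]; rfl
  rw [h6, mixNorm, eLpNorm_top_ennreal]
  refine essSup_le_of_ae_le _ ?_
  filter_upwards [h5] with y hy
  refine le_trans (eLpNorm_mono_ennreal hy) ?_
  exact (eLpNorm_comp_affine hc (e • y) q hSm).le

/-- With D = ae - bc, the substitution η = cx + eξ turns the first coordinate ax + bξ into (a/c)η -
(D/c)ξ and contributes |c|^(-d/q). Minkowski's inequality with exponent p/q then moves the L^p norm
in ξ inside the L^q norm in η, where it is a rescaled L^p norm of G(·, η) and contributes |c|^(d/p)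
because |D| = 1. -/
theorem mixNorm_comp_phaseMap_le {p q : ℝ≥0∞} (hq : 0 < q) (hqp : q ≤ p) {a b c e : ℝ}
    (hc : c ≠ 0) (hD : |a * e - b * c| = 1) {G : (Fin d → ℝ) × (Fin d → ℝ) → ℝ≥0∞}
    (hG : AEMeasurable G volume) :
    mixNorm volume volume q p (fun z => G (phaseMap a b c e z)) ≤
      ENNReal.ofReal |c| ^ (-(d * (q⁻¹.toReal - p⁻¹.toReal))) * mixNorm volume volume p q G := by
  have hD0 : a * e - b * c ≠ 0 := by
    intro h
    simp [h] at hD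
  have hL := quasiMeasurePreserving_phaseMap (d := d) hD0
  wlog hGm : Measurable G generalizing G
  · have h1 := this hG.measurable_mk.aemeasurable hG.measurable_mk
    have e1 : mixNorm volume volume p q G = mixNorm volume volume p q (hG.mk G) :=
      mixNorm_congr_ae hG.ae_eq_mk
    have e2 : mixNorm volume volume q p (fun z => G (phaseMap a b c e z)) =
        mixNorm volume volume q p (fun z => hG.mk G (phaseMap a b c e z)) :=
      mixNorm_congr_ae (hL.ae_eq_comp hG.ae_eq_mk)
    rwa [e1, e2]
  clear hG
  have hκ0 : ENNReal.ofReal |c| ≠ 0 := by simpa using hc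
  have hκ1 : ENNReal.ofReal |c| ≠ ∞ := ENNReal.ofReal_ne_top
  have hp0 : p ≠ 0 := (hq.trans_le hqp).ne'
  rcases eq_or_ne p ∞ with rfl | hp
  · simpa using mixNorm_comp_phaseMap_top_le q hc hD0 hGm
  have hq' : q ≠ ∞ := (hqp.trans_lt hp.lt_top).ne
  have hqr := ENNReal.toReal_pos hq.ne' hq'
  have hpr := ENNReal.toReal_pos hp0 hp
  have hqpr : q.toReal ≤ p.toReal := ENNReal.toReal_mono hp hqp
  set Q := q.toReal with hQ
  set R := p.toReal with hR
  set κ := ENNReal.ofReal |c| with hκ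
  have hP : 1 ≤ R / Q := (one_le_div hqr).2 hqpr
  have affine1 : ∀ (v : Fin d → ℝ) (f : (Fin d → ℝ) → ℝ≥0∞), Measurable f → ∀ c : ℝ, c ≠ 0 →
      ∫⁻ x, f (c • x + v) = ENNReal.ofReal |c| ^ (-(d : ℝ)) * ∫⁻ x, f x := by
    intro v f hf c hc
    have := eLpNorm_comp_affine hc v 1 hf
    simpa [eLpNorm_one_eq_lintegral_enorm] using this
  have inner : ∀ ξ : Fin d → ℝ, ∫⁻ x, G (phaseMap a b c e (x, ξ)) ^ Q =
      κ ^ (-(d : ℝ)) * ∫⁻ η, G ((-((a * e - b * c) / c)) • ξ + (a / c) • η, η) ^ Q := by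
    intro ξ
    rw [← affine1 (e • ξ) (fun η => G ((-((a * e - b * c) / c)) • ξ + (a / c) • η, η) ^ Q)
      ((hGm.comp (by fun_prop)).pow_const Q) c hc]
    refine lintegral_congr fun x => ?_
    congr 2
    simp only [phaseMap]
    congr 1
    ext j
    simp only [Pi.add_apply, Pi.smul_apply, smul_eq_mul]
    field_simp
    ring
  -- The slope in ξ is -D/c, of modulus 1/|c|; this inverse is why the exponent of |c| is positive
  -- here.
  have outer : ∀ η : Fin d → ℝ,
      (∫⁻ ξ, (G ((-((a * e - b * c) / c)) • ξ + (a / c) • η, η) ^ Q) ^ (R / Q)) ^ (1 / (R / Q)) =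
        κ ^ (d * (Q / R)) * eLpNorm (fun x => G (x, η)) p volume ^ Q := by
    intro η
    have hc' : -((a * e - b * c) / c) ≠ 0 := by simp [hD0, hc]
    rw [affine1 ((a / c) • η) (fun y => (G (y, η) ^ Q) ^ (R / Q))
      (((hGm.comp measurable_prodMk_right).pow_const Q).pow_const _) _ hc', abs_neg, abs_div, hD,
      eLpNorm_eq_lintegral_ennreal hp0 hp, one_div_div,
      ENNReal.mul_rpow_of_nonneg _ _ (by positivity), ← ENNReal.rpow_mul, ← ENNReal.rpow_mul]
    congr 1
    · rw [one_div, ENNReal.ofReal_inv_of_pos (by positivity), ENNReal.inv_rpow, ← ENNReal.rpow_neg]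
      congr 1
      ring
    · simp_rw [← ENNReal.rpow_mul]
      congr 2
      · ext x
        congr 1
        field_simp
        exact hR
      · rw [← hR]
        field_simp
  have hmeas : Measurable fun z : (Fin d → ℝ) × (Fin d → ℝ) =>
      G ((-((a * e - b * c) / c)) • z.1 + (a / c) • z.2, z.2) ^ Q :=
    (hGm.comp (by fun_prop)).pow_const Q
  have mink := lintegral_lintegral_rpow_le (μ := (volume : Measure (Fin d → ℝ)))
    (ν := (volume : Measure (Fin d → ℝ))) hP hmeas
  simp_rw [outer] at mink
  rw [lintegral_const_mul' _ _ (ENNReal.rpow_ne_top_of_ne_zero hκ0 hκ1)] at mink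
  have lhs : mixNorm volume volume q p (fun z => G (phaseMap a b c e z)) =
      κ ^ (-(d / Q)) * ((∫⁻ ξ, (∫⁻ η, G ((-((a * e - b * c) / c)) • ξ + (a / c) • η, η) ^ Q)
        ^ (R / Q)) ^ (1 / (R / Q))) ^ (1 / Q) := by
    rw [mixNorm, eLpNorm_eq_lintegral_ennreal hp0 hp]
    simp_rw [eLpNorm_eq_lintegral_ennreal hq.ne' hq', ← hQ, ← hR, inner, ← ENNReal.rpow_mul]
    have e1 : 1 / Q * R = R / Q := by ring
    have e2 : 1 / (R / Q) * (1 / Q) = 1 / R := by field_simp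
    rw [e1, e2]
    simp_rw [ENNReal.mul_rpow_of_nonneg _ _ (zero_le_one.trans hP), ← ENNReal.rpow_mul]
    rw [lintegral_const_mul' _ _ (ENNReal.rpow_ne_top_of_ne_zero hκ0 hκ1),
      ENNReal.mul_rpow_of_nonneg _ _ (by positivity), ← ENNReal.rpow_mul]
    congr 2
    field_simp
  rw [lhs]
  calc _ ≤ κ ^ (-(d / Q)) * (κ ^ (d * (Q / R)) *
        ∫⁻ η, eLpNorm (fun x => G (x, η)) p volume ^ Q) ^ (1 / Q) := by gcongr
    _ = _ := by
      rw [ENNReal.mul_rpow_of_nonneg _ _ (by positivity), ← mul_assoc, mixNorm,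
        eLpNorm_eq_lintegral_ennreal hq.ne' hq', ← ENNReal.rpow_mul,
        ← ENNReal.rpow_add _ _ hκ0 hκ1, ENNReal.toReal_inv, ENNReal.toReal_inv]
      congr 2
      rw [← hQ, ← hR]
      field_simp
      ring

theorem mixNorm_comp_smul {r : ℝ} (hr : r ≠ 0) (p q : ℝ≥0∞)
    {G : (Fin d → ℝ) × (Fin d → ℝ) → ℝ≥0∞} (hG : AEMeasurable G volume) :
    mixNorm volume volume p q (fun z => G (r • z)) =
      ENNReal.ofReal |r| ^ (-(d * q⁻¹.toReal)) *
        (ENNReal.ofReal |r| ^ (-(d * p⁻¹.toReal)) * mixNorm volume volume p q G) := by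
  wlog hGm : Measurable G generalizing G
  · have h1 := this hG.measurable_mk.aemeasurable hG.measurable_mk
    have e1 : mixNorm volume volume p q G = mixNorm volume volume p q (hG.mk G) :=
      mixNorm_congr_ae hG.ae_eq_mk
    have e2 : mixNorm volume volume p q (fun z => G (r • z)) =
        mixNorm volume volume p q (fun z => hG.mk G (r • z)) :=
      have : (volume : Measure ((Fin d → ℝ) × (Fin d → ℝ))).IsAddHaarMeasure :=
        Measure.prod.instIsAddHaarMeasure _ _
      mixNorm_congr_ae (μ := volume) (ν := volume)
        ((Measure.quasiMeasurePreserving_smul volume hr).ae_eq_comp hG.ae_eq_mk)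
    rwa [e1, e2]
  have hκ : ENNReal.ofReal |r| ^ (-(d * p⁻¹.toReal)) ≠ ∞ :=
    ENNReal.rpow_ne_top_of_ne_zero (by simpa using hr) ENNReal.ofReal_ne_top
  have h1 : ∀ y : Fin d → ℝ, eLpNorm (fun x => G (r • x, y)) p volume =
      ENNReal.ofReal |r| ^ (-(d * p⁻¹.toReal)) * eLpNorm (fun x => G (x, y)) p volume := by
    intro y
    simpa [Function.comp_def] using
      eLpNorm_comp_affine hr 0 p (hGm.comp (measurable_prodMk_right (y := y)))
  have h2 := eLpNorm_comp_affine hr 0 q (measurable_eLpNorm_prod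
    (μ := (volume : Measure (Fin d → ℝ))) p hGm)
  simp only [mixNorm, Prod.smul_mk, h1, eLpNorm_const_mul_ennreal _ hκ]
  simp only [add_zero] at h2
  rw [h2, mul_left_comm]

/-! ### Exponential majorants of finite mixed norm. -/

theorem eLpNorm_exp_neg_sum_abs_lt_top (p : ℝ≥0∞) :
    eLpNorm (fun x : Fin d → ℝ => ENNReal.ofReal (Real.exp (-∑ j, |x j|))) p volume < ∞ := by
  rcases eq_or_ne p 0 with rfl | hp
  · simp
  rcases eq_or_ne p ∞ with rfl | hp'
  · rw [eLpNorm_top_ennreal]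
    refine (essSup_le_of_ae_le 1 (.of_forall fun x => ?_)).trans_lt ENNReal.one_lt_top
    refine ENNReal.ofReal_le_one.2 (Real.exp_le_one_iff.2 ?_)
    exact neg_nonpos.2 (Finset.sum_nonneg fun j _ => abs_nonneg _)
  have hpos := ENNReal.toReal_pos hp hp'
  have h1 : Integrable (fun t : ℝ => Real.exp (-p.toReal * |t|)) := by
    have h2 : IntegrableOn (fun t : ℝ => Real.exp (-p.toReal * t)) (Set.Ioi 0) :=
      exp_neg_integrableOn_Ioi 0 hpos
    have h3 : IntegrableOn (fun t : ℝ => Real.exp (-p.toReal * |t|)) (Set.Ioi 0) :=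
      h2.congr_fun (fun t ht => by simp [abs_of_pos (Set.mem_Ioi.1 ht)]) measurableSet_Ioi
    have h5 : IntegrableOn (fun t : ℝ => Real.exp (-p.toReal * |t|)) (Set.Iic 0) := by
      have h6 : IntegrableOn (fun t : ℝ => Real.exp (-p.toReal * |t|)) (Set.Ioi (-0)) := by
        simpa using h3
      simpa using h6.comp_neg_Iio.congr_set_ae Iio_ae_eq_Iic.symm
    rw [← integrableOn_univ, ← Set.Iic_union_Ioi (a := (0 : ℝ))]
    exact h5.union h3
  have h4 : Integrable (fun x : Fin d → ℝ => ∏ j, Real.exp (-p.toReal * |x j|)) :=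
    Integrable.fintype_prod (f := fun (_ : Fin d) (t : ℝ) => Real.exp (-p.toReal * |t|))
      fun _ => h1
  rw [eLpNorm_eq_lintegral_ennreal hp hp']
  refine ENNReal.rpow_lt_top_of_nonneg (by positivity) (ne_of_lt ?_)
  refine lt_of_eq_of_lt (lintegral_congr fun x => ?_) h4.lintegral_lt_top
  rw [ENNReal.ofReal_rpow_of_pos (Real.exp_pos _), ← Real.exp_mul, ← Real.exp_sum]
  congr 2
  rw [← Finset.mul_sum]
  ring

theorem mixNorm_exp_neg_lt_top (p q : ℝ≥0∞) :
    mixNorm volume volume p q (fun z : (Fin d → ℝ) × (Fin d → ℝ) =>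
      ENNReal.ofReal (Real.exp (-∑ j, (|z.1 j| + |z.2 j|)))) < ∞ := by
  have h1 : ∀ x y : Fin d → ℝ, ENNReal.ofReal (Real.exp (-∑ j, (|x j| + |y j|))) =
      ENNReal.ofReal (Real.exp (-∑ j, |y j|)) * ENNReal.ofReal (Real.exp (-∑ j, |x j|)) := by
    intro x y
    rw [← ENNReal.ofReal_mul (Real.exp_pos _).le, ← Real.exp_add, Finset.sum_add_distrib]
    congr 2
    ring
  have h2 := (eLpNorm_exp_neg_sum_abs_lt_top (d := d) p).ne
  simp only [mixNorm, h1, eLpNorm_const_mul_ennreal _ ENNReal.ofReal_ne_top]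
  simp_rw [mul_comm (ENNReal.ofReal _) (eLpNorm _ p volume)]
  rw [eLpNorm_const_mul_ennreal _ h2]
  exact ENNReal.mul_lt_top h2.lt_top (eLpNorm_exp_neg_sum_abs_lt_top q)

end ChangeOfVariables

/-! ### Hermite coefficients of time-frequency shifted Gaussians -/

section CoherentStates

theorem exists_polynomial_iteratedDeriv_gaussian (n : ℕ) : ∃ P : Polynomial ℝ, ∀ y : ℝ,
    iteratedDeriv n (fun y : ℝ => Real.exp (-y ^ 2)) y = P.eval y * Real.exp (-y ^ 2) := by
  induction n with
  | zero => exact ⟨1, by simp⟩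
  | succ n ih =>
    obtain ⟨P, hP⟩ := ih
    refine ⟨Polynomial.derivative P - 2 * Polynomial.X * P, fun y => ?_⟩
    rw [iteratedDeriv_succ, funext hP]
    have h1 : HasDerivAt (fun y : ℝ => Real.exp (-y ^ 2)) (Real.exp (-y ^ 2) * (-(2 * y))) y := by
      simpa using ((hasDerivAt_pow 2 y).neg).exp
    have h2 : deriv (fun x => Polynomial.eval x P * Real.exp (-x ^ 2)) y = _ :=
      ((P.hasDerivAt y).mul h1).deriv
    rw [h2]
    simp
    ring

theorem hasDerivAt_iteratedDeriv_gaussian (n : ℕ) (y : ℝ) :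
    HasDerivAt (iteratedDeriv n (fun y : ℝ => Real.exp (-y ^ 2)))
      (iteratedDeriv (n + 1) (fun y : ℝ => Real.exp (-y ^ 2)) y) y := by
  rw [iteratedDeriv_succ]
  apply DifferentiableAt.hasDerivAt
  obtain ⟨P, hP⟩ := exists_polynomial_iteratedDeriv_gaussian n
  rw [funext hP]
  fun_prop

/-- Since |y|^n ≤ n!(e^y + e^(-y)), a monomial factor costs no more than shifting w by ±1 in the
Gaussian integral. -/
theorem integrable_polynomial_mul_cexp_quadratic (P : Polynomial ℝ) (w : ℂ) :
    Integrable (fun y : ℝ => ((P.eval y : ℝ) : ℂ) * Complex.exp (w * y - y ^ 2)) := by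
  induction P using Polynomial.induction_on' generalizing w with
  | add P Q hP hQ =>
    refine ((hP w).add (hQ w)).congr (.of_forall fun y => ?_)
    simp [add_mul]
  | monomial n a =>
    have hq : ∀ w : ℂ, Integrable fun y : ℝ => Complex.exp (w * y - y ^ 2) := by
      intro w
      refine (integrable_cexp_quadratic (b := 1) (by simp) w 0).congr (.of_forall fun y => ?_)
      ring_nf
    have hdom : Integrable fun y : ℝ => |a| * n.factorial *
        (‖Complex.exp ((w + 1) * y - y ^ 2)‖ + ‖Complex.exp ((w - 1) * y - y ^ 2)‖) :=
      (((hq (w + 1)).norm.add (hq (w - 1)).norm)).const_mul _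
    refine hdom.mono' (by fun_prop) (.of_forall fun y => ?_)
    have h1 : |y| ^ n ≤ n.factorial * (Real.exp y + Real.exp (-y)) := by
      have h2 := Real.pow_div_factorial_le_exp |y| (abs_nonneg y) n
      rw [div_le_iff₀ (by positivity)] at h2
      have h3 : Real.exp |y| ≤ Real.exp y + Real.exp (-y) := by
        rcases abs_choice y with h | h <;> rw [h] <;>
          linarith [Real.exp_pos y, Real.exp_pos (-y)]
      calc |y| ^ n ≤ Real.exp |y| * n.factorial := h2
        _ ≤ (Real.exp y + Real.exp (-y)) * n.factorial := by gcongr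
        _ = _ := by ring
    have h4 : ‖Complex.exp ((w + 1) * y - y ^ 2)‖ =
        Real.exp y * ‖Complex.exp (w * y - y ^ 2)‖ := by
      rw [show (w + 1) * (y : ℂ) - y ^ 2 = y + (w * y - y ^ 2) by ring, Complex.exp_add, norm_mul,
        Complex.norm_exp]
      simp
    have h5 : ‖Complex.exp ((w - 1) * y - y ^ 2)‖ =
        Real.exp (-y) * ‖Complex.exp (w * y - y ^ 2)‖ := by
      rw [show (w - 1) * (y : ℂ) - y ^ 2 = -y + (w * y - y ^ 2) by ring, Complex.exp_add, norm_mul,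
        Complex.norm_exp]
      simp
    rw [h4, h5, norm_mul, Polynomial.eval_monomial, Complex.norm_real, norm_mul, norm_pow,
      Real.norm_eq_abs, Real.norm_eq_abs]
    calc |a| * |y| ^ n * ‖Complex.exp (w * y - y ^ 2)‖
        ≤ |a| * (n.factorial * (Real.exp y + Real.exp (-y))) * ‖Complex.exp (w * y - y ^ 2)‖ := by
          gcongr
      _ = _ := by ring

theorem integrable_cexp_mul_iteratedDeriv_gaussian (n : ℕ) (w : ℂ) :
    Integrable (fun y : ℝ => Complex.exp (w * y) *
      ((iteratedDeriv n (fun y : ℝ => Real.exp (-y ^ 2)) y : ℝ) : ℂ)) := by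
  obtain ⟨P, hP⟩ := exists_polynomial_iteratedDeriv_gaussian n
  refine (integrable_polynomial_mul_cexp_quadratic P w).congr (.of_forall fun y => ?_)
  simp only [hP, sub_eq_add_neg, Complex.exp_add]
  push_cast
  ring

/-- Each integration by parts moves one derivative onto e^(wy) and yields a factor -w. -/
theorem integral_cexp_mul_iteratedDeriv_gaussian (n : ℕ) (w : ℂ) :
    ∫ y : ℝ, Complex.exp (w * y) *
      ((iteratedDeriv n (fun y : ℝ => Real.exp (-y ^ 2)) y : ℝ) : ℂ) =
      (-w) ^ n * ((Real.pi ^ (1 / 2 : ℝ) : ℝ) : ℂ) * Complex.exp (w ^ 2 / 4) := by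
  induction n with
  | zero =>
    have h := integral_cexp_quadratic (b := -1) (by simp) w 0
    rw [pow_zero, one_mul, Complex.ofReal_cpow Real.pi_pos.le]
    convert h using 1
    · refine integral_congr_ae (.of_forall fun y => ?_)
      simp only [iteratedDeriv_zero, Complex.ofReal_exp, ← Complex.exp_add]
      congr 1
      push_cast
      ring
    · simp only [neg_neg, div_one]
      congr 2
      · norm_num
      · ring
  | succ n ih =>
    have hu : ∀ y : ℝ, HasDerivAt (fun y : ℝ => Complex.exp (w * y))
        (w * Complex.exp (w * y)) y := by
      intro y
      have := ((hasDerivAt_id (y : ℂ)).const_mul w).cexp.comp_ofReal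
      simpa [mul_comm] using this
    have hv : ∀ y : ℝ, HasDerivAt
        (fun y : ℝ => ((iteratedDeriv n (fun y : ℝ => Real.exp (-y ^ 2)) y : ℝ) : ℂ))
        ((iteratedDeriv (n + 1) (fun y : ℝ => Real.exp (-y ^ 2)) y : ℝ) : ℂ) y :=
      fun y => (hasDerivAt_iteratedDeriv_gaussian n y).ofReal_comp
    have h := integral_mul_deriv_eq_deriv_mul_of_integrable (u := fun y : ℝ => Complex.exp (w * y))
      (v := fun y : ℝ => ((iteratedDeriv n (fun y : ℝ => Real.exp (-y ^ 2)) y : ℝ) : ℂ))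
      (u' := fun y : ℝ => w * Complex.exp (w * y))
      (fun y _ => hu y) (fun y _ => hv y) (integrable_cexp_mul_iteratedDeriv_gaussian (n + 1) w)
      (by
        refine ((integrable_cexp_mul_iteratedDeriv_gaussian n w).const_mul w).congr
          (.of_forall fun y => ?_)
        simp [mul_assoc])
      (integrable_cexp_mul_iteratedDeriv_gaussian n w)
    rw [h]
    simp_rw [mul_assoc]
    rw [integral_const_mul, ih]
    ring

/-- The Hermite coefficients of the Gaussian on `ℝ` with centre `(x, ξ)` in phase space. -/
noncomputable def coherentOne (n : ℕ) (x ξ : ℝ) : ℂ :=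
  (((2 ^ n * (n.factorial : ℝ)) ^ (-(1 / 2) : ℝ) : ℝ) : ℂ) * (x + ξ * Complex.I) ^ n *
    Complex.exp (-x ^ 2 / 2 + (x + ξ * Complex.I) ^ 2 / 4)

/-- The factor e^(y²/2) of the Hermite function cancels the quadratic part of the window, leaving
e^(-x²/2) e^(wy) with w = x + iξ against a derivative of the Gaussian. The two signs (-1)^n cancel.
-/
theorem integral_gaussian_mul_hermiteFunctionOne (n : ℕ) (x ξ : ℝ) :
    ∫ y : ℝ, (((Real.pi ^ (-(1 / 4) : ℝ) * Real.exp (-(y - x) ^ 2 / 2) : ℝ) : ℂ) *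
      Complex.exp (Complex.I * ((y * ξ : ℝ) : ℂ))) * (hermiteFunctionOne n y : ℂ) =
      coherentOne n x ξ := by
  have hpi : Real.pi ^ (-(1 / 4) : ℝ) * Real.pi ^ (-(1 / 4) : ℝ) * Real.pi ^ (1 / 2 : ℝ) = 1 := by
    rw [← Real.rpow_add Real.pi_pos, ← Real.rpow_add Real.pi_pos]
    norm_num
  have hsign : ((-1 : ℂ) ^ n) * (-1) ^ n = 1 := by
    rw [← mul_pow]; simp
  have h1 : ∀ y : ℝ, (((Real.pi ^ (-(1 / 4) : ℝ) * Real.exp (-(y - x) ^ 2 / 2) : ℝ) : ℂ) *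
      Complex.exp (Complex.I * ((y * ξ : ℝ) : ℂ))) * (hermiteFunctionOne n y : ℂ) =
      (((Real.pi ^ (-(1 / 4) : ℝ) * Real.pi ^ (-(1 / 4) : ℝ) *
        (2 ^ n * (n.factorial : ℝ)) ^ (-(1 / 2) : ℝ) : ℝ) : ℂ) * (-1) ^ n *
        Complex.exp (-x ^ 2 / 2)) * (Complex.exp ((x + ξ * Complex.I) * y) *
        ((iteratedDeriv n (fun y : ℝ => Real.exp (-y ^ 2)) y : ℝ) : ℂ)) := by
    intro y
    have h2 : Complex.exp (-(y - x) ^ 2 / 2) * Complex.exp (Complex.I * (y * ξ)) *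
        Complex.exp (y ^ 2 / 2) =
        Complex.exp (-x ^ 2 / 2) * Complex.exp ((x + ξ * Complex.I) * y) := by
      rw [← Complex.exp_add, ← Complex.exp_add, ← Complex.exp_add]
      congr 1
      ring
    simp only [hermiteFunctionOne]
    push_cast
    linear_combination ((Real.pi ^ (-(1 / 4) : ℝ) : ℝ) : ℂ) * ((Real.pi ^ (-(1 / 4) : ℝ) : ℝ) : ℂ) *
      (((2 ^ n * (n.factorial : ℝ)) ^ (-(1 / 2) : ℝ) : ℝ) : ℂ) * (-1) ^ n *
      ((iteratedDeriv n (fun y : ℝ => Real.exp (-y ^ 2)) y : ℝ) : ℂ) * h2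
  simp_rw [h1]
  rw [integral_const_mul, integral_cexp_mul_iteratedDeriv_gaussian, coherentOne, Complex.exp_add,
    neg_pow ((x : ℂ) + ξ * Complex.I)]
  have hpi' := congrArg (fun t : ℝ => (t : ℂ)) hpi
  push_cast at hpi' ⊢
  have hps := congrArg₂ (fun a b : ℂ => a * b) hpi' hsign
  simp only [mul_one] at hps
  linear_combination (((2 ^ n * (n.factorial : ℝ)) ^ (-(1 / 2) : ℝ) : ℝ) : ℂ) *
    (x + ξ * Complex.I) ^ n * Complex.exp (-x ^ 2 / 2) *
    Complex.exp ((x + ξ * Complex.I) ^ 2 / 4) * hps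

variable {d : ℕ}

/-- The Hermite coefficients of the Gaussian on `ℝ^d` with centre `z` in phase space. -/
noncomputable def coherentCoeff (z : (Fin d → ℝ) × (Fin d → ℝ)) (α : Fin d → ℕ) : ℂ :=
  ∏ j, coherentOne (α j) (z.1 j) (z.2 j)

theorem hermiteCoeff_shiftedWindow (x ξ : Fin d → ℝ) :
    hermiteCoeff (shiftedWindow x ξ) = coherentCoeff (x, ξ) := by
  ext α
  simp only [hermiteCoeff, coherentCoeff, ← integral_gaussian_mul_hermiteFunctionOne]
  rw [← integral_fintype_prod_volume_eq_prod (f := fun (j : Fin d) (y : ℝ) =>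
    (((Real.pi ^ (-(1 / 4) : ℝ) * Real.exp (-(y - x j) ^ 2 / 2) : ℝ) : ℂ) *
      Complex.exp (Complex.I * ((y * ξ j : ℝ) : ℂ))) * (hermiteFunctionOne (α j) y : ℂ))]
  refine integral_congr_ae (.of_forall fun y => ?_)
  simp only [shiftedWindow, gaussWindow, hermiteFunction, Finset.prod_mul_distrib]
  rw [Complex.ofReal_prod]
  congr 1
  congr 1
  · rw [← Complex.ofReal_prod, Finset.prod_mul_distrib, Finset.prod_const, ← Real.exp_sum,
      Finset.card_univ, Fintype.card_fin, ← Real.rpow_natCast, ← Real.rpow_mul Real.pi_pos.le]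
    congr 3
    · ring
    · rw [← Finset.sum_div, Finset.sum_neg_distrib]
      rfl
  · rw [← Complex.exp_sum, ← Finset.mul_sum]
    push_cast
    rfl

theorem stft_eq_tsum (f : HermiteSeries d) (z : (Fin d → ℝ) × (Fin d → ℝ)) :
    stft f z = ((2 * Real.pi) ^ (-(d / 2) : ℝ) : ℝ) * ∑' α, f α * conj (coherentCoeff z α) := by
  rw [stft, hermiteCoeff_shiftedWindow, hermitePairing]

end CoherentStates

/-! ### Estimates for coherent states and for the short-time Fourier transform -/

section Estimates

theorem norm_coherentOne (n : ℕ) (x ξ : ℝ) : ‖coherentOne n x ξ‖ =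
    (2 ^ n * (n.factorial : ℝ)) ^ (-(1 / 2) : ℝ) * √(x ^ 2 + ξ ^ 2) ^ n *
      Real.exp (-(x ^ 2 + ξ ^ 2) / 4) := by
  rw [coherentOne, norm_mul, norm_mul, norm_pow, Complex.norm_real, Complex.norm_add_mul_I,
    Complex.norm_exp, Real.norm_of_nonneg (by positivity)]
  congr 2
  simp [pow_two]
  ring

theorem rpow_neg_half_eq {a : ℝ} (ha : 0 ≤ a) : a ^ (-(1 / 2) : ℝ) = (√a)⁻¹ := by
  rw [Real.rpow_neg ha, Real.sqrt_eq_rpow]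

theorem norm_coherentOne_le {K : ℝ} (n : ℕ) {x ξ : ℝ} (h : √(x ^ 2 + ξ ^ 2) ≤ K) :
    ‖coherentOne n x ξ‖ ≤ K ^ n / √(n.factorial : ℝ) := by
  have hK : 0 ≤ K := (Real.sqrt_nonneg _).trans h
  rw [norm_coherentOne, rpow_neg_half_eq (by positivity)]
  have h1 : Real.exp (-(x ^ 2 + ξ ^ 2) / 4) ≤ 1 :=
    Real.exp_le_one_iff.2 (by have : 0 ≤ x ^ 2 + ξ ^ 2 := by positivity
                              linarith)
  have h2 : (√(2 ^ n * (n.factorial : ℝ)))⁻¹ ≤ (√(n.factorial : ℝ))⁻¹ := by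
    refine inv_anti₀ (by positivity) (Real.sqrt_le_sqrt ?_)
    exact le_mul_of_one_le_left (by positivity) (one_le_pow₀ one_le_two)
  calc _ ≤ (√(n.factorial : ℝ))⁻¹ * K ^ n * 1 := by gcongr
    _ = _ := by rw [mul_one, mul_comm, div_eq_mul_inv]

/-- The modulus of the n-th coefficient, as a function of s = |(x, ξ)|, is concentrated near s² =
2n. Hence e^(Rs) can be afforded at the price of e^(O(√n)), which is the scale of decay that defines
Σ₁. -/
theorem norm_coherentOne_mul_exp_le {R : ℝ} (hR : 0 ≤ R) (n : ℕ) (x ξ : ℝ) :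
    ‖coherentOne n x ξ‖ * Real.exp (R * √(x ^ 2 + ξ ^ 2)) ≤
      Real.exp (3 * R + 4 * R ^ 2) * Real.exp (3 * R * √(n : ℝ)) := by
  rw [norm_coherentOne, rpow_neg_half_eq (by positivity)]
  obtain ⟨s, hs⟩ : ∃ s, s = √(x ^ 2 + ξ ^ 2) := ⟨_, rfl⟩
  have hs0 : 0 ≤ s := hs ▸ Real.sqrt_nonneg _
  have hs2 : s ^ 2 = x ^ 2 + ξ ^ 2 := by rw [hs]; exact Real.sq_sqrt (by positivity)
  rw [← hs, ← hs2]
  have hsq : ((√(2 ^ n * (n.factorial : ℝ)))⁻¹ * s ^ n) ^ 2 = (s ^ 2 / 2) ^ n / n.factorial := by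
    rw [mul_pow, inv_pow, Real.sq_sqrt (by positivity), div_pow]
    field_simp
    ring
  have hu0 : 0 ≤ (√(2 ^ n * (n.factorial : ℝ)))⁻¹ * s ^ n := by positivity
  have hn : 0 ≤ √(n : ℝ) := Real.sqrt_nonneg _
  have hn2 : √(n : ℝ) ^ 2 = n := Real.sq_sqrt (by positivity)
  rw [← Real.exp_add]
  -- For s² ≤ 8(n+1) one has s ≤ 3(√n + 1), and the normalized monomial is at most e^(s²/4).
  -- Otherwise it is at most e^(n/2 + s²/8), because its square is at most 2^n e^(s²/4); since n/2 <
  -- s²/16, the total exponent is at most Rs - s²/16 ≤ 4R².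
  by_cases hcase : s ^ 2 ≤ 8 * (n + 1)
  · have h1 : (√(2 ^ n * (n.factorial : ℝ)))⁻¹ * s ^ n ≤ Real.exp (s ^ 2 / 4) := by
      refine abs_le_of_sq_le_sq' ?_ (Real.exp_pos _).le |>.2
      rw [hsq, ← Real.exp_nat_mul]
      refine (Real.pow_div_factorial_le_exp _ (by positivity) n).trans_eq ?_
      congr 1; push_cast; ring
    have h2 : s ≤ 3 * (√(n : ℝ) + 1) := by
      refine abs_le_of_sq_le_sq' ?_ (by positivity) |>.2
      nlinarith
    calc _ ≤ Real.exp (s ^ 2 / 4) * Real.exp (-s ^ 2 / 4) * Real.exp (R * s) := by gcongr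
      _ = Real.exp (R * s) := by
        rw [← Real.exp_add, ← Real.exp_add]; congr 1; ring
      _ ≤ _ := Real.exp_le_exp.2 (by nlinarith [mul_le_mul_of_nonneg_left h2 hR])
  · have h1 : (√(2 ^ n * (n.factorial : ℝ)))⁻¹ * s ^ n ≤ Real.exp (n / 2 + s ^ 2 / 8) := by
      refine abs_le_of_sq_le_sq' ?_ (Real.exp_pos _).le |>.2
      rw [hsq, ← Real.exp_nat_mul]
      calc (s ^ 2 / 2) ^ n / n.factorial = 2 ^ n * ((s ^ 2 / 4) ^ n / n.factorial) := by
            rw [show s ^ 2 / 2 = 2 * (s ^ 2 / 4) by ring, mul_pow, mul_div_assoc]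
        _ ≤ Real.exp 1 ^ n * Real.exp (s ^ 2 / 4) := by
            gcongr
            · linarith [Real.add_one_le_exp 1]
            · exact Real.pow_div_factorial_le_exp _ (by positivity) n
        _ = _ := by
            rw [← Real.exp_nat_mul, ← Real.exp_add]; congr 1; push_cast; ring
    calc _ ≤ Real.exp (n / 2 + s ^ 2 / 8) * Real.exp (-s ^ 2 / 4) * Real.exp (R * s) := by gcongr
      _ = Real.exp (n / 2 + s ^ 2 / 8 + -s ^ 2 / 4 + R * s) := by
        rw [← Real.exp_add, ← Real.exp_add]
      _ ≤ _ := by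
        refine Real.exp_le_exp.2 ?_
        have h3 : 0 ≤ 3 * R * √(n : ℝ) := by positivity
        nlinarith [sq_nonneg (s / 4 - 2 * R)]

theorem summable_pow_div_sqrt_factorial (K : ℝ) (hK : 0 ≤ K) :
    Summable fun n : ℕ => K ^ n / √(n.factorial : ℝ) := by
  have h1 : Summable fun n : ℕ => Real.exp (2 * K ^ 2) * (1 / 2 : ℝ) ^ n :=
    (summable_geometric_two).mul_left _
  refine Summable.of_nonneg_of_le (fun n => by positivity) (fun n => ?_) h1
  refine abs_le_of_sq_le_sq' ?_ (by positivity) |>.2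
  have h2 := Real.pow_div_factorial_le_exp (4 * K ^ 2) (by positivity) n
  calc (K ^ n / √(n.factorial : ℝ)) ^ 2
      -- The square is split into a term of an exponential series and the geometric factor 4^(-n),
      -- which provides summability.
      = ((4 * K ^ 2) ^ n / n.factorial) * ((1 / 2 : ℝ) ^ n) ^ 2 := by
        have h4 : (4 : ℝ) ^ n * ((1 / 2 : ℝ) ^ n) ^ 2 = 1 := by
          rw [← pow_mul, mul_comm n 2, pow_mul, ← mul_pow]
          norm_num
        rw [div_pow, Real.sq_sqrt (by positivity), mul_pow]
        linear_combination (-((K ^ n) ^ 2 / n.factorial)) * h4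
    _ ≤ Real.exp (4 * K ^ 2) * ((1 / 2 : ℝ) ^ n) ^ 2 := by gcongr
    _ = _ := by
      rw [mul_pow, ← Real.exp_nat_mul]
      congr 2
      push_cast
      ring

theorem summable_exp_neg_mul_sqrt {r : ℝ} (hr : 0 < r) :
    Summable fun n : ℕ => Real.exp (-r * √(n : ℝ)) := by
  -- The constant is 4!, from e^u ≥ u⁴/4! with u = r√n.
  have h1 : Summable fun n : ℕ => 24 / r ^ 4 * (1 / (n : ℝ) ^ 2) :=
    (Real.summable_one_div_nat_pow.2 one_lt_two).mul_left _
  refine h1.of_norm_bounded_eventually_nat ?_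
  filter_upwards [eventually_gt_atTop 0] with n hn
  have hn' : (0 : ℝ) < n := by exact_mod_cast hn
  have h2 := Real.pow_div_factorial_le_exp (r * √(n : ℝ)) (by positivity) 4
  have h3 : (r * √(n : ℝ)) ^ 4 = r ^ 4 * (n : ℝ) ^ 2 := by
    rw [mul_pow, show √(n : ℝ) ^ 4 = (√(n : ℝ) ^ 2) ^ 2 by ring, Real.sq_sqrt hn'.le]
  rw [h3] at h2
  rw [Real.norm_of_nonneg (Real.exp_pos _).le, neg_mul, Real.exp_neg]
  calc (Real.exp (r * √(n : ℝ)))⁻¹ ≤ (r ^ 4 * (n : ℝ) ^ 2 / (Nat.factorial 4 : ℕ))⁻¹ :=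
        inv_anti₀ (by positivity) h2
    _ = _ := by
      rw [show Nat.factorial 4 = 24 from rfl]
      push_cast
      field_simp

variable {d : ℕ}

/-- A finite set of multi-indices lies in a cube, and over a cube the sum of products factorizes. -/
theorem summable_pi_prod {a : ℕ → ℝ} (ha : ∀ n, 0 ≤ a n) (hs : Summable a) :
    Summable fun α : Fin d → ℕ => ∏ j, a (α j) := by
  refine summable_of_sum_le (c := (∑' n, a n) ^ d) (fun α => Finset.prod_nonneg fun j _ => ha _)
    fun s => ?_
  obtain ⟨N, hN⟩ : ∃ N : ℕ, ∀ α ∈ s, ∀ j, α j < N := by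
    refine ⟨s.sup (fun α => Finset.univ.sup α) + 1, fun α hα j => Nat.lt_succ_of_le ?_⟩
    exact (Finset.le_sup (f := α) (Finset.mem_univ j)).trans
      (Finset.le_sup (f := fun α : Fin d → ℕ => Finset.univ.sup α) hα)
  calc ∑ α ∈ s, ∏ j, a (α j)
      ≤ ∑ α ∈ Fintype.piFinset fun _ : Fin d => Finset.range N, ∏ j, a (α j) := by
        refine Finset.sum_le_sum_of_subset_of_nonneg (fun α hα => ?_)
          fun α _ _ => Finset.prod_nonneg fun j _ => ha _
        exact Fintype.mem_piFinset.2 fun j => Finset.mem_range.2 (hN α hα j)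
    _ = ∏ _j : Fin d, ∑ n ∈ Finset.range N, a n := by
        rw [Finset.prod_univ_sum]
    _ = (∑ n ∈ Finset.range N, a n) ^ d := by simp
    _ ≤ _ := by
        gcongr
        · exact Finset.sum_nonneg fun n _ => ha n
        · exact hs.sum_le_tsum _ fun n _ => ha n

theorem sum_sqrt_le (α : Fin d → ℕ) : ∑ j, √(α j : ℝ) ≤ d * √(multiLength α : ℝ) := by
  calc ∑ j, √(α j : ℝ) ≤ ∑ _j : Fin d, √(multiLength α : ℝ) := by
        refine Finset.sum_le_sum fun j _ => Real.sqrt_le_sqrt ?_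
        exact_mod_cast Finset.single_le_sum (f := α) (fun _ _ => Nat.zero_le _) (Finset.mem_univ j)
    _ = _ := by simp

theorem summable_exp_neg_sqrt_multiLength {r : ℝ} (hr : 0 < r) :
    Summable fun α : Fin d → ℕ => Real.exp (-r * √(multiLength α : ℝ)) := by
  -- Since the sum of the √α_j is at most d√|α|, the rate r/(d+1) in every coordinate suffices; d +
  -- 1 keeps it meaningful for d = 0.
  have h1 : 0 < r / (d + 1) := by positivity
  refine Summable.of_nonneg_of_le (fun α => (Real.exp_pos _).le) (fun α => ?_)
    (summable_pi_prod (d := d) (fun n => (Real.exp_pos _).le) (summable_exp_neg_mul_sqrt h1))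
  rw [← Real.exp_sum]
  refine Real.exp_le_exp.2 ?_
  rw [← Finset.mul_sum, neg_mul, neg_mul, neg_le_neg_iff, div_mul_eq_mul_div,
    div_le_iff₀ (by positivity), mul_assoc]
  have := sum_sqrt_le α
  have h2 := Real.sqrt_nonneg (multiLength α : ℝ)
  exact mul_le_mul_of_nonneg_left (by linarith) hr.le

/-- The `ℓ¹` norm of the moduli `|(x_j, ξ_j)|`. -/
noncomputable def phaseRadius (z : (Fin d → ℝ) × (Fin d → ℝ)) : ℝ :=
  ∑ j, √(z.1 j ^ 2 + z.2 j ^ 2)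

theorem norm_coherentCoeff_mul_exp_le {R : ℝ} (hR : 0 ≤ R) (z : (Fin d → ℝ) × (Fin d → ℝ))
    (α : Fin d → ℕ) : ‖coherentCoeff z α‖ * Real.exp (R * phaseRadius z) ≤
      Real.exp (3 * R + 4 * R ^ 2) ^ d * Real.exp (3 * R * d * √(multiLength α : ℝ)) := by
  calc _ = ∏ j, (‖coherentOne (α j) (z.1 j) (z.2 j)‖ *
        Real.exp (R * √(z.1 j ^ 2 + z.2 j ^ 2))) := by
        rw [Finset.prod_mul_distrib, ← Real.exp_sum, ← Finset.mul_sum, coherentCoeff, norm_prod,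
          phaseRadius]
    _ ≤ ∏ j, (Real.exp (3 * R + 4 * R ^ 2) * Real.exp (3 * R * √(α j : ℝ))) :=
        Finset.prod_le_prod (fun j _ => by positivity)
          fun j _ => norm_coherentOne_mul_exp_le hR _ _ _
    _ = Real.exp (3 * R + 4 * R ^ 2) ^ d * Real.exp (3 * R * ∑ j, √(α j : ℝ)) := by
        rw [Finset.prod_mul_distrib, Finset.prod_const, Finset.card_univ, Fintype.card_fin,
          ← Real.exp_sum, ← Finset.mul_sum]
    _ ≤ _ := by
        rw [mul_assoc (3 * R)]
        gcongr
        exact sum_sqrt_le α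

/-- The majorant of the Hermite expansion of a coherent state in the polydisc of radius `K`. -/
noncomputable def coherentMajorant (K : ℝ) (α : Fin d → ℕ) : ℝ :=
  ∏ j, (K ^ α j / √((α j).factorial : ℝ))

theorem coherentMajorant_nonneg {K : ℝ} (hK : 0 ≤ K) (α : Fin d → ℕ) : 0 ≤ coherentMajorant K α :=
  Finset.prod_nonneg fun j _ => by positivity

theorem norm_coherentCoeff_le {K : ℝ} {z : (Fin d → ℝ) × (Fin d → ℝ)}
    (h : ∀ j, √(z.1 j ^ 2 + z.2 j ^ 2) ≤ K) (α : Fin d → ℕ) :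
    ‖coherentCoeff z α‖ ≤ coherentMajorant K α := by
  rw [coherentCoeff, norm_prod]
  exact Finset.prod_le_prod (fun j _ => norm_nonneg _) fun j _ => norm_coherentOne_le _ (h j)

/-- The growth e^(r√|α|) is at most e^(r|α|), which is absorbed by enlarging K to e^r K. This gives
locally uniform convergence of the series for V_φ f. -/
theorem summable_norm_mul_coherentMajorant {f : HermiteSeries d} (hf : f ∈ sigmaOneDual d)
    {K : ℝ} (hK : 0 ≤ K) : Summable fun α => ‖f α‖ * coherentMajorant K α := by
  obtain ⟨r, hr, C, hC⟩ := hf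
  have h1 : Summable fun α : Fin d → ℕ => C * coherentMajorant (Real.exp r * K) α :=
    (summable_pi_prod (fun n => by positivity)
      (summable_pow_div_sqrt_factorial (Real.exp r * K) (by positivity))).mul_left C
  refine Summable.of_nonneg_of_le
    (fun α => mul_nonneg (norm_nonneg _) (coherentMajorant_nonneg hK α)) (fun α => ?_) h1
  have hC0 : 0 ≤ C := by
    have := (norm_nonneg _).trans (hC α)
    exact nonneg_of_mul_nonneg_left this (Real.exp_pos _)
  have h2 : Real.exp (r * √(multiLength α : ℝ)) ≤ ∏ j, Real.exp r ^ α j := by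
    rw [Finset.prod_pow_eq_pow_sum, ← Real.exp_nat_mul, mul_comm]
    refine Real.exp_le_exp.2 (mul_le_mul_of_nonneg_right ?_ hr.le)
    change √(multiLength α : ℝ) ≤ (multiLength α : ℝ)
    rcases Nat.eq_zero_or_pos (multiLength α) with h | h
    · simp [h]
    · refine Real.sqrt_le_iff.2 ⟨by positivity, ?_⟩
      have : (1 : ℝ) ≤ multiLength α := by exact_mod_cast h
      nlinarith
  calc ‖f α‖ * coherentMajorant K α
      ≤ (C * ∏ j, Real.exp r ^ α j) * coherentMajorant K α := by
        gcongr
        · exact coherentMajorant_nonneg hK α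
        · exact (hC α).trans (by gcongr)
    _ = _ := by
      rw [mul_assoc, coherentMajorant, coherentMajorant, ← Finset.prod_mul_distrib]
      congr 1
      refine Finset.prod_congr rfl fun j _ => ?_
      rw [mul_pow]
      ring

theorem exists_radius_le (s : Set ((Fin d → ℝ) × (Fin d → ℝ))) (hs : Bornology.IsBounded s) :
    ∃ K : ℝ, 0 ≤ K ∧ ∀ z ∈ s, ∀ j, √(z.1 j ^ 2 + z.2 j ^ 2) ≤ K := by
  obtain ⟨M, hM⟩ := hs.exists_norm_le
  refine ⟨2 * |M|, by positivity, fun z hz j => ?_⟩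
  have h1 : |z.1 j| ≤ |M| :=
    ((norm_le_pi_norm z.1 j).trans ((norm_fst_le z).trans (hM z hz))).trans (le_abs_self M)
  have h2 : |z.2 j| ≤ |M| :=
    ((norm_le_pi_norm z.2 j).trans ((norm_snd_le z).trans (hM z hz))).trans (le_abs_self M)
  refine Real.sqrt_le_iff.2 ⟨by positivity, ?_⟩
  nlinarith [sq_abs (z.1 j), sq_abs (z.2 j), abs_nonneg (z.1 j), abs_nonneg (z.2 j)]

theorem summable_mul_conj_coherentCoeff {f : HermiteSeries d} (hf : f ∈ sigmaOneDual d)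
    (z : (Fin d → ℝ) × (Fin d → ℝ)) : Summable fun α => f α * conj (coherentCoeff z α) := by
  obtain ⟨K, hK, hz⟩ := exists_radius_le {z} Bornology.isBounded_singleton
  refine (summable_norm_mul_coherentMajorant hf hK).of_norm_bounded fun α => ?_
  rw [norm_mul, RCLike.norm_conj]
  gcongr
  exact norm_coherentCoeff_le (hz z rfl) α

theorem continuous_coherentCoeff (α : Fin d → ℕ) :
    Continuous fun z : (Fin d → ℝ) × (Fin d → ℝ) => coherentCoeff z α := by
  unfold coherentCoeff coherentOne
  fun_prop

theorem continuous_stft {f : HermiteSeries d} (hf : f ∈ sigmaOneDual d) : Continuous (stft f) := by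
  have h1 : stft f = fun z => (((2 * Real.pi) ^ (-(d / 2) : ℝ) : ℝ) : ℂ) *
      ∑' α, f α * conj (coherentCoeff z α) := funext (stft_eq_tsum f)
  rw [h1]
  refine continuous_const.mul (continuous_iff_continuousAt.2 fun z => ?_)
  obtain ⟨K, hK, hz⟩ := exists_radius_le (Metric.ball z 1) Metric.isBounded_ball
  have h2 : ContinuousOn (fun z => ∑' α, f α * conj (coherentCoeff z α)) (Metric.ball z 1) := by
    refine continuousOn_tsum (fun α => ?_) (summable_norm_mul_coherentMajorant hf hK)
      fun α z' hz' => ?_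
    · exact (continuous_const.mul
        (Complex.continuous_conj.comp (continuous_coherentCoeff α))).continuousOn
    · rw [norm_mul, RCLike.norm_conj]
      gcongr
      exact norm_coherentCoeff_le (hz z' hz') α
  exact h2.continuousAt (Metric.ball_mem_nhds z one_pos)

/-! ### Linearity of the transform and of the space Σ₁'. -/

theorem stft_add {f g : HermiteSeries d} (hf : f ∈ sigmaOneDual d) (hg : g ∈ sigmaOneDual d)
    (z : (Fin d → ℝ) × (Fin d → ℝ)) : stft (f + g) z = stft f z + stft g z := by
  simp only [stft_eq_tsum, Pi.add_apply, add_mul]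
  rw [(summable_mul_conj_coherentCoeff hf z).tsum_add (summable_mul_conj_coherentCoeff hg z),
    mul_add]

theorem stft_neg (f : HermiteSeries d) (z : (Fin d → ℝ) × (Fin d → ℝ)) :
    stft (-f) z = -stft f z := by
  simp only [stft_eq_tsum, Pi.neg_apply, neg_mul, tsum_neg, mul_neg]

theorem sigmaOneDual_add {f g : HermiteSeries d} (hf : f ∈ sigmaOneDual d)
    (hg : g ∈ sigmaOneDual d) : f + g ∈ sigmaOneDual d := by
  obtain ⟨r, hr, C, hC⟩ := hf
  obtain ⟨s, hs, D, hD⟩ := hg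
  refine ⟨r + s, by positivity, |C| + |D|, fun α => ?_⟩
  have h0 := Real.sqrt_nonneg (multiLength α : ℝ)
  calc ‖(f + g) α‖ ≤ ‖f α‖ + ‖g α‖ := norm_add_le _ _
    _ ≤ |C| * Real.exp (r * √(multiLength α : ℝ)) + |D| * Real.exp (s * √(multiLength α : ℝ)) :=
        add_le_add ((hC α).trans (by gcongr; exact le_abs_self C))
          ((hD α).trans (by gcongr; exact le_abs_self D))
    _ ≤ |C| * Real.exp ((r + s) * √(multiLength α : ℝ)) +
        |D| * Real.exp ((r + s) * √(multiLength α : ℝ)) := by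
        gcongr <;> linarith
    _ = _ := by ring

theorem sigmaOneDual_neg {f : HermiteSeries d} (hf : f ∈ sigmaOneDual d) :
    -f ∈ sigmaOneDual d := by
  obtain ⟨r, hr, C, hC⟩ := hf
  exact ⟨r, hr, C, fun α => by simpa using hC α⟩

theorem sigmaOneDual_sub {f g : HermiteSeries d} (hf : f ∈ sigmaOneDual d)
    (hg : g ∈ sigmaOneDual d) : f - g ∈ sigmaOneDual d := by
  rw [sub_eq_add_neg]
  exact sigmaOneDual_add hf (sigmaOneDual_neg hg)

theorem sigmaOne_subset_sigmaOneDual : sigmaOne d ⊆ sigmaOneDual d := by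
  intro f hf
  obtain ⟨C, hC⟩ := hf 1 one_pos
  refine ⟨1, one_pos, |C|, fun α => (hC α).trans ?_⟩
  have h0 := Real.sqrt_nonneg (multiLength α : ℝ)
  gcongr
  · exact le_abs_self C
  · norm_num

/-- The short-time Fourier transform of an element of `Σ₁` decays faster than every exponential. -/
theorem exists_norm_stft_le_of_mem_sigmaOne {f : HermiteSeries d} (hf : f ∈ sigmaOne d) {R : ℝ}
    (hR : 0 ≤ R) : ∃ C : ℝ, 0 ≤ C ∧ ∀ z, ‖stft f z‖ ≤ C * Real.exp (-R * phaseRadius z) := by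
  -- The rate 3Rd compensates the growth of the coherent states in α, and the surplus 1 leaves a
  -- summable factor.
  obtain ⟨C, hC⟩ := hf (3 * R * d + 1) (by positivity)
  have hsum := summable_exp_neg_sqrt_multiLength (d := d) one_pos
  set S := ∑' α : Fin d → ℕ, |C| * Real.exp (3 * R + 4 * R ^ 2) ^ d *
    Real.exp (-1 * √(multiLength α : ℝ)) with hS
  have hS0 : 0 ≤ S := tsum_nonneg fun α => by positivity
  refine ⟨(2 * Real.pi) ^ (-(d / 2) : ℝ) * S, by positivity, fun z => ?_⟩
  have hterm : ∀ α, ‖f α * conj (coherentCoeff z α)‖ ≤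
      |C| * Real.exp (3 * R + 4 * R ^ 2) ^ d * Real.exp (-1 * √(multiLength α : ℝ)) *
        Real.exp (-R * phaseRadius z) := by
    intro α
    have h1 := norm_coherentCoeff_mul_exp_le hR z α
    have h2 : ‖coherentCoeff z α‖ ≤ Real.exp (3 * R + 4 * R ^ 2) ^ d *
        Real.exp (3 * R * d * √(multiLength α : ℝ)) * Real.exp (-R * phaseRadius z) := by
      rw [neg_mul, Real.exp_neg, ← div_eq_mul_inv, le_div_iff₀ (Real.exp_pos _)]
      exact h1
    rw [norm_mul, RCLike.norm_conj]
    calc ‖f α‖ * ‖coherentCoeff z α‖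
        ≤ (|C| * Real.exp (-(3 * R * d + 1) * √(multiLength α : ℝ))) *
          (Real.exp (3 * R + 4 * R ^ 2) ^ d * Real.exp (3 * R * d * √(multiLength α : ℝ)) *
            Real.exp (-R * phaseRadius z)) := by
          gcongr
          exact (hC α).trans (by gcongr; exact le_abs_self C)
      _ = _ := by
          have h3 : Real.exp (-(3 * R * d + 1) * √(multiLength α : ℝ)) *
              Real.exp (3 * R * d * √(multiLength α : ℝ)) =
              Real.exp (-1 * √(multiLength α : ℝ)) := by
            rw [← Real.exp_add]
            congr 1
            ring
          rw [← h3]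
          ring
  have hsum' := ((hsum.mul_left (|C| * Real.exp (3 * R + 4 * R ^ 2) ^ d)).mul_right
    (Real.exp (-R * phaseRadius z)))
  rw [stft_eq_tsum, norm_mul, Complex.norm_real, Real.norm_of_nonneg (by positivity), mul_assoc]
  gcongr
  refine (tsum_of_norm_bounded hsum'.hasSum hterm).trans_eq ?_
  rw [tsum_mul_right]

end Estimates

/-! ### Moderate weights -/

section Weights

/-- Moderate weights have at most exponential growth, relative to any base point. -/
theorem IsModerate.exists_exp_bound {E : Type*} [NormedAddCommGroup E] [NormedSpace ℝ E]
    [FiniteDimensional ℝ E] [MeasureSpace E] [BorelSpace E]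
    [(volume : Measure E).IsAddHaarMeasure] {ω : E → ℝ} (h0 : ∀ x, 0 < ω x) (h : IsModerate ω) :
    ∃ A R : ℝ, 0 < A ∧ 0 ≤ R ∧ ∀ x y, ω (x + y) ≤ A * Real.exp (R * ‖y‖) * ω x := by
  obtain ⟨v, hv0, hv, C, hC, hCv⟩ := h
  have hK := hv (Metric.closedBall 0 2) (isCompact_closedBall 0 2)
  obtain ⟨M, hM0, hM⟩ : ∃ M : ℝ, 0 ≤ M ∧ ∀ᵐ y : E, y ∈ Metric.closedBall (0 : E) 2 → v y ≤ M := by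
    refine ⟨(eLpNorm v ∞ (volume.restrict (Metric.closedBall 0 2))).toReal,
      ENNReal.toReal_nonneg, ?_⟩
    rw [← ae_restrict_iff' Metric.isClosed_closedBall.measurableSet]
    filter_upwards [ae_le_eLpNormEssSup (f := v)
      (μ := volume.restrict (Metric.closedBall 0 2))] with y hy
    rw [← eLpNorm_exponent_top] at hy
    have := ENNReal.toReal_mono hK.2.ne hy
    rw [toReal_enorm, Real.norm_eq_abs] at this
    exact (le_abs_self _).trans this
  -- v is bounded only almost everywhere on the ball, so y itself may be a bad point. It is written
  -- as w + (y - w) with w in the unit ball such that both summands avoid the exceptional null set.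
  have hunit : ∀ x y : E, ‖y‖ ≤ 1 → ω (x + y) ≤ (C * M) ^ 2 * ω x := by
    intro x y hy
    have h1 : ∀ᵐ w : E, y - w ∈ Metric.closedBall (0 : E) 2 → v (y - w) ≤ M :=
      (quasiMeasurePreserving_sub_left volume y).ae hM
    obtain ⟨w, hw, hw2⟩ := (Measure.dense_of_ae (hM.and h1)).exists_mem_open
      (Metric.isOpen_ball (x := (0 : E)) (ε := 1)) ⟨0, Metric.mem_ball_self one_pos⟩
    have hwn : ‖w‖ < 1 := by simpa using hw2
    have h2 : v w ≤ M := hw.1 (by simp; linarith)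
    have h3 : v (y - w) ≤ M := hw.2 (by
      have := norm_sub_le y w
      simp; linarith)
    calc ω (x + y) = ω (x + w + (y - w)) := by congr 1; abel
      _ ≤ C * (ω (x + w) * v (y - w)) := hCv _ _
      _ ≤ C * (C * (ω x * M) * M) := by
          have h4 : ω (x + w) ≤ C * (ω x * M) := (hCv x w).trans (by gcongr; exact (h0 x).le)
          have h5 : 0 ≤ C * (ω x * M) := (h0 _).le.trans h4
          gcongr
          exact (hv0 _).le
      _ = _ := by ring
  -- B ≥ 1 makes the powers of B increasing. A vector y is then reached in ⌈‖y‖⌉ equal steps of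
  -- length at most 1.
  set B := max 1 ((C * M) ^ 2) with hB
  have hB1 : 1 ≤ B := le_max_left _ _
  have hiter : ∀ (n : ℕ) (x y : E), ‖y‖ ≤ 1 → ω (x + n • y) ≤ B ^ n * ω x := by
    intro n
    induction n with
    | zero => intro x y _; simp
    | succ n ih =>
      intro x y hy
      calc ω (x + (n + 1) • y) = ω (x + n • y + y) := by rw [succ_nsmul, add_assoc]
        _ ≤ (C * M) ^ 2 * ω (x + n • y) := hunit _ _ hy
        _ ≤ B * (B ^ n * ω x) := by
            gcongr
            · exact (h0 _).le
            · exact le_max_right _ _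
            · exact ih x y hy
        _ = _ := by ring
  refine ⟨B, Real.log B, by positivity, Real.log_nonneg hB1, fun x y => ?_⟩
  have hfac : B ^ (⌈‖y‖⌉₊) ≤ B * Real.exp (Real.log B * ‖y‖) := by
    rw [← Real.rpow_def_of_pos (by positivity), ← Real.rpow_natCast]
    calc B ^ ((⌈‖y‖⌉₊ : ℕ) : ℝ) ≤ B ^ (1 + ‖y‖) :=
          Real.rpow_le_rpow_of_exponent_le hB1
            (by linarith [Nat.ceil_lt_add_one (norm_nonneg y)])
      _ = _ := by rw [Real.rpow_add (by positivity), Real.rpow_one]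
  rcases Nat.eq_zero_or_pos ⌈‖y‖⌉₊ with hn | hn
  · have hy : y = 0 := norm_le_zero_iff.1 (Nat.ceil_eq_zero.1 hn)
    subst hy
    simpa using le_mul_of_one_le_left (h0 x).le hB1
  · have hn' : (0 : ℝ) < (⌈‖y‖⌉₊ : ℕ) := by exact_mod_cast hn
    have h1 := hiter ⌈‖y‖⌉₊ x ((⌈‖y‖⌉₊ : ℝ)⁻¹ • y) (by
      rw [norm_smul, norm_inv, Real.norm_of_nonneg hn'.le, inv_mul_le_iff₀ hn', mul_one]
      exact Nat.le_ceil _)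
    rw [← Nat.cast_smul_eq_nsmul ℝ, smul_smul, mul_inv_cancel₀ hn'.ne', one_smul] at h1
    exact h1.trans (mul_le_mul_of_nonneg_right hfac (h0 x).le)

theorem IsWeight.aemeasurable {E : Type*} [NormedAddCommGroup E] [ProperSpace E] [MeasureSpace E]
    {ω : E → ℝ} (h : IsWeight ω) : AEMeasurable ω volume := by
  have h1 : ⋃ n : ℕ, Metric.closedBall (0 : E) n = Set.univ :=
    Metric.iUnion_closedBall_nat 0
  rw [← Measure.restrict_univ (μ := (volume : Measure E)), ← h1, aemeasurable_iUnion_iff]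
  exact fun n => (h.locBdd _ (isCompact_closedBall 0 (n : ℝ))).1.aemeasurable

variable {d : ℕ}

instance isAddHaarMeasure_volume_phaseSpace :
    (volume : Measure ((Fin d → ℝ) × (Fin d → ℝ))).IsAddHaarMeasure :=
  Measure.prod.instIsAddHaarMeasure _ _

/-- A rotation preserves each x_j² + ξ_j²; this is the purpose of the radial symmetry. -/
theorem IsModerateRadialWeight.comp_rotation {ω : (Fin d → ℝ) × (Fin d → ℝ) → ℝ}
    (h : IsModerateRadialWeight ω) (θ : ℝ) (z : (Fin d → ℝ) × (Fin d → ℝ)) :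
    ω (phaseMap (Real.cos θ) (-Real.sin θ) (Real.sin θ) (Real.cos θ) z) = ω z := by
  obtain ⟨ω₀, -, hω₀⟩ := h.radial
  rw [phaseMap, hω₀, show ω z = ω (z.1, z.2) from rfl, hω₀]
  congr 1
  ext j
  simp only [Pi.add_apply, Pi.smul_apply, smul_eq_mul]
  linear_combination (z.1 j ^ 2 + z.2 j ^ 2) * Real.sin_sq_add_cos_sq θ

/-- The squared Euclidean norm on phase space. -/
noncomputable def phaseEnergy (z : (Fin d → ℝ) × (Fin d → ℝ)) : ℝ :=
  ∑ j, (z.1 j ^ 2 + z.2 j ^ 2)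

theorem phaseEnergy_nonneg (z : (Fin d → ℝ) × (Fin d → ℝ)) : 0 ≤ phaseEnergy z :=
  Finset.sum_nonneg fun j _ => by positivity

theorem norm_sq_le_phaseEnergy (z : (Fin d → ℝ) × (Fin d → ℝ)) : ‖z‖ ^ 2 ≤ phaseEnergy z := by
  have h1 : ‖z‖ ≤ √(phaseEnergy z) := by
    rw [Prod.norm_def]
    refine max_le ?_ ?_ <;> refine (pi_norm_le_iff_of_nonneg (Real.sqrt_nonneg _)).2 fun j => ?_
    all_goals
      refine Real.abs_le_sqrt ?_
      refine le_trans ?_ (Finset.single_le_sum (f := fun j => z.1 j ^ 2 + z.2 j ^ 2)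
        (fun j _ => by positivity) (Finset.mem_univ j))
      nlinarith [sq_nonneg (z.1 j), sq_nonneg (z.2 j)]
  calc ‖z‖ ^ 2 ≤ √(phaseEnergy z) ^ 2 := by gcongr
    _ = _ := Real.sq_sqrt (phaseEnergy_nonneg z)

theorem norm_le_phaseRadius (z : (Fin d → ℝ) × (Fin d → ℝ)) : ‖z‖ ≤ phaseRadius z := by
  have h0 : 0 ≤ phaseRadius z := Finset.sum_nonneg fun j _ => Real.sqrt_nonneg _
  rw [Prod.norm_def]
  refine max_le ?_ ?_ <;> refine (pi_norm_le_iff_of_nonneg h0).2 fun j => ?_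
  all_goals
    refine le_trans ?_ (Finset.single_le_sum (f := fun j => √(z.1 j ^ 2 + z.2 j ^ 2))
      (fun j _ => Real.sqrt_nonneg _) (Finset.mem_univ j))
    refine Real.abs_le_sqrt ?_
    nlinarith [sq_nonneg (z.1 j), sq_nonneg (z.2 j)]

theorem sum_abs_le_phaseRadius (z : (Fin d → ℝ) × (Fin d → ℝ)) :
    ∑ j, (|z.1 j| + |z.2 j|) ≤ 2 * phaseRadius z := by
  rw [phaseRadius, Finset.mul_sum]
  refine Finset.sum_le_sum fun j _ => ?_
  have h1 : |z.1 j| ≤ √(z.1 j ^ 2 + z.2 j ^ 2) :=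
    Real.abs_le_sqrt (by nlinarith [sq_nonneg (z.2 j)])
  have h2 : |z.2 j| ≤ √(z.1 j ^ 2 + z.2 j ^ 2) :=
    Real.abs_le_sqrt (by nlinarith [sq_nonneg (z.1 j)])
  linarith

end Weights

/-! ### The Fock space picture -/

section Fock

variable {d : ℕ}

/-- The normalized monomials `∏_j (x_j + iξ_j)^{α_j} / (2^{α_j} α_j!)^{1/2}`. -/
noncomputable def fockMonomial (z : (Fin d → ℝ) × (Fin d → ℝ)) (α : Fin d → ℕ) : ℂ :=
  ∏ j, ((((2 ^ α j * ((α j).factorial : ℝ)) ^ (-(1 / 2) : ℝ) : ℝ) : ℂ) *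
    (z.1 j + z.2 j * Complex.I) ^ α j)

/-- The conjugate of the Bargmann transform. -/
noncomputable def fockTransform (f : HermiteSeries d) (z : (Fin d → ℝ) × (Fin d → ℝ)) : ℂ :=
  ∑' α, f α * conj (fockMonomial z α)

/-- The factor which relates coherent states and monomials. -/
noncomputable def fockFactor (z : (Fin d → ℝ) × (Fin d → ℝ)) : ℂ :=
  ∏ j, Complex.exp (-(z.1 j : ℂ) ^ 2 / 2 + (z.1 j + z.2 j * Complex.I) ^ 2 / 4)

theorem coherentCoeff_eq (z : (Fin d → ℝ) × (Fin d → ℝ)) (α : Fin d → ℕ) :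
    coherentCoeff z α = fockMonomial z α * fockFactor z := by
  rw [fockMonomial, fockFactor, ← Finset.prod_mul_distrib]
  rfl

theorem norm_fockFactor (z : (Fin d → ℝ) × (Fin d → ℝ)) :
    ‖fockFactor z‖ = Real.exp (-phaseEnergy z / 4) := by
  rw [fockFactor, norm_prod, phaseEnergy, ← Finset.sum_neg_distrib, Finset.sum_div, Real.exp_sum]
  refine Finset.prod_congr rfl fun j _ => ?_
  rw [Complex.norm_exp]
  congr 1
  simp [pow_two]
  ring

theorem stft_eq_fockTransform (f : HermiteSeries d) (z : (Fin d → ℝ) × (Fin d → ℝ)) :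
    stft f z = (((2 * Real.pi) ^ (-(d / 2) : ℝ) : ℝ) : ℂ) *
      (fockTransform f z * conj (fockFactor z)) := by
  rw [stft_eq_tsum, fockTransform, ← tsum_mul_right]
  simp only [coherentCoeff_eq, map_mul, mul_assoc]

theorem norm_stft (f : HermiteSeries d) (z : (Fin d → ℝ) × (Fin d → ℝ)) :
    ‖stft f z‖ = (2 * Real.pi) ^ (-(d / 2) : ℝ) *
      (‖fockTransform f z‖ * Real.exp (-phaseEnergy z / 4)) := by
  rw [stft_eq_fockTransform, norm_mul, norm_mul, RCLike.norm_conj, norm_fockFactor,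
    Complex.norm_real, Real.norm_of_nonneg (by positivity)]

/-- The map is multiplication of every x_j + iξ_j by a, and the monomial is homogeneous of degree
|α|. -/
theorem fockMonomial_phaseMap (a : ℂ) (z : (Fin d → ℝ) × (Fin d → ℝ)) (α : Fin d → ℕ) :
    fockMonomial (phaseMap a.re (-a.im) a.im a.re z) α =
      a ^ multiLength α * fockMonomial z α := by
  rw [multiLength, ← Finset.prod_pow_eq_pow_sum, fockMonomial, fockMonomial,
    ← Finset.prod_mul_distrib]
  refine Finset.prod_congr rfl fun j _ => ?_
  have h1 : (((phaseMap a.re (-a.im) a.im a.re z).1 j : ℝ) : ℂ) +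
      ((phaseMap a.re (-a.im) a.im a.re z).2 j : ℝ) * Complex.I =
      a * (z.1 j + z.2 j * Complex.I) := by
    conv_rhs => rw [← Complex.re_add_im a]
    simp only [phaseMap, Pi.add_apply, Pi.smul_apply, smul_eq_mul]
    push_cast
    linear_combination (-(a.im : ℂ) * z.2 j) * Complex.I_sq
  rw [h1, mul_pow]
  ring

theorem phaseEnergy_phaseMap (a : ℂ) (z : (Fin d → ℝ) × (Fin d → ℝ)) :
    phaseEnergy (phaseMap a.re (-a.im) a.im a.re z) = ‖a‖ ^ 2 * phaseEnergy z := by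
  rw [phaseEnergy, phaseEnergy, Finset.mul_sum]
  refine Finset.sum_congr rfl fun j _ => ?_
  rw [← Complex.normSq_eq_norm_sq, Complex.normSq_apply]
  simp only [phaseMap, Pi.add_apply, Pi.smul_apply, smul_eq_mul]
  ring

/-- Multiplication of the Hermite coefficients by powers `b \bar a^{|α|}` corresponds to the
complex dilation by `a` in phase space. -/
theorem norm_stft_dilate (a b : ℂ) (f : HermiteSeries d) (z : (Fin d → ℝ) × (Fin d → ℝ)) :
    ‖stft (fun α => b * conj a ^ multiLength α * f α) z‖ =
      ‖b‖ * ‖stft f (phaseMap a.re (-a.im) a.im a.re z)‖ *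
        Real.exp (-(1 - ‖a‖ ^ 2) * phaseEnergy z / 4) := by
  have h1 : fockTransform (fun α => b * conj a ^ multiLength α * f α) z =
      b * fockTransform f (phaseMap a.re (-a.im) a.im a.re z) := by
    rw [fockTransform, fockTransform, ← tsum_mul_left]
    refine tsum_congr fun α => ?_
    rw [fockMonomial_phaseMap, map_mul, map_pow]
    ring
  have h2 : Real.exp (-phaseEnergy z / 4) =
      Real.exp (-(‖a‖ ^ 2 * phaseEnergy z) / 4) *
        Real.exp (-(1 - ‖a‖ ^ 2) * phaseEnergy z / 4) := by
    rw [← Real.exp_add]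
    congr 1
    ring
  rw [norm_stft, norm_stft, h1, norm_mul, phaseEnergy_phaseMap, h2]
  ring

/-- Apart from e^(-it(d+c)), of modulus e^(t Im c), the coefficients are multiplied by powers of
conj a with a = e^(2it). Since |a| = 1, the Gaussian correction disappears and only the rotation by
2t is left. -/
theorem norm_stft_oscPropagator (c : ℂ) (f : HermiteSeries d) (t : ℝ)
    (z : (Fin d → ℝ) × (Fin d → ℝ)) :
    ‖stft (oscPropagator c f t) z‖ = Real.exp (t * c.im) *
      ‖stft f (phaseMap (Real.cos (2 * t)) (-Real.sin (2 * t)) (Real.sin (2 * t))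
        (Real.cos (2 * t)) z)‖ := by
  have ha : ((Real.cos (2 * t) : ℝ) : ℂ) + (Real.sin (2 * t) : ℝ) * Complex.I =
      Complex.exp ((2 * t : ℝ) * Complex.I) := by
    rw [Complex.exp_mul_I]
    push_cast
    rfl
  have h1 := norm_stft_dilate (Complex.exp ((2 * t : ℝ) * Complex.I))
    (Complex.exp (-Complex.I * t * (d + c))) f z
  rw [Complex.exp_ofReal_mul_I_re, Complex.exp_ofReal_mul_I_im, Complex.norm_exp_ofReal_mul_I,
    Complex.norm_exp] at h1
  have h2 : oscPropagator c f t = fun α => Complex.exp (-Complex.I * t * (d + c)) *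
      conj (Complex.exp ((2 * t : ℝ) * Complex.I)) ^ multiLength α * f α := by
    ext α
    rw [oscPropagator, ← Complex.exp_conj, ← Complex.exp_nat_mul, ← Complex.exp_add]
    congr 2
    rw [map_mul, Complex.conj_ofReal, Complex.conj_I]
    push_cast
    ring
  rw [h2, h1]
  simp

theorem fockTransform_eq_zero_iff_stft (f : HermiteSeries d) (z : (Fin d → ℝ) × (Fin d → ℝ)) :
    fockTransform f z = 0 ↔ stft f z = 0 := by
  rw [← norm_eq_zero (a := stft f z), norm_stft]
  have h1 := Real.exp_pos (-phaseEnergy z / 4)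
  have h2 : (0 : ℝ) < (2 * Real.pi) ^ (-(d / 2) : ℝ) := by positivity
  simp [h1.ne', h2.ne']

/-- An element of `Σ₁'` is determined by its short-time Fourier transform. -/
theorem eq_zero_of_stft_eq_zero {f : HermiteSeries d} (hf : f ∈ sigmaOneDual d)
    (h : ∀ z, stft f z = 0) : f = 0 := by
  -- On the torus |x_j + iξ_j| = 1 the Fock transform is an absolutely convergent Fourier series
  -- with coefficients f(α)N(α), so its vanishing there already forces f = 0.
  let N : (Fin d → ℕ) → ℂ := fun α =>
    ∏ j, (((2 ^ α j * ((α j).factorial : ℝ)) ^ (-(1 / 2) : ℝ) : ℝ) : ℂ)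
  have hN0 : ∀ α, N α ≠ 0 := fun α => Finset.prod_ne_zero_iff.2 fun j _ => by
    rw [Ne, Complex.ofReal_eq_zero]
    positivity
  let e : (Fin d → ℕ) → (Fin d → ℤ) := fun α j => (α j : ℤ)
  have he : Function.Injective e := fun α β hαβ => funext fun j => by
    have := congrFun hαβ j
    simpa [e] using this
  have hsum : Summable fun α => ‖f α * N α‖ := by
    refine Summable.of_nonneg_of_le (fun α => norm_nonneg _) (fun α => ?_)
      (summable_norm_mul_coherentMajorant hf zero_le_one)
    rw [norm_mul, norm_prod, coherentMajorant]
    gcongr with j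
    rw [Complex.norm_real, Real.norm_of_nonneg (by positivity), rpow_neg_half_eq (by positivity),
      one_pow, one_div]
    refine inv_anti₀ (by positivity) (Real.sqrt_le_sqrt ?_)
    exact le_mul_of_one_le_left (by positivity) (one_le_pow₀ one_le_two)
  have hsum' : Summable fun α => (f α * N α) • UnitAddTorus.mFourier (e α) := by
    refine Summable.of_norm ?_
    simpa [norm_smul, UnitAddTorus.mFourier_norm] using hsum
  have hzero : ∑' α, (f α * N α) • UnitAddTorus.mFourier (e α) = 0 := by
    ext t
    refine (ContinuousMap.tsum_apply hsum' t).symm.trans ?_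
    rw [ContinuousMap.zero_apply]
    -- The sign of the second coordinate undoes the conjugation in `fockTransform`, so that
    -- characters of nonnegative frequency appear.
    rw [← (fockTransform_eq_zero_iff_stft f (fun j => ((t j).toCircle : ℂ).re,
      fun j => -((t j).toCircle : ℂ).im)).2 (h _), fockTransform]
    refine tsum_congr fun α => ?_
    have h1 : conj (fockMonomial (fun j => ((t j).toCircle : ℂ).re,
        fun j => -((t j).toCircle : ℂ).im) α) = N α * UnitAddTorus.mFourier (e α) t := by
      simp only [fockMonomial, N, Finset.prod_mul_distrib, map_mul, map_prod, Complex.conj_ofReal,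
        map_pow, UnitAddTorus.mFourier, ContinuousMap.coe_mk, e, fourier_apply]
      congr 1
      refine Finset.prod_congr rfl fun j _ => ?_
      rw [natCast_zsmul, AddCircle.toCircle_nsmul]
      congr 1
      apply Complex.ext <;> simp
    rw [h1, ContinuousMap.smul_apply, smul_eq_mul, mul_assoc]
  -- Uniform convergence passes to L², where orthonormality of the characters isolates each
  -- coefficient.
  have hLp : HasSum (fun α => (f α * N α) • UnitAddTorus.mFourierLp (d := Fin d) 2 (e α)) 0 := by
    have h1 := hsum'.hasSum
    rw [hzero] at h1
    have : IsFiniteMeasure (@volume _ (@MeasureSpace.pi (Fin d) _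
        (fun _ => UnitAddCircle) (fun _ => instMeasureSpaceUnitAddCircle))) :=
      inferInstanceAs
        (IsFiniteMeasure (Measure.pi fun _ : Fin d => AddCircle.haarAddCircle (T := 1)))
    have h2 := h1.mapL (ContinuousMap.toLp (E := ℂ) 2 (@volume _ (@MeasureSpace.pi (Fin d) _
      (fun _ => UnitAddCircle) (fun _ => instMeasureSpaceUnitAddCircle))) ℂ)
    simp only [map_smul, map_zero] at h2
    exact h2
  ext β
  have h3 := hLp.mapL (innerSL ℂ (UnitAddTorus.mFourierLp (d := Fin d) 2 (e β)))
  have h4 : ∀ α, innerSL ℂ (UnitAddTorus.mFourierLp (d := Fin d) 2 (e β))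
      ((f α * N α) • UnitAddTorus.mFourierLp (d := Fin d) 2 (e α)) =
      if α = β then f β * N β else 0 := by
    intro α
    rw [innerSL_apply_apply, inner_smul_right,
      orthonormal_iff_ite.1 UnitAddTorus.orthonormal_mFourier]
    by_cases hα : α = β
    · simp [hα]
    · have : e β ≠ e α := fun h' => hα (he h').symm
      simp [hα, this]
  simp only [h4, map_zero] at h3
  have h5 := h3.unique (hasSum_ite_eq β (f β * N β))
  simpa [hN0] using h5.symm

end Fock

/-! ### Modulation and Wiener amalgam quasi-norms as mixed norms -/

section PhaseNorm

variable {d : ℕ}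

/-- The modulus `|V_φ f · ω|`. -/
noncomputable def weightedStft (ω : (Fin d → ℝ) × (Fin d → ℝ) → ℝ) (f : HermiteSeries d)
    (z : (Fin d → ℝ) × (Fin d → ℝ)) : ℝ≥0∞ :=
  ‖stft f z * (ω z : ℂ)‖ₑ

/-- The mixed norm of `V_φ f · ω` after a permutation `S` of the phase space variables `x, ξ`. -/
noncomputable def phaseNorm (S : (Fin d → ℝ) × (Fin d → ℝ) → (Fin d → ℝ) × (Fin d → ℝ))
    (ω : (Fin d → ℝ) × (Fin d → ℝ) → ℝ) (p q : ℝ≥0∞) (f : HermiteSeries d) : ℝ≥0∞ :=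
  mixNorm volume volume p q (fun z => weightedStft ω f (S z))

theorem modNorm_eq_phaseNorm (ω : (Fin d → ℝ) × (Fin d → ℝ) → ℝ) (p q : ℝ≥0∞) :
    modNorm ω p q = phaseNorm id ω p q := by
  ext f
  simp only [modNorm, mixedNorm, phaseNorm, mixNorm, weightedStft, id_eq, eLpNorm_enorm]

theorem wienerNorm_eq_phaseNorm (ω : (Fin d → ℝ) × (Fin d → ℝ) → ℝ) (p q : ℝ≥0∞) :
    wienerNorm ω p q = phaseNorm Prod.swap ω q p := by
  ext f
  simp only [wienerNorm, mixedNormStar, phaseNorm, mixNorm, weightedStft, Prod.swap_prod_mk,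
    eLpNorm_enorm]

/-- `S` is one of the two permutations of the phase space variables `x, ξ`. -/
def IsPhasePerm (S : (Fin d → ℝ) × (Fin d → ℝ) → (Fin d → ℝ) × (Fin d → ℝ)) : Prop :=
  S = id ∨ S = Prod.swap

theorem isPhasePerm_id : IsPhasePerm (d := d) id := Or.inl rfl

theorem isPhasePerm_swap : IsPhasePerm (d := d) Prod.swap := Or.inr rfl

variable {S S' : (Fin d → ℝ) × (Fin d → ℝ) → (Fin d → ℝ) × (Fin d → ℝ)}
  {ω : (Fin d → ℝ) × (Fin d → ℝ) → ℝ} {p q : ℝ≥0∞} {f g : HermiteSeries d}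

theorem IsPhasePerm.quasiMeasurePreserving (hS : IsPhasePerm S) :
    Measure.QuasiMeasurePreserving S volume volume := by
  rcases hS with rfl | rfl
  · exact Measure.QuasiMeasurePreserving.id _
  · exact (Measure.measurePreserving_swap (μ := (volume : Measure (Fin d → ℝ)))
      (ν := (volume : Measure (Fin d → ℝ)))).quasiMeasurePreserving

theorem IsPhasePerm.apply_apply (hS : IsPhasePerm S) (z : (Fin d → ℝ) × (Fin d → ℝ)) :
    S (S z) = z := by
  rcases hS with rfl | rfl <;> simp

theorem IsPhasePerm.apply_smul (hS : IsPhasePerm S) (r : ℝ) (z : (Fin d → ℝ) × (Fin d → ℝ)) :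
    S (r • z) = r • S z := by
  rcases hS with rfl | rfl <;> simp

theorem IsPhasePerm.sum_abs (hS : IsPhasePerm S) (z : (Fin d → ℝ) × (Fin d → ℝ)) :
    ∑ j, (|(S z).1 j| + |(S z).2 j|) = ∑ j, (|z.1 j| + |z.2 j|) := by
  rcases hS with rfl | rfl
  · rfl
  · exact Finset.sum_congr rfl fun j _ => add_comm _ _

theorem IsPhasePerm.measurable (hS : IsPhasePerm S) : Measurable S :=
  hS.quasiMeasurePreserving.measurable

theorem weightedStft_eq_ofReal (hω : ∀ z, 0 < ω z) (f : HermiteSeries d)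
    (z : (Fin d → ℝ) × (Fin d → ℝ)) :
    weightedStft ω f z = ENNReal.ofReal (‖stft f z‖ * ω z) := by
  rw [weightedStft, ← ofReal_norm, norm_mul, Complex.norm_real,
    Real.norm_of_nonneg (hω z).le]

theorem aemeasurable_weightedStft (hω : IsWeight ω) (hf : f ∈ sigmaOneDual d) :
    AEMeasurable (weightedStft ω f) volume :=
  (((continuous_stft hf).aemeasurable).mul
    (Complex.measurable_ofReal.comp_aemeasurable hω.aemeasurable)).enorm

theorem aemeasurable_weightedStft_comp (hS : IsPhasePerm S) (hω : IsWeight ω)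
    (hf : f ∈ sigmaOneDual d) : AEMeasurable (fun z => weightedStft ω f (S z)) volume :=
  (aemeasurable_weightedStft hω hf).comp_quasiMeasurePreserving hS.quasiMeasurePreserving

theorem weightedStft_add_le (hf : f ∈ sigmaOneDual d) (hg : g ∈ sigmaOneDual d)
    (z : (Fin d → ℝ) × (Fin d → ℝ)) :
    weightedStft ω (f + g) z ≤ weightedStft ω f z + weightedStft ω g z := by
  rw [weightedStft, stft_add hf hg, add_mul]
  exact enorm_add_le _ _

theorem weightedStft_neg (f : HermiteSeries d) (z : (Fin d → ℝ) × (Fin d → ℝ)) :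
    weightedStft ω (-f) z = weightedStft ω f z := by
  rw [weightedStft, stft_neg, neg_mul, enorm_neg, weightedStft]

theorem phaseNorm_add_le (hS : IsPhasePerm S) (hω : IsWeight ω) (hf : f ∈ sigmaOneDual d)
    (hg : g ∈ sigmaOneDual d) : phaseNorm S ω p q (f + g) ≤
      ENNReal.LpAddConst p * ENNReal.LpAddConst q * (phaseNorm S ω p q f + phaseNorm S ω p q g) :=
  (mixNorm_mono fun _ => weightedStft_add_le hf hg _).trans
    (mixNorm_add_le (aemeasurable_weightedStft_comp hS hω hf)
      (aemeasurable_weightedStft_comp hS hω hg))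

theorem phaseNorm_neg (f : HermiteSeries d) : phaseNorm S ω p q (-f) = phaseNorm S ω p q f := by
  simp only [phaseNorm, weightedStft_neg]

theorem phaseNorm_sub_comm (f g : HermiteSeries d) :
    phaseNorm S ω p q (f - g) = phaseNorm S ω p q (g - f) := by
  rw [← phaseNorm_neg, neg_sub]

/-- The weight is positive, so V_φ f vanishes almost everywhere, and by continuity everywhere. -/
theorem eq_zero_of_phaseNorm_eq_zero (hS : IsPhasePerm S) (hω : IsWeight ω) (hp : p ≠ 0)
    (hq : q ≠ 0) (hf : f ∈ sigmaOneDual d) (h : phaseNorm S ω p q f = 0) : f = 0 := by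
  have h1 := mixNorm_eq_zero hp hq (aemeasurable_weightedStft_comp hS hω hf) h
  have h2 : ∀ᵐ z : (Fin d → ℝ) × (Fin d → ℝ), weightedStft ω f (S (S z)) = 0 :=
    hS.quasiMeasurePreserving.ae h1
  have h3 : stft f =ᵐ[volume] fun _ => 0 := by
    filter_upwards [h2] with z hz
    rw [hS.apply_apply, weightedStft, enorm_eq_zero, mul_eq_zero] at hz
    exact hz.resolve_right (by exact_mod_cast (hω.pos z).ne')
  have h4 := Continuous.ae_eq_iff_eq volume (continuous_stft hf) continuous_const |>.1 h3
  exact eq_zero_of_stft_eq_zero hf fun z => congrFun h4 z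

/-- Measurability in time of the quasi-norms of a family of distributions with measurable Hermite
coefficients. -/
theorem aemeasurable_phaseNorm {γ : Type*} [MeasurableSpace γ] {μ : Measure γ}
    (hS : IsPhasePerm S) (hω : IsWeight ω) {u : γ → HermiteSeries d}
    (hu : ∀ α, AEMeasurable (fun t => u t α) μ) (hu' : ∀ᵐ t ∂μ, u t ∈ sigmaOneDual d) :
    AEMeasurable (fun t => phaseNorm S ω p q (u t)) μ := by
  have hmk : ∀ᵐ t ∂μ, u t ∈ sigmaOneDual d ∧ ∀ α, u t α = (hu α).mk _ t :=
    hu'.and (ae_all_iff.2 fun α => (hu α).ae_eq_mk)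
  obtain ⟨B, hBsub, hBm, hB0⟩ := exists_measurable_superset_of_null (ae_iff.1 hmk)
  have hBu : ∀ t, t ∉ B → u t ∈ sigmaOneDual d ∧ ∀ α, u t α = (hu α).mk _ t := fun t ht => by
    by_contra h
    exact ht (hBsub h)
  -- Replacing u by 0 on a measurable null set makes all coefficients measurable and all series
  -- convergent at every parameter. The transform is then jointly measurable as a pointwise limit of
  -- finite sums.
  let w : γ → HermiteSeries d := fun t => Bᶜ.indicator u t
  have hwm : ∀ α, Measurable fun t => w t α := by
    intro α
    have h1 : (fun t => w t α) = Bᶜ.indicator ((hu α).mk _) := by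
      ext t
      by_cases ht : t ∈ B
      · simp [w, ht]
      · simpa [w, ht] using (hBu t ht).2 α
    rw [h1]
    exact (hu α).measurable_mk.indicator hBm.compl
  have hw : ∀ t, w t ∈ sigmaOneDual d := by
    intro t
    by_cases ht : t ∈ B
    · simp only [w, Set.mem_compl_iff, ht, not_true_eq_false, not_false_eq_true,
        Set.indicator_of_notMem]
      exact ⟨1, one_pos, 0, fun α => by simp⟩
    · simpa [w, ht] using (hBu t ht).1
  have hae : ∀ᵐ t ∂μ, u t = w t := by
    filter_upwards [compl_mem_ae_iff.2 hB0] with t ht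
    exact (Set.indicator_of_mem ht u).symm
  have hstft : Measurable fun tz : γ × ((Fin d → ℝ) × (Fin d → ℝ)) => stft (w tz.1) (S tz.2) := by
    simp only [stft_eq_tsum]
    refine measurable_const.mul ?_
    refine measurable_of_tendsto_metrizable' (atTop : Filter (Finset (Fin d → ℕ)))
      (f := fun s (tz : γ × ((Fin d → ℝ) × (Fin d → ℝ))) =>
        ∑ α ∈ s, w tz.1 α * conj (coherentCoeff (S tz.2) α)) (fun s => ?_)
      (tendsto_pi_nhds.2 fun tz => (summable_mul_conj_coherentCoeff (hw tz.1) (S tz.2)).hasSum)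
    refine Finset.measurable_sum _ fun α _ => ((hwm α).comp measurable_fst).mul ?_
    exact (Complex.continuous_conj.comp (continuous_coherentCoeff α)).measurable.comp
      (hS.measurable.comp measurable_snd)
  have hωS : AEMeasurable (fun z => ω (S z)) volume :=
    hω.aemeasurable.comp_quasiMeasurePreserving hS.quasiMeasurePreserving
  refine ⟨fun t => mixNorm volume volume p q (fun z => ‖stft (w t) (S z) * (hωS.mk _ z : ℂ)‖ₑ),
    measurable_mixNorm (H := fun tz : γ × ((Fin d → ℝ) × (Fin d → ℝ)) =>
      ‖stft (w tz.1) (S tz.2) * (hωS.mk _ tz.2 : ℂ)‖ₑ) ?_, ?_⟩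
  · exact (hstft.mul (Complex.measurable_ofReal.comp
      (hωS.measurable_mk.comp measurable_snd))).enorm
  · filter_upwards [hae] with t ht
    rw [ht]
    refine mixNorm_congr_ae ?_
    filter_upwards [hωS.ae_eq_mk] with z hz
    rw [weightedStft, hz]

theorem phaseNorm_lt_top_of_mem_sigmaOne (hS : IsPhasePerm S) (hω : IsWeight ω)
    (hm : IsModerate ω) (hf : f ∈ sigmaOne d) : phaseNorm S ω p q f < ∞ := by
  obtain ⟨A, R, hA, hR, hAR⟩ := hm.exists_exp_bound hω.pos
  -- R absorbs the growth of the weight; the surplus 2 matches the bound of the sum of all |x_j| +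
  -- |ξ_j| by twice `phaseRadius`.
  obtain ⟨C, hC, hCf⟩ := exists_norm_stft_le_of_mem_sigmaOne hf (R := R + 2) (by linarith)
  have hω0 := hω.pos 0
  have h1 : ∀ z, weightedStft ω f (S z) ≤ ENNReal.ofReal (C * (A * ω 0)) *
      ENNReal.ofReal (Real.exp (-∑ j, (|z.1 j| + |z.2 j|))) := by
    intro z
    rw [weightedStft_eq_ofReal hω.pos, ← ENNReal.ofReal_mul (by positivity), ← hS.sum_abs z]
    refine ENNReal.ofReal_le_ofReal ?_
    generalize S z = z
    have h2 : ω z ≤ A * Real.exp (R * phaseRadius z) * ω 0 := by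
      have h3 := hAR 0 z
      rw [zero_add] at h3
      refine h3.trans ?_
      gcongr
      exact norm_le_phaseRadius z
    calc ‖stft f z‖ * ω z ≤ (C * Real.exp (-(R + 2) * phaseRadius z)) *
          (A * Real.exp (R * phaseRadius z) * ω 0) := by
          gcongr
          · exact (hω.pos z).le
          · exact hCf z
      _ = C * (A * ω 0) * Real.exp (-(2 * phaseRadius z)) := by
          have h4 : Real.exp (-(2 * phaseRadius z)) =
              Real.exp (-(R + 2) * phaseRadius z) * Real.exp (R * phaseRadius z) := by
            rw [← Real.exp_add]
            congr 1
            ring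
          rw [h4]
          ring
      _ ≤ _ := by
          gcongr
          exact sum_abs_le_phaseRadius z
  refine (mixNorm_mono h1).trans_lt ?_
  rw [mixNorm_const_mul ENNReal.ofReal_ne_top]
  exact ENNReal.mul_lt_top ENNReal.ofReal_lt_top (mixNorm_exp_neg_lt_top p q)

/-! ### The dispersive estimate at a fixed time. -/

/-- The time dependence `(|sin 4t| / 2)^{-a}` of the dispersive estimate. -/
noncomputable def dispersionKernel (a t : ℝ) : ℝ≥0∞ :=
  ENNReal.ofReal (|Real.sin (4 * t)| / 2) ^ (-a)

theorem weightedStft_oscPropagator (hω : IsModerateRadialWeight ω) (c : ℂ) (f : HermiteSeries d)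
    (t : ℝ) (z : (Fin d → ℝ) × (Fin d → ℝ)) :
    weightedStft ω (oscPropagator c f t) z = ENNReal.ofReal (Real.exp (t * c.im)) *
      weightedStft ω f (phaseMap (Real.cos (2 * t)) (-Real.sin (2 * t)) (Real.sin (2 * t))
        (Real.cos (2 * t)) z) := by
  rw [weightedStft_eq_ofReal hω.isWeight.pos, weightedStft_eq_ofReal hω.isWeight.pos,
    ← ENNReal.ofReal_mul (Real.exp_pos _).le, norm_stft_oscPropagator, hω.comp_rotation]
  congr 1
  ring

/-- Composing with swaps permutes the rotation matrix. Its lower left entry, which governs the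
change of variables, is ±sin θ if the two permutations agree and ±cos θ otherwise; the determinant
may change sign. -/
theorem exists_phaseMap_eq (hS : IsPhasePerm S) (hS' : IsPhasePerm S') (θ : ℝ) :
    ∃ a b c e : ℝ, |a * e - b * c| = 1 ∧ (|c| = |Real.sin θ| ∨ |c| = |Real.cos θ|) ∧
      ∀ z, S (phaseMap (Real.cos θ) (-Real.sin θ) (Real.sin θ) (Real.cos θ) (S' z)) =
        phaseMap a b c e z := by
  have h := Real.sin_sq_add_cos_sq θ
  have h1 : |Real.cos θ * Real.cos θ - -Real.sin θ * Real.sin θ| = 1 := by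
    rw [show Real.cos θ * Real.cos θ - -Real.sin θ * Real.sin θ = 1 by linarith, abs_one]
  have h2 : |Real.sin θ * -Real.sin θ - Real.cos θ * Real.cos θ| = 1 := by
    rw [show Real.sin θ * -Real.sin θ - Real.cos θ * Real.cos θ = -1 by linarith, abs_neg, abs_one]
  rcases hS with rfl | rfl <;> rcases hS' with rfl | rfl
  · exact ⟨_, _, _, _, h1, Or.inl rfl, fun z => rfl⟩
  · refine ⟨-Real.sin θ, Real.cos θ, Real.cos θ, Real.sin θ, ?_, Or.inr rfl, fun z => ?_⟩
    · rw [← h2]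
      congr 1
      ring
    · simp only [phaseMap, Prod.fst_swap, Prod.snd_swap, id_eq]
      rw [add_comm, add_comm (Real.sin θ • z.2)]
  · exact ⟨Real.sin θ, Real.cos θ, Real.cos θ, -Real.sin θ, h2, Or.inr rfl, fun z => rfl⟩
  · refine ⟨Real.cos θ, Real.sin θ, -Real.sin θ, Real.cos θ, ?_, Or.inl (abs_neg _), fun z => ?_⟩
    · rw [← h1]
      congr 1
      ring
    · simp only [phaseMap, Prod.fst_swap, Prod.snd_swap, Prod.swap_prod_mk]
      rw [add_comm, add_comm (Real.cos θ • z.2)]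

/-- The dispersive estimate for the propagator at a fixed time. -/
theorem phaseNorm_oscPropagator_le (hS : IsPhasePerm S) (hS' : IsPhasePerm S')
    (hω : IsModerateRadialWeight ω) (hq : 0 < q) (hqp : q ≤ p) (c : ℂ)
    (hf : f ∈ sigmaOneDual d) {t : ℝ} (ht : Real.sin (4 * t) ≠ 0) :
    phaseNorm S' ω q p (oscPropagator c f t) ≤ ENNReal.ofReal (Real.exp (t * c.im)) *
      (dispersionKernel (d * (q⁻¹.toReal - p⁻¹.toReal)) t * phaseNorm S ω p q f) := by
  obtain ⟨a, b, k, e, hdet, hk, hmap⟩ := exists_phaseMap_eq hS hS' (2 * t)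
  have hsin : Real.sin (4 * t) = 2 * Real.sin (2 * t) * Real.cos (2 * t) := by
    rw [← Real.sin_two_mul]
    congr 1
    ring
  -- |sin 4t|/2 = |sin 2t||cos 2t| bounds both possible values of |k| from below, so one kernel
  -- serves all combinations of M and W.
  have hk' : |Real.sin (4 * t)| / 2 ≤ |k| := by
    rw [hsin, abs_mul, abs_mul, abs_two, mul_assoc, mul_div_cancel_left₀ _ two_ne_zero]
    rcases hk with hk | hk <;> rw [hk]
    · exact mul_le_of_le_one_right (abs_nonneg _) (Real.abs_cos_le_one _)
    · exact mul_le_of_le_one_left (abs_nonneg _) (Real.abs_sin_le_one _)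
  have hk0 : k ≠ 0 := by
    intro h0
    rw [h0, abs_zero] at hk'
    have := abs_pos.2 ht
    linarith
  have hexp : 0 ≤ (d : ℝ) * (q⁻¹.toReal - p⁻¹.toReal) := by
    have h1 : p⁻¹.toReal ≤ q⁻¹.toReal :=
      ENNReal.toReal_mono (ENNReal.inv_ne_top.2 hq.ne') (ENNReal.inv_le_inv.2 hqp)
    exact mul_nonneg (by positivity) (by linarith)
  have h1 : ∀ z, weightedStft ω (oscPropagator c f t) (S' z) =
      ENNReal.ofReal (Real.exp (t * c.im)) * weightedStft ω f (S (phaseMap a b k e z)) := by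
    intro z
    rw [weightedStft_oscPropagator hω, ← hmap, hS.apply_apply]
  rw [phaseNorm]
  simp_rw [h1]
  rw [mixNorm_const_mul ENNReal.ofReal_ne_top]
  gcongr
  refine (mixNorm_comp_phaseMap_le hq hqp hk0 hdet
    (aemeasurable_weightedStft_comp hS hω.isWeight hf)).trans ?_
  rw [dispersionKernel, phaseNorm]
  gcongr ?_ * _
  rw [ENNReal.rpow_neg, ENNReal.rpow_neg, ENNReal.inv_le_inv]
  exact ENNReal.rpow_le_rpow (ENNReal.ofReal_le_ofReal hk') hexp

end PhaseNorm

/-! ### Density of `Σ₁` -/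

section Density

variable {d : ℕ}

/-- The action of the Mehler semigroup on Hermite series. -/
noncomputable def mehler (r : ℝ) (f : HermiteSeries d) : HermiteSeries d :=
  fun α => (r : ℂ) ^ multiLength α * f α

theorem mehler_add (r : ℝ) (f g : HermiteSeries d) : mehler r (f + g) = mehler r f + mehler r g :=
  funext fun _ => mul_add _ _ _

theorem mehler_mem_sigmaOne {r : ℝ} (hr : 0 < r) (hr1 : r < 1) {f : HermiteSeries d}
    (hf : f ∈ sigmaOneDual d) : mehler r f ∈ sigmaOne d := by
  obtain ⟨s, hs, C, hC⟩ := hf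
  intro ρ hρ
  obtain ⟨l, hl, rfl⟩ : ∃ l : ℝ, 0 < l ∧ Real.exp (-l) = r :=
    ⟨-Real.log r, neg_pos.2 (Real.log_neg hr hr1), by rw [neg_neg, Real.exp_log hr]⟩
  -- The exponent is the maximum of (s + ρ)m - lm² over m = √|α|: the damping e^(-l|α|) beats every
  -- e^(O(√|α|)).
  refine ⟨|C| * Real.exp ((s + ρ) ^ 2 / (4 * l)), fun α => ?_⟩
  obtain ⟨m, hm⟩ : ∃ m : ℝ, m = √(multiLength α : ℝ) := ⟨_, rfl⟩
  have hm2 : (multiLength α : ℝ) = m ^ 2 := by rw [hm, Real.sq_sqrt (by positivity)]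
  have h1 : ‖mehler (Real.exp (-l)) f α‖ = Real.exp (-l * m ^ 2) * ‖f α‖ := by
    rw [mehler, norm_mul, norm_pow, Complex.norm_real, Real.norm_of_nonneg (Real.exp_pos _).le,
      ← Real.exp_nat_mul, hm2, mul_comm (m ^ 2)]
  have h2 : -l * m ^ 2 + s * m ≤ (s + ρ) ^ 2 / (4 * l) + -ρ * m := by
    have h3 : (s + ρ) ^ 2 / (4 * l) - (s + ρ) * m + l * m ^ 2 =
        ((s + ρ) / 2 - l * m) ^ 2 / l := by
      field_simp
      ring
    have h4 : 0 ≤ ((s + ρ) / 2 - l * m) ^ 2 / l := by positivity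
    linarith
  rw [h1, ← hm, mul_assoc, ← Real.exp_add]
  calc Real.exp (-l * m ^ 2) * ‖f α‖ ≤ Real.exp (-l * m ^ 2) * (|C| * Real.exp (s * m)) := by
        gcongr
        refine (hC α).trans ?_
        rw [← hm]
        gcongr
        exact le_abs_self C
    _ = |C| * Real.exp (-l * m ^ 2 + s * m) := by rw [Real.exp_add]; ring
    _ ≤ _ := by gcongr

theorem norm_stft_mehler (r : ℝ) (f : HermiteSeries d) (z : (Fin d → ℝ) × (Fin d → ℝ)) :
    ‖stft (mehler r f) z‖ = ‖stft f (r • z)‖ * Real.exp (-(1 - r ^ 2) * phaseEnergy z / 4) := by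
  have h := norm_stft_dilate (r : ℂ) 1 f z
  have h2 : phaseMap r (-0) 0 r z = r • z := by
    ext j <;> simp [phaseMap]
  simp only [Complex.conj_ofReal, one_mul, Complex.ofReal_re, Complex.ofReal_im, norm_one,
    Complex.norm_real, Real.norm_eq_abs, sq_abs, h2] at h
  exact h

variable {S : (Fin d → ℝ) × (Fin d → ℝ) → (Fin d → ℝ) × (Fin d → ℝ)}
  {ω : (Fin d → ℝ) × (Fin d → ℝ) → ℝ} {p q : ℝ≥0∞} {f : HermiteSeries d}

/-- Comparing ω(z) with ω(rz) costs e^(R(1-r)‖z‖), while the dilation gains e^(-(1-r²)|z|²/4). As 1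
- r² ≥ 1 - r, completing the square leaves at most e^(R²), uniformly in r. -/
theorem exists_weightedStft_mehler_le (hω : IsWeight ω) (hm : IsModerate ω)
    (f : HermiteSeries d) : ∃ C : ℝ≥0, ∀ r : ℝ, 0 ≤ r → r ≤ 1 → ∀ z,
      weightedStft ω (mehler r f) z ≤ C * weightedStft ω f (r • z) := by
  obtain ⟨A, R, hA, hR, hAR⟩ := hm.exists_exp_bound hω.pos
  refine ⟨(A * Real.exp (R ^ 2)).toNNReal, fun r hr hr1 z => ?_⟩
  rw [weightedStft_eq_ofReal hω.pos, weightedStft_eq_ofReal hω.pos, norm_stft_mehler]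
  change _ ≤ ENNReal.ofReal (A * Real.exp (R ^ 2)) * _
  rw [← ENNReal.ofReal_mul (by positivity)]
  refine ENNReal.ofReal_le_ofReal ?_
  have h1 : ω z ≤ A * Real.exp (R * ((1 - r) * ‖z‖)) * ω (r • z) := by
    have h2 := hAR (r • z) ((1 - r) • z)
    rw [← add_smul, add_sub_cancel, one_smul, norm_smul, Real.norm_of_nonneg (by linarith)] at h2
    exact h2
  have h3 : -(1 - r ^ 2) * phaseEnergy z / 4 + R * ((1 - r) * ‖z‖) ≤ R ^ 2 := by
    have h4 := norm_sq_le_phaseEnergy z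
    have h5 : 0 ≤ 1 - r ^ 2 := by nlinarith
    have h6 : (1 - r ^ 2) * ‖z‖ ^ 2 ≤ (1 - r ^ 2) * phaseEnergy z := by gcongr
    have h7 : (1 - r) * ‖z‖ ^ 2 ≤ (1 - r ^ 2) * ‖z‖ ^ 2 := by
      gcongr
      nlinarith
    have h8 : (1 - r) * (R * ‖z‖ - ‖z‖ ^ 2 / 4) ≤ (1 - r) * R ^ 2 := by
      refine mul_le_mul_of_nonneg_left ?_ (by linarith)
      nlinarith [sq_nonneg (‖z‖ / 2 - R)]
    nlinarith [mul_nonneg hr (sq_nonneg R)]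
  calc _ ≤ ‖stft f (r • z)‖ * Real.exp (-(1 - r ^ 2) * phaseEnergy z / 4) *
        (A * Real.exp (R * ((1 - r) * ‖z‖)) * ω (r • z)) := by gcongr
    _ = A * Real.exp (-(1 - r ^ 2) * phaseEnergy z / 4 + R * ((1 - r) * ‖z‖)) *
        (‖stft f (r • z)‖ * ω (r • z)) := by
        rw [Real.exp_add]
        ring
    _ ≤ _ := by
        have h9 : 0 ≤ ‖stft f (r • z)‖ * ω (r • z) := mul_nonneg (norm_nonneg _) (hω.pos _).le
        gcongr

/-- `mehler r f` converges to `f` locally uniformly in phase space. -/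
theorem exists_tendsto_weightedStft_mehler_sub (hω : IsWeight ω) (hm : IsModerate ω)
    (hf : f ∈ sigmaOneDual d) {r : ℕ → ℝ} (hr0 : ∀ n, 0 < r n) (hr1 : ∀ n, r n < 1)
    (hr : Tendsto r atTop (𝓝 1)) (K : ℝ) :
    ∃ ε : ℕ → ℝ, Tendsto ε atTop (𝓝 0) ∧ (∀ n, 0 ≤ ε n) ∧ ∀ n z, ‖z‖ ≤ K →
      weightedStft ω (mehler (r n) f - f) z ≤ ENNReal.ofReal (ε n) := by
  obtain ⟨A, R, hA, hR, hAR⟩ := hm.exists_exp_bound hω.pos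
  obtain ⟨K', hK', hK⟩ := exists_radius_le (d := d) (Metric.closedBall 0 K)
    Metric.isBounded_closedBall
  have hsum := summable_norm_mul_coherentMajorant hf hK'
  let c : ℝ := (2 * Real.pi) ^ (-(d / 2) : ℝ)
  let B : ℝ := A * Real.exp (R * K) * ω 0
  have hB : 0 ≤ B := by have := hω.pos 0; positivity
  have hle : ∀ n (α : Fin d → ℕ), 0 ≤ 1 - r n ^ multiLength α ∧ 1 - r n ^ multiLength α ≤ 1 :=
    fun n α => ⟨sub_nonneg.2 (pow_le_one₀ (hr0 n).le (hr1 n).le),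
      sub_le_self _ (pow_nonneg (hr0 n).le _)⟩
  let t : ℕ → (Fin d → ℕ) → ℝ := fun n α =>
    (1 - r n ^ multiLength α) * (‖f α‖ * coherentMajorant K' α)
  have hmaj : ∀ α, 0 ≤ ‖f α‖ * coherentMajorant K' α := fun α =>
    mul_nonneg (norm_nonneg _) (coherentMajorant_nonneg hK' α)
  have ht0 : ∀ n α, 0 ≤ t n α := fun n α => mul_nonneg (hle n α).1 (hmaj α)
  have ht1 : ∀ n α, t n α ≤ ‖f α‖ * coherentMajorant K' α := fun n α =>
    mul_le_of_le_one_left (hmaj α) (hle n α).2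
  have hts : ∀ n, Summable (t n) := fun n => Summable.of_nonneg_of_le (ht0 n) (ht1 n) hsum
  have hlim : Tendsto (fun n => ∑' α, t n α) atTop (𝓝 (∑' _ : Fin d → ℕ, (0 : ℝ))) := by
    refine tendsto_tsum_of_dominated_convergence hsum (fun α => ?_) (.of_forall fun n α => ?_)
    · have h1 : Tendsto (fun n => (1 - r n ^ multiLength α) * (‖f α‖ * coherentMajorant K' α)) atTop
          (𝓝 ((1 - 1 ^ multiLength α) * (‖f α‖ * coherentMajorant K' α))) :=
        ((hr.pow _).const_sub 1).mul_const _
      simpa using h1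
    · rw [Real.norm_of_nonneg (ht0 n α)]
      exact ht1 n α
  refine ⟨fun n => c * (∑' α, t n α) * B, ?_, fun n => ?_, fun n z hz => ?_⟩
  · simpa using (hlim.const_mul c).mul_const B
  · have : 0 ≤ ∑' α, t n α := tsum_nonneg (ht0 n)
    positivity
  · rw [weightedStft_eq_ofReal hω.pos]
    refine ENNReal.ofReal_le_ofReal ?_
    have h1 : ‖stft (mehler (r n) f - f) z‖ ≤ c * ∑' α, t n α := by
      rw [stft_eq_tsum, norm_mul, Complex.norm_real, Real.norm_of_nonneg (by positivity)]
      gcongr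
      refine tsum_of_norm_bounded (hts n).hasSum fun α => ?_
      have h2 : (mehler (r n) f - f) α = -(((1 - r n ^ multiLength α : ℝ) : ℂ) * f α) := by
        simp only [mehler, Pi.sub_apply]
        push_cast
        ring
      rw [h2, norm_mul, norm_neg, norm_mul, RCLike.norm_conj, Complex.norm_real,
        Real.norm_of_nonneg (hle n α).1, mul_assoc]
      refine mul_le_mul_of_nonneg_left ?_ (hle n α).1
      gcongr
      exact norm_coherentCoeff_le (hK z (by simpa using hz)) α
    have h3 : ω z ≤ B := by
      have h4 := hAR 0 z
      rw [zero_add] at h4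
      refine h4.trans ?_
      have := (hω.pos 0).le
      simp only [B]
      gcongr
    have h5 : 0 ≤ c * ∑' α, t n α := (norm_nonneg _).trans h1
    exact mul_le_mul h1 h3 (hω.pos z).le h5

/-- For ‖z‖ ≤ 2k the transforms converge uniformly. Beyond, r ≥ 1/2 ensures ‖rz‖ > k, so both terms
are controlled by the part of the transform outside the ball of radius k, whose norm is small
uniformly in r because both exponents are finite. -/
theorem tendsto_phaseNorm_mehler_sub (hS : IsPhasePerm S) (hω : IsWeight ω) (hm : IsModerate ω)
    (hp : p ≠ 0) (hp' : p ≠ ∞) (hq : q ≠ 0) (hq' : q ≠ ∞) (hf : f ∈ sigmaOneDual d)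
    (hfin : phaseNorm S ω p q f ≠ ∞) {r : ℕ → ℝ} (hr0 : ∀ n, 1 / 2 ≤ r n) (hr1 : ∀ n, r n < 1)
    (hr : Tendsto r atTop (𝓝 1)) :
    Tendsto (fun n => phaseNorm S ω p q (mehler (r n) f - f)) atTop (𝓝 0) := by
  obtain ⟨C, hC⟩ := exists_weightedStft_mehler_le hω hm f
  have hrpos : ∀ n, 0 < r n := fun n => by linarith [hr0 n]
  set G := fun z => weightedStft ω f (S z) with hG
  have hGm : AEMeasurable G volume := aemeasurable_weightedStft_comp hS hω hf
  have hGr : ∀ n, AEMeasurable (fun z => G (r n • z)) volume := fun n =>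
    hGm.comp_quasiMeasurePreserving
      (Measure.quasiMeasurePreserving_smul volume (hrpos n).ne')
  set tail : ℕ → (Fin d → ℝ) × (Fin d → ℝ) → ℝ≥0∞ :=
    fun k => {z | (k : ℝ) < ‖z‖}.indicator G with htail
  have hset : ∀ k : ℕ, MeasurableSet {z : (Fin d → ℝ) × (Fin d → ℝ) | (k : ℝ) < ‖z‖} :=
    fun k => measurableSet_lt measurable_const measurable_norm
  have htm : ∀ k, AEMeasurable (tail k) volume := fun k => hGm.indicator (hset k)
  have htail_le : ∀ k z, tail k z ≤ G z := fun k z => Set.indicator_le_self _ _ _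
  have hlim : Tendsto (fun k => mixNorm volume volume p q (tail k)) atTop (𝓝 0) := by
    refine tendsto_mixNorm_of_antitone hp hp' hq hq' htm (fun z k l hkl => ?_) ?_ fun z => ?_
    · refine Set.indicator_le_indicator_of_subset (fun z hz => ?_) (fun _ => zero_le) z
      rw [Set.mem_ofPred_eq] at hz ⊢
      exact lt_of_le_of_lt (by exact_mod_cast hkl) hz
    · exact ne_top_of_le_ne_top hfin (mixNorm_mono (htail_le 0))
    · refine tendsto_const_nhds.congr' ?_
      obtain ⟨n, hn⟩ := exists_nat_ge ‖z‖
      filter_upwards [eventually_ge_atTop n] with k hk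
      refine (Set.indicator_of_notMem (fun hz => ?_) _).symm
      rw [Set.mem_ofPred_eq] at hz
      have h2 : (n : ℝ) ≤ k := by exact_mod_cast hk
      linarith
  set L := ENNReal.LpAddConst p * ENNReal.LpAddConst q with hL
  have hLtop : L ≠ ∞ := ENNReal.mul_ne_top (ENNReal.LpAddConst_lt_top p).ne
    (ENNReal.LpAddConst_lt_top q).ne
  set E := mixNorm volume volume p q (fun z : (Fin d → ℝ) × (Fin d → ℝ) =>
      ENNReal.ofReal (Real.exp (-∑ j, (|z.1 j| + |z.2 j|)))) with hE
  have hEtop : E ≠ ∞ := (mixNorm_exp_neg_lt_top p q).ne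
  -- The cost of a dilation by r in a mixed norm, at its worst for r = 1/2.
  set D := ENNReal.ofReal (1 / 2) ^ (-(d * q⁻¹.toReal)) *
    ENNReal.ofReal (1 / 2) ^ (-(d * p⁻¹.toReal)) with hD
  have hDtop : D ≠ ∞ := by
    refine ENNReal.mul_ne_top ?_ ?_ <;>
      exact ENNReal.rpow_ne_top_of_ne_zero (by simp) ENNReal.ofReal_ne_top
  have hdil : ∀ n k, mixNorm volume volume p q (fun z => tail k (r n • z)) ≤
      D * mixNorm volume volume p q (tail k) := by
    intro n k
    have hmono : ∀ x : ℝ, 0 ≤ x →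
        ENNReal.ofReal |r n| ^ (-(d * x)) ≤ ENNReal.ofReal (1 / 2) ^ (-(d * x)) := by
      intro x hx
      rw [ENNReal.rpow_neg, ENNReal.rpow_neg, ENNReal.inv_le_inv]
      refine ENNReal.rpow_le_rpow (ENNReal.ofReal_le_ofReal ?_) (by positivity)
      exact (hr0 n).trans (le_abs_self _)
    rw [mixNorm_comp_smul (hrpos n).ne' p q (htm k), hD, mul_assoc]
    gcongr ?_ * (?_ * _)
    · exact hmono _ ENNReal.toReal_nonneg
    · exact hmono _ ENNReal.toReal_nonneg
  have hbound : ∀ k : ℕ, ∃ ε : ℕ → ℝ, Tendsto ε atTop (𝓝 0) ∧ ∀ n,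
      phaseNorm S ω p q (mehler (r n) f - f) ≤
        L * (ENNReal.ofReal (ε n) * E + L * (C * D + 1) * mixNorm volume volume p q (tail k)) := by
    intro k
    obtain ⟨ε, hε, hε0, hεb⟩ :=
      exists_tendsto_weightedStft_mehler_sub hω hm hf hrpos hr1 hr (2 * k)
    -- For ‖z‖ ≤ 2k the sum of all |x_j| + |ξ_j| is at most 4kd. The extra factor thus allows the
    -- indicator of the ball to be replaced by an exponential of finite mixed norm.
    refine ⟨fun n => ε n * Real.exp (d * (4 * k)), ?_, fun n => ?_⟩
    · simpa using hε.mul_const (Real.exp (d * (4 * k)))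
    have hpt : ∀ z, weightedStft ω (mehler (r n) f - f) (S z) ≤
        ENNReal.ofReal (ε n * Real.exp (d * (4 * k))) *
          ENNReal.ofReal (Real.exp (-∑ j, (|z.1 j| + |z.2 j|))) +
        (C * tail k (r n • z) + tail k z) := by
      intro z
      have hnS : ‖S z‖ = ‖z‖ := by
        rcases hS with rfl | rfl
        · rfl
        · simp [Prod.norm_def, max_comm]
      by_cases hz : ‖z‖ ≤ 2 * k
      · refine le_add_right ((hεb n (S z) (hnS ▸ hz)).trans ?_)
        rw [← ENNReal.ofReal_mul (mul_nonneg (hε0 n) (Real.exp_pos _).le), mul_assoc,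
          ← Real.exp_add]
        refine ENNReal.ofReal_le_ofReal (le_mul_of_one_le_right (hε0 n) (Real.one_le_exp ?_))
        have h1 : ∑ j, (|z.1 j| + |z.2 j|) ≤ ∑ _j : Fin d, (4 * k : ℝ) := by
          refine Finset.sum_le_sum fun j _ => ?_
          have h2 : |z.1 j| ≤ ‖z‖ := (norm_le_pi_norm z.1 j).trans (norm_fst_le z)
          have h3 : |z.2 j| ≤ ‖z‖ := (norm_le_pi_norm z.2 j).trans (norm_snd_le z)
          linarith
        simp only [Finset.sum_const, Finset.card_univ, Fintype.card_fin, nsmul_eq_mul] at h1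
        linarith
      · push Not at hz
        refine le_add_left ?_
        have hk0 : (0 : ℝ) ≤ k := Nat.cast_nonneg k
        have h1 : tail k z = G z := Set.indicator_of_mem (by rw [Set.mem_ofPred_eq]; linarith) _
        have h2 : tail k (r n • z) = G (r n • z) := by
          refine Set.indicator_of_mem ?_ _
          rw [Set.mem_ofPred_eq, norm_smul, Real.norm_of_nonneg (hrpos n).le]
          nlinarith [hr0 n]
        rw [h1, h2, sub_eq_add_neg]
        refine (weightedStft_add_le (sigmaOne_subset_sigmaOneDual
          (mehler_mem_sigmaOne (hrpos n) (hr1 n) hf)) (sigmaOneDual_neg hf) _).trans ?_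
        rw [weightedStft_neg]
        gcongr
        simp only [hG, hS.apply_smul]
        exact hC _ (hrpos n).le (hr1 n).le _
    have htr : AEMeasurable (fun z => tail k (r n • z)) volume :=
      (htm k).comp_quasiMeasurePreserving
        (Measure.quasiMeasurePreserving_smul volume (hrpos n).ne')
    have hexpm : Measurable (fun z : (Fin d → ℝ) × (Fin d → ℝ) =>
        ENNReal.ofReal (Real.exp (-∑ j, (|z.1 j| + |z.2 j|)))) := by fun_prop
    calc phaseNorm S ω p q (mehler (r n) f - f)
        ≤ L * (mixNorm volume volume p q (fun z : (Fin d → ℝ) × (Fin d → ℝ) =>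
            ENNReal.ofReal (ε n * Real.exp (d * (4 * k))) *
              ENNReal.ofReal (Real.exp (-∑ j, (|z.1 j| + |z.2 j|)))) +
            mixNorm volume volume p q (fun z => C * tail k (r n • z) + tail k z)) :=
          (mixNorm_mono hpt).trans (mixNorm_add_le (hexpm.const_mul _).aemeasurable
            ((htr.const_mul _).add (htm k)))
      _ ≤ L * (ENNReal.ofReal (ε n * Real.exp (d * (4 * k))) * E +
            L * (C * (D * mixNorm volume volume p q (tail k)) +
              mixNorm volume volume p q (tail k))) := by
          rw [mixNorm_const_mul ENNReal.ofReal_ne_top]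
          gcongr
          refine (mixNorm_add_le (htr.const_mul _) (htm k)).trans ?_
          rw [mixNorm_const_mul ENNReal.coe_ne_top]
          gcongr
          exact hdil n k
      _ = _ := by ring
  rw [ENNReal.tendsto_nhds_zero]
  intro δ hδ
  have hL2 : L * (L * (C * D + 1)) ≠ ∞ := by finiteness
  have h1 : Tendsto (fun k => L * (L * (C * D + 1)) * mixNorm volume volume p q (tail k)) atTop
      (𝓝 0) := by
    simpa using ENNReal.Tendsto.const_mul hlim (Or.inr hL2)
  -- The radius k is fixed by the tail before n is sent to infinity in the uniform part.
  obtain ⟨k, hk⟩ := ((ENNReal.tendsto_nhds_zero.1 h1) (δ / 2) (by simpa using hδ.ne')).exists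
  obtain ⟨ε, hε, hεb⟩ := hbound k
  have h2 : Tendsto (fun n => L * (ENNReal.ofReal (ε n) * E)) atTop (𝓝 0) := by
    have h3 : Tendsto (fun n => ENNReal.ofReal (ε n)) atTop (𝓝 0) := by
      simpa using ENNReal.tendsto_ofReal hε
    simpa using ENNReal.Tendsto.const_mul (ENNReal.Tendsto.mul_const h3 (Or.inr hEtop))
      (Or.inr hLtop)
  filter_upwards [(ENNReal.tendsto_nhds_zero.1 h2) (δ / 2) (by simpa using hδ.ne')] with n hn
  calc _ ≤ L * (ENNReal.ofReal (ε n) * E) +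
        L * (L * (C * D + 1)) * mixNorm volume volume p q (tail k) := by
        refine (hεb n).trans_eq ?_
        ring
    _ ≤ δ / 2 + δ / 2 := add_le_add hn hk
    _ = δ := ENNReal.add_halves δ

end Density

/-! ### Quasi-norms in the time variable -/

section TimeNorm

/-- The zeros of sin 4t are the multiples of π/4, and they are simple: |sin u| ≥ (2/π)|u| for |u| ≤
π/2, applied to u = 4t - kπ, with 2/π ≥ 1/2. The bound by 1 limits the integers k that are relevant
on [0, T]. -/
theorem exists_int_abs_sub_le (t : ℝ) :
    ∃ k : ℤ, |t - k * (Real.pi / 4)| ≤ |Real.sin (4 * t)| / 2 ∧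
      |t - k * (Real.pi / 4)| ≤ 1 := by
  have hpi := Real.pi_gt_three
  have hpi4 := Real.pi_le_four
  refine ⟨round (4 * t / Real.pi), ?_⟩
  set k := round (4 * t / Real.pi) with hk
  have h1 : |4 * t - k * Real.pi| ≤ Real.pi / 2 := by
    have h2 := abs_sub_round (4 * t / Real.pi)
    have h3 : 4 * t - k * Real.pi = (4 * t / Real.pi - k) * Real.pi := by field_simp
    rw [h3, abs_mul, abs_of_pos Real.pi_pos]
    nlinarith
  have h4 := Real.mul_abs_le_abs_sin h1
  have h5 : |Real.sin (4 * t - k * Real.pi)| = |Real.sin (4 * t)| := by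
    rw [Real.sin_sub_int_mul_pi, abs_mul, abs_zpow, abs_neg, abs_one, one_zpow, one_mul]
  have h6 : |4 * t - k * Real.pi| = 4 * |t - k * (Real.pi / 4)| := by
    rw [show 4 * t - k * Real.pi = 4 * (t - k * (Real.pi / 4)) by ring, abs_mul]
    norm_num
  rw [h5, h6] at h4
  rw [h6] at h1
  have h7 : (1 : ℝ) / 2 ≤ 2 / Real.pi := by
    rw [div_le_div_iff₀ two_pos Real.pi_pos]
    linarith
  have h8 := abs_nonneg (t - k * (Real.pi / 4))
  constructor <;> nlinarith

instance isFiniteMeasure_timeMeasure (T : ℝ) : IsFiniteMeasure (timeMeasure T) := by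
  unfold timeMeasure
  infer_instance

theorem exists_timeMeasure_sin_lt_le (T : ℝ) : ∃ C : ℝ≥0, ∀ ε : ℝ, 0 < ε →
    timeMeasure T {t | |Real.sin (4 * t)| / 2 < ε} ≤ C * ENNReal.ofReal ε := by
  obtain ⟨N, hN⟩ := exists_nat_ge (|T| + 1)
  -- Only the 4N + 1 integers in [-2N, 2N] matter, since π/4 > 1/2, and each contributes an interval
  -- of length 2ε.
  refine ⟨(4 * N + 1) * 2, fun ε hε => ?_⟩
  have hsub : {t | |Real.sin (4 * t)| / 2 < ε} ∩ Set.Icc 0 T ⊆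
      ⋃ k ∈ Finset.Icc (-(2 * N : ℤ)) (2 * N), Metric.ball ((k : ℝ) * (Real.pi / 4)) ε := by
    rintro t ⟨ht, ht0, htT⟩
    obtain ⟨k, hk, hk1⟩ := exists_int_abs_sub_le t
    rw [Set.mem_ofPred_eq] at ht
    have h1 := abs_le.1 hk1
    have hpi := Real.pi_gt_three
    have h2 := le_abs_self T
    refine Set.mem_iUnion₂.2 ⟨k, Finset.mem_Icc.2 ⟨?_, ?_⟩, ?_⟩
    · have h3 : (-(2 * N : ℤ) : ℝ) ≤ k := by
        push_cast
        by_contra h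
        push Not at h
        nlinarith
      exact_mod_cast h3
    · have h3 : (k : ℝ) ≤ ((2 * N : ℤ) : ℝ) := by
        push_cast
        by_contra h
        push Not at h
        nlinarith
      exact_mod_cast h3
    · rw [Metric.mem_ball, Real.dist_eq]
      linarith
  rw [timeMeasure, Measure.restrict_apply' measurableSet_Icc]
  refine (measure_mono hsub).trans ((measure_biUnion_finset_le _ _).trans ?_)
  simp only [Real.volume_ball, Finset.sum_const, Int.card_Icc, nsmul_eq_mul]
  rw [show (2 * (N : ℤ) + 1 - -(2 * N)).toNat = 4 * N + 1 by omega,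
    ENNReal.ofReal_mul zero_le_two, ← mul_assoc]
  gcongr
  push_cast
  rw [ENNReal.ofReal_ofNat]

theorem ae_sin_ne_zero (T : ℝ) : ∀ᵐ t ∂timeMeasure T, Real.sin (4 * t) ≠ 0 := by
  obtain ⟨C, hC⟩ := exists_timeMeasure_sin_lt_le T
  rw [ae_iff]
  simp only [ne_eq, not_not]
  have h1 : Tendsto (fun n : ℕ => (C : ℝ≥0∞) * ENNReal.ofReal (1 / ((n : ℝ) + 1))) atTop (𝓝 0) := by
    have h2 := ENNReal.tendsto_ofReal (tendsto_one_div_add_atTop_nhds_zero_nat (𝕜 := ℝ))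
    simpa using ENNReal.Tendsto.const_mul h2 (Or.inr (ENNReal.coe_ne_top (r := C)))
  refine le_antisymm (ge_of_tendsto' h1 fun n => ?_) (zero_le)
  refine (measure_mono fun t ht => ?_).trans (hC _ (by positivity))
  rw [Set.mem_ofPred_eq] at ht ⊢
  rw [ht]
  simp only [abs_zero, zero_div]
  positivity

/-- The kernel exceeds s only where |sin 4t|/2 < s^(-1/a); this is membership in weak L^{1/a}. -/
theorem exists_timeMeasure_kernel_le (T : ℝ) : ∃ C : ℝ≥0, ∀ a : ℝ, 0 < a → ∀ s : ℝ, 0 < s →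
    timeMeasure T {t | ENNReal.ofReal s < dispersionKernel a t} ≤
      C * ENNReal.ofReal (s ^ (-(1 / a))) := by
  obtain ⟨C, hC⟩ := exists_timeMeasure_sin_lt_le T
  refine ⟨C, fun a ha s hs => (measure_mono fun t ht => ?_).trans (hC _ (by positivity))⟩
  rw [Set.mem_ofPred_eq] at ht ⊢
  by_contra h
  push Not at h
  refine ht.not_ge ?_
  have hspos : 0 < s ^ (-(1 / a)) := by positivity
  rw [dispersionKernel, ENNReal.ofReal_rpow_of_pos (hspos.trans_le h)]
  refine ENNReal.ofReal_le_ofReal ?_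
  calc (|Real.sin (4 * t)| / 2) ^ (-a) ≤ (s ^ (-(1 / a))) ^ (-a) :=
        Real.rpow_le_rpow_of_nonpos hspos h (by linarith)
    _ = s := by
        rw [← Real.rpow_mul hs.le, neg_mul_neg, one_div_mul_cancel ha.ne', Real.rpow_one]

theorem measurable_dispersionKernel (a : ℝ) : Measurable (dispersionKernel a) := by
  unfold dispersionKernel
  fun_prop

/-- Layer cake formula: levels up to 1 cost at most the total measure, and s^(-1/b) is integrable at
infinity because 1/b > 1. -/
theorem lintegral_dispersionKernel_lt_top (T : ℝ) {b : ℝ} (hb : 0 ≤ b) (hb1 : b < 1) :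
    ∫⁻ t, dispersionKernel b t ∂timeMeasure T < ∞ := by
  rcases hb.eq_or_lt with rfl | hb
  · simp [dispersionKernel]
  obtain ⟨C, hC⟩ := exists_timeMeasure_kernel_le T
  set f : ℝ → ℝ := fun t => (dispersionKernel b t).toReal with hf
  have hfm : Measurable f := (measurable_dispersionKernel b).ennreal_toReal
  have hfk : ∀ᵐ t ∂timeMeasure T, dispersionKernel b t = ENNReal.ofReal (f t) := by
    filter_upwards [ae_sin_ne_zero T] with t ht
    rw [hf, ENNReal.ofReal_toReal]
    refine ENNReal.rpow_ne_top_of_ne_zero ?_ ENNReal.ofReal_ne_top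
    have := abs_pos.2 ht
    simp only [ne_eq, ENNReal.ofReal_eq_zero, not_le]
    positivity
  rw [lintegral_congr_ae hfk, lintegral_eq_lintegral_meas_lt _
    (.of_forall fun t => ENNReal.toReal_nonneg) hfm.aemeasurable,
    ← Set.Ioc_union_Ioi_eq_Ioi zero_le_one]
  refine (lintegral_union_le _ _ _).trans_lt (ENNReal.add_lt_top.2 ⟨?_, ?_⟩)
  · refine (lintegral_mono fun s => measure_mono (Set.subset_univ _)).trans_lt ?_
    rw [setLIntegral_const]
    exact ENNReal.mul_lt_top (measure_lt_top _ _) (by simp)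
  · have hint : IntegrableOn (fun s : ℝ => s ^ (-(1 / b))) (Set.Ioi 1) :=
      integrableOn_Ioi_rpow_of_lt (by rw [neg_lt_neg_iff, lt_div_iff₀ hb]; linarith) one_pos
    refine lt_of_le_of_lt (setLIntegral_mono' measurableSet_Ioi (g := fun s : ℝ =>
      (C : ℝ≥0∞) * ENNReal.ofReal (s ^ (-(1 / b)))) fun s hs => ?_) ?_
    · refine le_trans (measure_mono fun t ht => ?_) (hC b hb s (one_pos.trans hs))
      rw [Set.mem_ofPred_eq] at ht ⊢
      have hne : dispersionKernel b t ≠ ∞ := by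
        intro h
        simp only [h, ENNReal.toReal_top] at ht
        exact ht.not_gt (one_pos.trans hs)
      exact (ENNReal.ofReal_lt_iff_lt_toReal (one_pos.trans hs).le hne).2 ht
    · rw [lintegral_const_mul' _ _ ENNReal.coe_ne_top]
      exact ENNReal.mul_lt_top ENNReal.coe_lt_top hint.lintegral_lt_top

/-- The properties of a quasi-norm in the time variable which are used for the Strichartz
estimates: it is monotone and homogeneous, it is finite on the dispersion kernel, and convergence
to zero implies convergence to zero in measure. -/
structure IsDispersiveTimeNorm (T a : ℝ) (L : (ℝ → ℝ≥0∞) → ℝ≥0∞) : Prop where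
  mono : ∀ f g : ℝ → ℝ≥0∞, f ≤ᵐ[timeMeasure T] g → L f ≤ L g
  const_mul_le : ∀ (C : ℝ≥0) (f : ℝ → ℝ≥0∞), L (fun t => C * f t) ≤ C * L f
  kernel_lt_top : L (dispersionKernel a) < ∞
  measure_le : ∀ s η : ℝ≥0, 0 < s → 0 < η → ∃ ε : ℝ≥0∞, 0 < ε ∧ ∀ f : ℝ → ℝ≥0∞,
    AEMeasurable f (timeMeasure T) → L f < ε → timeMeasure T {t | (s : ℝ≥0∞) < f t} ≤ η

theorem isDispersiveTimeNorm_weak (T : ℝ) {a : ℝ} {r : ℝ≥0∞} (hr : r ≠ 0)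
    (ha : r⁻¹.toReal = a) : IsDispersiveTimeNorm T a (weakTimeNorm T r) := by
  rcases eq_or_ne r ∞ with rfl | hr'
  · have hL : weakTimeNorm T ∞ = fun f => essSup f (timeMeasure T) := by
      ext f
      simp [weakTimeNorm]
    -- For r = ∞ the kernel has exponent 0 and is the constant 1.
    have ha0 : a = 0 := by simpa using ha.symm
    subst ha0
    rw [hL]
    refine ⟨fun f g h => essSup_mono_ae h, fun C f => ENNReal.essSup_const_mul.le, ?_, ?_⟩
    · refine (essSup_le_of_ae_le 1 (.of_forall fun t => ?_)).trans_lt ENNReal.one_lt_top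
      simp [dispersionKernel]
    · refine fun s η hs hη => ⟨s, by exact_mod_cast hs, fun f _ hf => ?_⟩
      have h1 := ae_lt_of_essSup_lt hf
      rw [ae_iff] at h1
      have h2 : timeMeasure T {t | (s : ℝ≥0∞) < f t} = 0 := by
        refine measure_mono_null (fun t ht => ?_) h1
        rw [Set.mem_ofPred_eq] at ht ⊢
        exact ht.le.not_gt
      exact h2.trans_le (zero_le)
  · have hrpos := ENNReal.toReal_pos hr hr'
    have ha' : 1 / r.toReal = a := by rw [← ha, ENNReal.toReal_inv, one_div]
    have hapos : 0 < a := by rw [← ha']; positivity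
    have hL : weakTimeNorm T r = fun f => ⨆ s : ℝ≥0, (s : ℝ≥0∞) *
        timeMeasure T {t | (s : ℝ≥0∞) < f t} ^ a := by
      ext f
      simp [weakTimeNorm, hr', ← ha']
    rw [hL]
    refine ⟨fun f g h => ?_, fun C f => ?_, ?_, ?_⟩
    · refine iSup_mono fun s => ?_
      have h1 : timeMeasure T {t | (s : ℝ≥0∞) < f t} ≤ timeMeasure T {t | (s : ℝ≥0∞) < g t} := by
        refine measure_mono_ae ?_
        filter_upwards [h] with t ht hs
        exact lt_of_lt_of_le hs ht
      gcongr
    · refine iSup_le fun s => ?_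
      rcases eq_or_ne C 0 with rfl | hC
      · simp [hapos]
      · have h1 : {t | (s : ℝ≥0∞) < C * f t} = {t | ((s / C : ℝ≥0) : ℝ≥0∞) < f t} := by
          ext t
          rw [Set.mem_ofPred_eq, Set.mem_ofPred_eq, ENNReal.coe_div hC,
            ENNReal.div_lt_iff (by simp [hC]) (by simp), mul_comm]
        have h2 : (s : ℝ≥0∞) = C * ((s / C : ℝ≥0) : ℝ≥0∞) := by
          rw [← ENNReal.coe_mul, mul_div_cancel₀ _ hC]
        rw [h1]
        nth_rewrite 1 [h2]
        rw [mul_assoc]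
        gcongr
        exact le_iSup (fun s : ℝ≥0 => (s : ℝ≥0∞) *
          timeMeasure T {t | (s : ℝ≥0∞) < f t} ^ a) (s / C)
    · obtain ⟨C, hC⟩ := exists_timeMeasure_kernel_le T
      refine lt_of_le_of_lt (iSup_le fun s => ?_) (b := (C : ℝ≥0∞) ^ a) (by finiteness)
      rcases eq_or_ne s 0 with rfl | hs
      · simp
      have hs' : (0 : ℝ) < s := by positivity
      have h1 := ENNReal.rpow_le_rpow (hC a hapos s hs') hapos.le
      rw [ENNReal.ofReal_coe_nnreal, ENNReal.mul_rpow_of_nonneg _ _ hapos.le,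
        ENNReal.ofReal_rpow_of_pos (by positivity), ← Real.rpow_mul hs'.le, neg_mul,
        one_div_mul_cancel hapos.ne', Real.rpow_neg_one, ENNReal.ofReal_inv_of_pos hs',
        ENNReal.ofReal_coe_nnreal] at h1
      calc _ ≤ (s : ℝ≥0∞) * ((C : ℝ≥0∞) ^ a * (s : ℝ≥0∞)⁻¹) := by gcongr
        _ = (C : ℝ≥0∞) ^ a := by
          rw [mul_left_comm, ENNReal.mul_inv_cancel (by simpa using hs) (by simp), mul_one]
    -- Chosen so that the term of the supremum at level s alone gives the measure bound η.
    · refine fun s η hs hη => ⟨s * (η : ℝ≥0∞) ^ a, ?_, fun f _ hf => ?_⟩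
      · have : (η : ℝ≥0∞) ≠ 0 := by exact_mod_cast hη.ne'
        refine ENNReal.mul_pos (by exact_mod_cast hs.ne') ?_
        simp [ENNReal.rpow_eq_zero_iff, this]
      · have h1 := (le_iSup (fun s : ℝ≥0 => (s : ℝ≥0∞) *
          timeMeasure T {t | (s : ℝ≥0∞) < f t} ^ a) s).trans_lt hf
        have h2 := (ENNReal.mul_lt_mul_iff_right (by exact_mod_cast hs.ne') (by simp)).1 h1
        exact ((ENNReal.rpow_lt_rpow_iff hapos).1 h2).le

/-- The r-th power of the kernel of exponent a is the kernel of exponent ar < 1, hence integrable;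
control in measure is Chebyshev's inequality. -/
theorem isDispersiveTimeNorm_strong (T : ℝ) {a : ℝ} (ha : 0 ≤ a) {r : ℝ≥0∞} (hr : r ≠ 0)
    (har : a < r⁻¹.toReal) : IsDispersiveTimeNorm T a (strongTimeNorm T r) := by
  have hr' : r ≠ ∞ := by
    rintro rfl
    simp at har
    linarith
  have hrpos := ENNReal.toReal_pos hr hr'
  refine ⟨fun f g h => eLpNorm_mono_ennreal h,
    fun C f => (eLpNorm_const_mul_ennreal r ENNReal.coe_ne_top f).le, ?_, ?_⟩
  · rw [strongTimeNorm, eLpNorm_eq_lintegral_ennreal hr hr']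
    refine ENNReal.rpow_lt_top_of_nonneg (by positivity) (ne_of_lt ?_)
    have h1 : ∀ t, dispersionKernel a t ^ r.toReal = dispersionKernel (a * r.toReal) t := by
      intro t
      rw [dispersionKernel, dispersionKernel, ← ENNReal.rpow_mul, neg_mul]
    simp_rw [h1]
    refine lintegral_dispersionKernel_lt_top T (by positivity) ?_
    rwa [ENNReal.toReal_inv, ← one_div, lt_div_iff₀ hrpos] at har
  · refine fun s η hs hη => ⟨((s : ℝ≥0∞) ^ r.toReal * η) ^ (1 / r.toReal), ?_, fun f hfm hf => ?_⟩
    · refine ENNReal.rpow_pos (ENNReal.mul_pos ?_ (by exact_mod_cast hη.ne')) (by finiteness)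
      exact (ENNReal.rpow_pos (by exact_mod_cast hs) (by simp)).ne'
    · have h1 := mul_meas_ge_le_pow_eLpNorm' (timeMeasure T) hr hr' hfm.aestronglyMeasurable
        (s : ℝ≥0∞)
      have h2 : eLpNorm f r (timeMeasure T) ^ r.toReal ≤ (s : ℝ≥0∞) ^ r.toReal * η := by
        have h3 := ENNReal.rpow_le_rpow hf.le hrpos.le
        rwa [← ENNReal.rpow_mul, one_div_mul_cancel hrpos.ne', ENNReal.rpow_one] at h3
      have h4 := h1.trans h2
      rw [ENNReal.mul_le_mul_iff_right
        (ENNReal.rpow_pos (by exact_mod_cast hs) (by simp)).ne' (by finiteness)] at h4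
      refine (measure_mono fun t ht => ?_).trans h4
      rw [Set.mem_ofPred_eq] at ht ⊢
      simpa using ht.le

end TimeNorm

/-! ### The propagator on the sum space -/

section Propagator

variable {d : ℕ} {c : ℂ} {T : ℝ} {ω : (Fin d → ℝ) × (Fin d → ℝ) → ℝ} {p q : ℝ≥0∞}
  {S : (Fin d → ℝ) × (Fin d → ℝ) → (Fin d → ℝ) × (Fin d → ℝ)} {f g : HermiteSeries d}

theorem exists_coe_eq_of_ne_top {x : ℝ≥0∞} (hx : x ≠ ∞) : ∃ y : ℝ≥0, (y : ℝ≥0∞) = x :=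
  ⟨_, ENNReal.coe_toNNReal hx⟩

theorem oscPropagator_add (c : ℂ) (f g : HermiteSeries d) (t : ℝ) :
    oscPropagator c (f + g) t = oscPropagator c f t + oscPropagator c g t :=
  funext fun _ => mul_add _ _ _

theorem oscPropagator_sub (c : ℂ) (f g : HermiteSeries d) (t : ℝ) :
    oscPropagator c (f - g) t = oscPropagator c f t - oscPropagator c g t :=
  funext fun _ => mul_sub _ _ _

theorem norm_oscPropagator (c : ℂ) (f : HermiteSeries d) (t : ℝ) (α : Fin d → ℕ) :
    ‖oscPropagator c f t α‖ = Real.exp (t * c.im) * ‖f α‖ := by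
  rw [oscPropagator, norm_mul, Complex.norm_exp]
  congr 2
  simp

theorem oscPropagator_mem_sigmaOneDual (hf : f ∈ sigmaOneDual d) (t : ℝ) :
    oscPropagator c f t ∈ sigmaOneDual d := by
  obtain ⟨r, hr, C, hC⟩ := hf
  refine ⟨r, hr, Real.exp (t * c.im) * C, fun α => ?_⟩
  rw [norm_oscPropagator, mul_assoc]
  gcongr
  exact hC α

theorem mem_modSpace_iff :
    f ∈ modSpace ω p q ↔ f ∈ sigmaOneDual d ∧ phaseNorm id ω p q f < ∞ := by
  rw [modSpace, finiteNormSpace, Set.mem_ofPred_eq, modNorm_eq_phaseNorm]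

theorem mem_wienerSpace_iff :
    f ∈ wienerSpace ω q p ↔ f ∈ sigmaOneDual d ∧ phaseNorm Prod.swap ω p q f < ∞ := by
  rw [wienerSpace, finiteNormSpace, Set.mem_ofPred_eq, wienerNorm_eq_phaseNorm]

theorem mem_sumSpace_iff : f ∈ sumSpace ω p q ↔
    ∃ f₁ ∈ modSpace ω p q, ∃ f₂ ∈ wienerSpace ω q p, f = f₁ + f₂ := by
  rw [sumSpace, Set.mem_ofPred_eq]

theorem sumNorm_add_le {f₁ f₂ : HermiteSeries d} (h₁ : f₁ ∈ modSpace ω p q)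
    (h₂ : f₂ ∈ wienerSpace ω q p) :
    sumNorm ω p q (f₁ + f₂) ≤ phaseNorm id ω p q f₁ + phaseNorm Prod.swap ω p q f₂ := by
  rw [sumNorm, modNorm_eq_phaseNorm, wienerNorm_eq_phaseNorm]
  exact iInf₂_le_of_le f₁ h₁ (iInf₂_le_of_le f₂ h₂ (iInf_le_of_le rfl le_rfl))

theorem sigmaOneDual_of_mem_sumSpace (hf : f ∈ sumSpace ω p q) : f ∈ sigmaOneDual d := by
  obtain ⟨f₁, h₁, f₂, h₂, rfl⟩ := mem_sumSpace_iff.1 hf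
  exact sigmaOneDual_add (mem_modSpace_iff.1 h₁).1 (mem_wienerSpace_iff.1 h₂).1

theorem sumNorm_lt_top (hf : f ∈ sumSpace ω p q) : sumNorm ω p q f < ∞ := by
  obtain ⟨f₁, h₁, f₂, h₂, rfl⟩ := mem_sumSpace_iff.1 hf
  exact (sumNorm_add_le h₁ h₂).trans_lt
    (ENNReal.add_lt_top.2 ⟨(mem_modSpace_iff.1 h₁).2, (mem_wienerSpace_iff.1 h₂).2⟩)

theorem sumSpace_sub (hω : IsWeight ω) (hf : f ∈ sumSpace ω p q) (hg : g ∈ sumSpace ω p q) :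
    f - g ∈ sumSpace ω p q := by
  obtain ⟨f₁, h₁, f₂, h₂, rfl⟩ := mem_sumSpace_iff.1 hf
  obtain ⟨g₁, k₁, g₂, k₂, rfl⟩ := mem_sumSpace_iff.1 hg
  rw [mem_modSpace_iff] at h₁ k₁
  rw [mem_wienerSpace_iff] at h₂ k₂
  have key : ∀ {S : (Fin d → ℝ) × (Fin d → ℝ) → (Fin d → ℝ) × (Fin d → ℝ)}, IsPhasePerm S →
      ∀ {f g : HermiteSeries d}, f ∈ sigmaOneDual d ∧ phaseNorm S ω p q f < ∞ →
      g ∈ sigmaOneDual d ∧ phaseNorm S ω p q g < ∞ →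
      f - g ∈ sigmaOneDual d ∧ phaseNorm S ω p q (f - g) < ∞ := fun hS f g hf hg => by
    refine ⟨sigmaOneDual_sub hf.1 hg.1, ?_⟩
    rw [sub_eq_add_neg]
    refine (phaseNorm_add_le hS hω hf.1 (sigmaOneDual_neg hg.1)).trans_lt ?_
    rw [phaseNorm_neg]
    exact ENNReal.mul_lt_top (ENNReal.mul_lt_top (ENNReal.LpAddConst_lt_top _)
      (ENNReal.LpAddConst_lt_top _)) (ENNReal.add_lt_top.2 ⟨hf.2, hg.2⟩)
  exact mem_sumSpace_iff.2 ⟨_, mem_modSpace_iff.2 (key isPhasePerm_id h₁ k₁), _,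
    mem_wienerSpace_iff.2 (key isPhasePerm_swap h₂ k₂), add_sub_add_comm _ _ _ _⟩

theorem sigmaOne_subset_sumSpace (hω : IsWeight ω) (hm : IsModerate ω) :
    sigmaOne d ⊆ sumSpace ω p q := by
  intro f hf
  have h0 : (0 : HermiteSeries d) ∈ sigmaOne d := fun r _ => ⟨0, fun α => by simp⟩
  exact mem_sumSpace_iff.2 ⟨f, mem_modSpace_iff.2 ⟨sigmaOne_subset_sigmaOneDual hf,
    phaseNorm_lt_top_of_mem_sigmaOne isPhasePerm_id hω hm hf⟩, 0,
    mem_wienerSpace_iff.2 ⟨sigmaOne_subset_sigmaOneDual h0,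
    phaseNorm_lt_top_of_mem_sigmaOne isPhasePerm_swap hω hm h0⟩, (add_zero f).symm⟩

theorem dispersionKernel_ne_zero {a : ℝ} (ha : 0 ≤ a) (t : ℝ) : dispersionKernel a t ≠ 0 := by
  rw [dispersionKernel, ENNReal.rpow_neg]
  exact ENNReal.inv_ne_zero.2 (by finiteness)

theorem dispersionKernel_ne_top (a : ℝ) {t : ℝ} (ht : Real.sin (4 * t) ≠ 0) :
    dispersionKernel a t ≠ ∞ := by
  refine ENNReal.rpow_ne_top_of_ne_zero ?_ ENNReal.ofReal_ne_top
  have := abs_pos.2 ht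
  simp only [ne_eq, ENNReal.ofReal_eq_zero, not_le]
  positivity

/-- The exceptional times are the zeros of sin 4t, whatever the decomposition f = f₁ + f₂. The
infimum over all decompositions can therefore be taken at each remaining time. -/
theorem exists_phaseNorm_oscPropagator_le (hω : IsModerateRadialWeight ω) (hq : 0 < q)
    (hqp : q ≤ p) (c : ℂ) (T : ℝ) : ∃ K : ℝ≥0, ∀ S, IsPhasePerm S → ∀ f : HermiteSeries d,
      ∀ᵐ t ∂timeMeasure T, phaseNorm S ω q p (oscPropagator c f t) ≤
        K * sumNorm ω p q f * dispersionKernel (d * (q⁻¹.toReal - p⁻¹.toReal)) t := by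
  have ha : 0 ≤ (d : ℝ) * (q⁻¹.toReal - p⁻¹.toReal) := by
    refine mul_nonneg (Nat.cast_nonneg _) (sub_nonneg.2 ?_)
    exact ENNReal.toReal_mono (ENNReal.inv_ne_top.2 hq.ne') (ENNReal.inv_le_inv.2 hqp)
  generalize hκ : (d : ℝ) * (q⁻¹.toReal - p⁻¹.toReal) = a at ha ⊢
  have hfin : ENNReal.LpAddConst q * ENNReal.LpAddConst p < ∞ :=
    ENNReal.mul_lt_top (ENNReal.LpAddConst_lt_top _) (ENNReal.LpAddConst_lt_top _)
  obtain ⟨A, hA⟩ := exists_coe_eq_of_ne_top hfin.ne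
  obtain ⟨B, hB⟩ : ∃ B : ℝ≥0, (B : ℝ≥0∞) = ENNReal.ofReal (Real.exp (T * |c.im|)) := ⟨_, rfl⟩
  -- The summand 1 makes the constant nonzero, so that it can be moved to the other side before
  -- taking the infimum.
  refine ⟨A * B + 1, fun S hS f => ?_⟩
  have hIcc : ∀ᵐ t ∂timeMeasure T, t ∈ Set.Icc 0 T := ae_restrict_mem measurableSet_Icc
  filter_upwards [ae_sin_ne_zero T, hIcc] with t ht htT
  have hκ0 := dispersionKernel_ne_zero ha t
  have hκ1 := dispersionKernel_ne_top a ht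
  have hexp : ENNReal.ofReal (Real.exp (t * c.im)) ≤ B := by
    rw [hB]
    refine ENNReal.ofReal_le_ofReal (Real.exp_le_exp.2 ?_)
    exact (mul_le_mul_of_nonneg_left (le_abs_self _) htT.1).trans
      (mul_le_mul_of_nonneg_right htT.2 (abs_nonneg _))
  rw [mul_right_comm, mul_comm, ← ENNReal.div_le_iff_le_mul (Or.inl (by simp [hκ0]))
    (Or.inl (by finiteness))]
  rw [sumNorm, modNorm_eq_phaseNorm, wienerNorm_eq_phaseNorm]
  refine le_iInf₂ fun f₁ h₁ => le_iInf₂ fun f₂ h₂ => le_iInf fun hff => ?_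
  rw [mem_modSpace_iff] at h₁
  rw [mem_wienerSpace_iff] at h₂
  rw [ENNReal.div_le_iff_le_mul (Or.inl (by simp [hκ0])) (Or.inl (by finiteness)), hff,
    oscPropagator_add]
  refine (phaseNorm_add_le hS hω.isWeight (oscPropagator_mem_sigmaOneDual h₁.1 t)
    (oscPropagator_mem_sigmaOneDual h₂.1 t)).trans ?_
  have e₁ := phaseNorm_oscPropagator_le isPhasePerm_id hS hω hq hqp c h₁.1 ht
  have e₂ := phaseNorm_oscPropagator_le isPhasePerm_swap hS hω hq hqp c h₂.1 ht
  rw [hκ] at e₁ e₂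
  rw [← hA]
  calc _ ≤ (A : ℝ≥0∞) * (B * (dispersionKernel a t * phaseNorm id ω p q f₁) +
        B * (dispersionKernel a t * phaseNorm Prod.swap ω p q f₂)) := by
        gcongr
        · exact e₁.trans (by gcongr)
        · exact e₂.trans (by gcongr)
    _ = (A * B) * dispersionKernel a t *
        (phaseNorm id ω p q f₁ + phaseNorm Prod.swap ω p q f₂) := by ring
    _ ≤ _ := by
        rw [mul_comm]
        push_cast
        gcongr
        exact le_self_add

/-! ### Weak* continuity and truncation. -/

theorem hermitePairing_oscPropagator (c : ℂ) (f g : HermiteSeries d) (t : ℝ) :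
    hermitePairing (oscPropagator c f t) g = hermitePairing f fun α =>
      conj (Complex.exp (-Complex.I * t * (2 * (multiLength α : ℂ) + d + c))) * g α := by
  refine tsum_congr fun α => ?_
  rw [oscPropagator, map_mul, Complex.conj_conj]
  ring

/-- The adjoint multiplies all coefficients by factors of the same modulus e^(t Im c), so it
preserves Σ₁. No time is exceptional. -/
theorem weakStarTendsto_oscPropagator {u : ℕ → HermiteSeries d} (h : WeakStarTendsto u f)
    (c : ℂ) (t : ℝ) : WeakStarTendsto (fun n => oscPropagator c (u n) t) (oscPropagator c f t) := by
  intro g hg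
  simp only [hermitePairing_oscPropagator]
  refine h _ fun r hr => ?_
  obtain ⟨C, hC⟩ := hg r hr
  refine ⟨Real.exp (t * c.im) * C, fun α => ?_⟩
  rw [norm_mul, RCLike.norm_conj, ← norm_mul]
  refine (norm_oscPropagator c g t α).le.trans ?_
  rw [mul_assoc]
  gcongr
  exact hC α

theorem summable_norm_mul_of_mem (hf : f ∈ sigmaOneDual d) (hg : g ∈ sigmaOne d) :
    Summable fun α => ‖f α * conj (g α)‖ := by
  obtain ⟨r, hr, C, hC⟩ := hf
  obtain ⟨D, hD⟩ := hg (r + 1) (by positivity)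
  refine Summable.of_nonneg_of_le (fun _ => norm_nonneg _) (fun α => ?_)
    ((summable_exp_neg_sqrt_multiLength (d := d) one_pos).mul_left (C * D))
  rw [norm_mul, RCLike.norm_conj]
  calc ‖f α‖ * ‖g α‖ ≤ (C * Real.exp (r * √(multiLength α : ℝ))) *
        (D * Real.exp (-(r + 1) * √(multiLength α : ℝ))) :=
        mul_le_mul (hC α) (hD α) (norm_nonneg _) ((norm_nonneg _).trans (hC α))
    _ = C * D * (Real.exp (r * √(multiLength α : ℝ)) *
        Real.exp (-(r + 1) * √(multiLength α : ℝ))) := by ring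
    _ = _ := by
        rw [← Real.exp_add]
        congr 2
        ring

theorem finite_multiLength_le (n : ℕ) : {α : Fin d → ℕ | multiLength α ≤ n}.Finite := by
  refine (Set.finite_Iic (fun _ : Fin d => n)).subset fun α hα => ?_
  rw [Set.mem_ofPred_eq] at hα
  exact fun j => (Finset.single_le_sum (f := α) (fun _ _ => Nat.zero_le _)
    (Finset.mem_univ j)).trans hα

theorem mem_sigmaOne_of_finite_support (hf : f.support.Finite) : f ∈ sigmaOne d := by
  intro r _
  have h0 : ∀ α, 0 ≤ ‖f α‖ / Real.exp (-r * √(multiLength α : ℝ)) := fun α => by positivity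
  refine ⟨∑ α ∈ hf.toFinset, ‖f α‖ / Real.exp (-r * √(multiLength α : ℝ)), fun α => ?_⟩
  by_cases hα : f α = 0
  · rw [hα, norm_zero]
    exact mul_nonneg (Finset.sum_nonneg fun β _ => h0 β) (Real.exp_pos _).le
  · rw [← div_le_iff₀ (Real.exp_pos _)]
    exact Finset.single_le_sum (f := fun α => ‖f α‖ / Real.exp (-r * √(multiLength α : ℝ)))
      (fun β _ => h0 β) (hf.mem_toFinset.2 hα)

/-- The part of a Hermite series with multi-indices of length at most `n`. -/
noncomputable def hermiteTruncation (f : HermiteSeries d) (n : ℕ) : HermiteSeries d :=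
  Set.indicator {α | multiLength α ≤ n} f

theorem hermiteTruncation_mem_sigmaOne (f : HermiteSeries d) (n : ℕ) :
    hermiteTruncation f n ∈ sigmaOne d :=
  mem_sigmaOne_of_finite_support ((finite_multiLength_le n).subset Set.support_indicator_subset)

theorem weakStarTendsto_hermiteTruncation (hf : f ∈ sigmaOneDual d) :
    WeakStarTendsto (hermiteTruncation f) f := by
  intro g hg
  refine tendsto_tsum_of_dominated_convergence (summable_norm_mul_of_mem hf hg) (fun α => ?_)
    (.of_forall fun n α => ?_)
  · refine tendsto_const_nhds.congr' ?_
    filter_upwards [eventually_ge_atTop (multiLength α)] with n hn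
    rw [hermiteTruncation, Set.indicator_of_mem (by rw [Set.mem_ofPred_eq]; exact hn)]
  · rw [norm_mul, norm_mul, hermiteTruncation]
    gcongr
    exact norm_indicator_le_norm_self _ _

/-- Testing against a single Hermite function recovers each coefficient. -/
theorem WeakStarTendsto.unique {u : ℕ → HermiteSeries d} (hf : WeakStarTendsto u f)
    (hg : WeakStarTendsto u g) : f = g := by
  classical
  ext α
  have hδ : (Pi.single α 1 : HermiteSeries d) ∈ sigmaOne d :=
    mem_sigmaOne_of_finite_support ((Set.finite_singleton α).subset (Pi.support_single_subset))
  have hpair : ∀ f : HermiteSeries d, hermitePairing f (Pi.single α 1) = f α := fun f => by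
    rw [hermitePairing, tsum_eq_single α fun β hβ => by simp [Pi.single_eq_of_ne hβ]]
    simp
  have h := tendsto_nhds_unique (hf _ hδ) (hg _ hδ)
  rwa [hpair, hpair] at h

end Propagator

/-! ### Strichartz estimates and unique extensions -/

section Strichartz

variable {d : ℕ} {T : ℝ} {ω : (Fin d → ℝ) × (Fin d → ℝ) → ℝ} {p q : ℝ≥0∞}
  {L : (ℝ → ℝ≥0∞) → ℝ≥0∞} {f : HermiteSeries d}

theorem exists_timeNorm_oscPropagator_le (hω : IsModerateRadialWeight ω) (hq : 0 < q)
    (hqp : q ≤ p) (c : ℂ)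
    (hL : IsDispersiveTimeNorm T (d * (q⁻¹.toReal - p⁻¹.toReal)) L) :
    ∃ C : ℝ≥0, ∀ S, IsPhasePerm S → ∀ f ∈ sumSpace (d := d) ω p q,
      L (fun t => phaseNorm S ω q p (oscPropagator c f t)) ≤ C * sumNorm ω p q f := by
  obtain ⟨K, hK⟩ := exists_phaseNorm_oscPropagator_le hω hq hqp c T
  obtain ⟨M, hM⟩ := exists_coe_eq_of_ne_top hL.kernel_lt_top.ne
  refine ⟨K * M, fun S hS f hf => ?_⟩
  obtain ⟨σ, hσ⟩ := exists_coe_eq_of_ne_top (sumNorm_lt_top hf).ne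
  have h := hK S hS f
  rw [← hσ] at h ⊢
  refine (hL.mono _ (fun t => ((K * σ : ℝ≥0) : ℝ≥0∞) *
    dispersionKernel (d * (q⁻¹.toReal - p⁻¹.toReal)) t) ?_).trans
      ((hL.const_mul_le _ _).trans (le_of_eq ?_))
  · filter_upwards [h] with t ht
    exact ht.trans_eq (by push_cast; rfl)
  · rw [← hM]
    push_cast
    ring

theorem isPropagatorExtension_oscPropagator (hω : IsModerateRadialWeight ω) (hq : 0 < q)
    (hqp : q ≤ p) (c : ℂ) (hL : IsDispersiveTimeNorm T (d * (q⁻¹.toReal - p⁻¹.toReal)) L) :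
    IsPropagatorExtension c T ω p q L (oscPropagator c) := by
  obtain ⟨K, hK⟩ := exists_phaseNorm_oscPropagator_le hω hq hqp c T
  obtain ⟨C, hC⟩ := exists_timeNorm_oscPropagator_le hω hq hqp c hL
  have key : ∀ S, IsPhasePerm S → ∀ f ∈ sumSpace ω p q,
      MemTimeSpace T L (phaseNorm S ω q p) (oscPropagator c f) := fun S hS f hf => by
    have hf' := sigmaOneDual_of_mem_sumSpace hf
    have hcoeff : ∀ α, AEMeasurable (fun t => oscPropagator c f t α) (timeMeasure T) :=
      fun α => Continuous.aemeasurable (by unfold oscPropagator; fun_prop)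
    refine ⟨hcoeff, aemeasurable_phaseNorm hS hω.isWeight hcoeff
      (.of_forall fun t => oscPropagator_mem_sigmaOneDual hf' t), ?_,
      (hC S hS f hf).trans_lt (ENNReal.mul_lt_top ENNReal.coe_lt_top (sumNorm_lt_top hf))⟩
    filter_upwards [hK S hS f, ae_sin_ne_zero T] with t ht hsin
    rw [finiteNormSpace, Set.mem_ofPred_eq]
    refine ⟨oscPropagator_mem_sigmaOneDual hf' t, ht.trans_lt ?_⟩
    exact ENNReal.mul_lt_top (ENNReal.mul_lt_top ENNReal.coe_lt_top (sumNorm_lt_top hf))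
      (dispersionKernel_ne_top _ hsin).lt_top
  refine ⟨fun f hf => ?_, fun f hf => ?_, fun f _ => .of_forall fun t => rfl⟩
  · rw [modNorm_eq_phaseNorm]
    exact key _ isPhasePerm_id f hf
  · rw [wienerNorm_eq_phaseNorm]
    exact key _ isPhasePerm_swap f hf

theorem exists_timeNorm_add_timeNorm_le (hω : IsModerateRadialWeight ω) (hq : 0 < q)
    (hqp : q ≤ p) (c : ℂ) (hL : IsDispersiveTimeNorm T (d * (q⁻¹.toReal - p⁻¹.toReal)) L) :
    ∃ C : ℝ≥0, ∀ f ∈ sumSpace (d := d) ω p q,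
      L (fun t => modNorm ω q p (oscPropagator c f t))
        + L (fun t => wienerNorm ω p q (oscPropagator c f t)) ≤ C * sumNorm ω p q f := by
  obtain ⟨C, hC⟩ := exists_timeNorm_oscPropagator_le hω hq hqp c hL
  refine ⟨C + C, fun f hf => ?_⟩
  rw [modNorm_eq_phaseNorm, wienerNorm_eq_phaseNorm, ENNReal.coe_add, add_mul]
  exact add_le_add (hC _ isPhasePerm_id f hf) (hC _ isPhasePerm_swap f hf)

theorem isNormContinuous_oscPropagator (hω : IsModerateRadialWeight ω) (hq : 0 < q)
    (hqp : q ≤ p) (c : ℂ) (hL : IsDispersiveTimeNorm T (d * (q⁻¹.toReal - p⁻¹.toReal)) L) :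
    IsNormContinuous ω p q L (oscPropagator (d := d) c) := by
  obtain ⟨C, hC⟩ := exists_timeNorm_add_timeNorm_le hω hq hqp c hL
  intro f hf ε hε
  -- By linearity the estimate applies to g - f; C + 1 replaces C since C may be 0.
  refine ⟨ε / (C + 1), ENNReal.div_pos hε.ne' (by finiteness), fun g hg hgf => ?_⟩
  simp only [← oscPropagator_sub]
  refine (hC _ (sumSpace_sub hω.isWeight hg hf)).trans_lt ?_
  rw [ENNReal.lt_div_iff_mul_lt (Or.inl (by simp)) (Or.inl (by finiteness)), mul_comm] at hgf
  refine lt_of_le_of_lt ?_ hgf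
  gcongr
  exact le_self_add

/-- The same Mehler dilation is applied to both summands: each is approximated in its own norm,
while the sum is the dilation of f and lies in Σ₁. -/
theorem exists_mem_sigmaOne_sumNorm_sub_lt (hω : IsWeight ω) (hm : IsModerate ω) (hp : p ≠ 0)
    (hp' : p ≠ ∞) (hq : q ≠ 0) (hq' : q ≠ ∞) (hf : f ∈ sumSpace ω p q) {δ : ℝ≥0∞} (hδ : 0 < δ) :
    ∃ g ∈ sigmaOne d, sumNorm ω p q (g - f) < δ := by
  obtain ⟨f₁, h₁, f₂, h₂, rfl⟩ := mem_sumSpace_iff.1 hf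
  have hd := sigmaOneDual_of_mem_sumSpace hf
  rw [mem_modSpace_iff] at h₁
  rw [mem_wienerSpace_iff] at h₂
  obtain ⟨r, hr0, hr1, hr⟩ : ∃ r : ℕ → ℝ, (∀ n, 1 / 2 ≤ r n) ∧ (∀ n, r n < 1) ∧
      Tendsto r atTop (𝓝 1) := by
    refine ⟨fun n => 1 - 1 / ((n : ℝ) + 1) / 2, fun n => ?_, fun n => ?_, ?_⟩
    · have : 1 / ((n : ℝ) + 1) ≤ 1 := by
        rw [div_le_one (by positivity)]
        linarith [n.cast_nonneg (α := ℝ)]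
      linarith
    · have : 0 < 1 / ((n : ℝ) + 1) := by positivity
      linarith
    · simpa using ((tendsto_one_div_add_atTop_nhds_zero_nat (𝕜 := ℝ)).div_const 2).const_sub 1
  have hδ' : 0 < min (δ / 2) 1 := lt_min (ENNReal.half_pos hδ.ne') one_pos
  have t₁ := tendsto_phaseNorm_mehler_sub isPhasePerm_id hω hm hp hp' hq hq' h₁.1 h₁.2.ne
    hr0 hr1 hr
  have t₂ := tendsto_phaseNorm_mehler_sub isPhasePerm_swap hω hm hp hp' hq hq' h₂.1 h₂.2.ne
    hr0 hr1 hr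
  obtain ⟨n, e₁, e₂⟩ := ((t₁.eventually_lt_const hδ').and (t₂.eventually_lt_const hδ')).exists
  have hr0' : 0 < r n := by linarith [hr0 n]
  refine ⟨mehler (r n) (f₁ + f₂), mehler_mem_sigmaOne hr0' (hr1 n) hd, ?_⟩
  have hmem : ∀ {f : HermiteSeries d}, f ∈ sigmaOneDual d →
      mehler (r n) f - f ∈ sigmaOneDual d := fun hf =>
    sigmaOneDual_sub (sigmaOne_subset_sigmaOneDual (mehler_mem_sigmaOne hr0' (hr1 n) hf)) hf
  rw [mehler_add, add_sub_add_comm]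
  refine (sumNorm_add_le (mem_modSpace_iff.2 ⟨hmem h₁.1, ?_⟩)
    (mem_wienerSpace_iff.2 ⟨hmem h₂.1, ?_⟩)).trans_lt ?_
  · exact e₁.trans_le (le_top)
  · exact e₂.trans_le (le_top)
  · calc _ < δ / 2 + δ / 2 := ENNReal.add_lt_add (e₁.trans_le (min_le_left _ _))
          (e₂.trans_le (min_le_left _ _))
      _ = δ := ENNReal.add_halves δ

theorem MemTimeSpace.aemeasurable_sub {N N' : HermiteSeries d → ℝ≥0∞}
    {u v : ℝ → HermiteSeries d} (hω : IsWeight ω)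
    (hu : MemTimeSpace T L N u) (hv : MemTimeSpace T L N' v) :
    AEMeasurable (fun t => phaseNorm id ω q p (u t - v t)) (timeMeasure T) := by
  refine aemeasurable_phaseNorm isPhasePerm_id hω
    (fun α => (hu.measurable_coeff α).sub (hv.measurable_coeff α)) ?_
  filter_upwards [hu.mem, hv.mem] with t h₁ h₂
  exact sigmaOneDual_sub h₁.1 h₂.1

/-- Two quasi-norm continuous maps which agree on `Σ₁` agree on `M^{p,q} + W^{q,p}`. -/
theorem ae_eq_of_isNormContinuous {𝓔 𝓕 : HermiteSeries d → ℝ → HermiteSeries d} {c : ℂ} {a : ℝ}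
    (hω : IsWeight ω) (hm : IsModerate ω) (hp : p ≠ 0) (hp' : p ≠ ∞) (hq : q ≠ 0) (hq' : q ≠ ∞)
    (hL : IsDispersiveTimeNorm T a L) (h𝓔 : IsPropagatorExtension c T ω p q L 𝓔)
    (h𝓕 : IsPropagatorExtension c T ω p q L 𝓕) (c𝓔 : IsNormContinuous ω p q L 𝓔)
    (c𝓕 : IsNormContinuous ω p q L 𝓕) (hf : f ∈ sumSpace ω p q) :
    ∀ᵐ t ∂timeMeasure T, 𝓔 f t = 𝓕 f t := by
  have hfin : ENNReal.LpAddConst q * ENNReal.LpAddConst p < ∞ :=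
    ENNReal.mul_lt_top (ENNReal.LpAddConst_lt_top _) (ENNReal.LpAddConst_lt_top _)
  obtain ⟨A, hA⟩ := exists_coe_eq_of_ne_top hfin.ne
  simp only [IsNormContinuous, modNorm_eq_phaseNorm] at c𝓔 c𝓕
  have hs : ∀ s : ℝ≥0, 0 < s → ∀ᵐ t ∂timeMeasure T,
      phaseNorm id ω q p (𝓔 f t - 𝓕 f t) ≤ A * (s + s) := by
    intro s hs
    rw [ae_iff]
    -- No linearity of the two maps is available, so 𝓔 f and 𝓕 f are both compared with the common
    -- value on some g in Σ₁ close to f. Each comparison fails by more than s on a set of measure at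
    -- most η.
    have hη : ∀ η : ℝ≥0, 0 < η → timeMeasure T
        {t | ¬phaseNorm id ω q p (𝓔 f t - 𝓕 f t) ≤ A * (s + s)} ≤ η + η := by
      intro η hη
      obtain ⟨ε, hε, hεL⟩ := hL.measure_le s η hs hη
      obtain ⟨δ₁, hδ₁, k₁⟩ := c𝓔 f hf ε hε
      obtain ⟨δ₂, hδ₂, k₂⟩ := c𝓕 f hf ε hε
      obtain ⟨g, hg, hgf⟩ := exists_mem_sigmaOne_sumNorm_sub_lt hω hm hp hp' hq hq' hf
        (lt_min hδ₁ hδ₂)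
      have hg' := sigmaOne_subset_sumSpace hω hm hg (p := p) (q := q)
      have l₁ := hεL _ ((h𝓔.mapsTo_mod g hg').aemeasurable_sub hω (h𝓔.mapsTo_mod f hf))
        (le_self_add.trans_lt (k₁ g hg' (hgf.trans_le (min_le_left _ _))))
      have l₂ := hεL _ ((h𝓕.mapsTo_mod g hg').aemeasurable_sub hω (h𝓕.mapsTo_mod f hf))
        (le_self_add.trans_lt (k₂ g hg' (hgf.trans_le (min_le_right _ _))))
      refine le_trans ?_ (add_le_add l₁ l₂)
      refine le_trans (measure_mono_ae (μ := timeMeasure T) ?_) (measure_union_le _ _)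
      filter_upwards [h𝓔.eq_on_sigmaOne g hg, h𝓕.eq_on_sigmaOne g hg, (h𝓔.mapsTo_mod f hf).mem,
        (h𝓕.mapsTo_mod f hf).mem] with t e₁ e₂ m₁ m₂ ht
      by_contra hcon
      refine ht ?_
      have hcon' : ¬((s : ℝ≥0∞) < phaseNorm id ω q p (𝓔 g t - 𝓔 f t) ∨
        (s : ℝ≥0∞) < phaseNorm id ω q p (𝓕 g t - 𝓕 f t)) := hcon
      push Not at hcon'
      have hgd : oscPropagator c g t ∈ sigmaOneDual d :=
        oscPropagator_mem_sigmaOneDual (sigmaOne_subset_sigmaOneDual hg) t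
      rw [e₁, e₂, phaseNorm_sub_comm _ (𝓔 f t)] at hcon'
      rw [← sub_add_sub_cancel (𝓔 f t) (oscPropagator c g t) (𝓕 f t), hA]
      refine (phaseNorm_add_le isPhasePerm_id hω (sigmaOneDual_sub m₁.1 hgd)
        (sigmaOneDual_sub hgd m₂.1)).trans ?_
      gcongr
      · exact hcon'.1
      · exact hcon'.2
    refine le_antisymm (ENNReal.le_of_forall_pos_le_add fun η hη' _ => ?_) (zero_le)
    rw [zero_add]
    refine (hη (η / 2) (by positivity)).trans_eq ?_
    rw [← ENNReal.coe_add, add_halves]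
  -- Countably many levels s tending to 0 give one null set outside which the norm of the difference
  -- vanishes.
  have hall := ae_all_iff.2 fun n : ℕ => hs (1 / ((n : ℝ≥0) + 1)) (by positivity)
  filter_upwards [hall, (h𝓔.mapsTo_mod f hf).mem, (h𝓕.mapsTo_mod f hf).mem] with t ht m₁ m₂
  have h1 : Tendsto (fun n : ℕ => ((A * (1 / ((n : ℝ≥0) + 1) + 1 / ((n : ℝ≥0) + 1)) : ℝ≥0) : ℝ≥0∞))
      atTop (𝓝 ((A * (0 + 0) : ℝ≥0) : ℝ≥0∞)) := by
    refine ENNReal.tendsto_coe.2 (Tendsto.const_mul _ ?_)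
    have := tendsto_one_div_add_atTop_nhds_zero_nat (𝕜 := ℝ≥0)
    exact this.add this
  have h2 := ge_of_tendsto' h1 fun n => (ht n).trans_eq (by push_cast; rfl)
  refine sub_eq_zero.1 (eq_zero_of_phaseNorm_eq_zero (p := q) (q := p) isPhasePerm_id hω hq hp
    (sigmaOneDual_sub m₁.1 m₂.1) (le_antisymm (h2.trans_eq (by simp)) (zero_le)))

theorem strichartzExtension_of_isDispersiveTimeNorm (hω : IsModerateRadialWeight ω) (hq : 0 < q)
    (hqp : q ≤ p) (c : ℂ) (hL : IsDispersiveTimeNorm T (d * (q⁻¹.toReal - p⁻¹.toReal)) L) :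
    StrichartzExtension c T ω p q L where
  sigmaOne_subset := sigmaOne_subset_sumSpace hω.isWeight hω.isModerate
  isExtension := isPropagatorExtension_oscPropagator hω hq hqp c hL
  estimate := exists_timeNorm_add_timeNorm_le hω hq hqp c hL
  normContinuous := isNormContinuous_oscPropagator hω hq hqp c hL
  weakStarContinuous := fun _ _ _ _ h => .of_forall fun t => weakStarTendsto_oscPropagator h c t
  unique_weakStar := by
    intro 𝓔 h𝓔 c𝓔 f hf
    have hmem := fun n => hermiteTruncation_mem_sigmaOne f n
    have htrunc := weakStarTendsto_hermiteTruncation (sigmaOneDual_of_mem_sumSpace hf)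
    -- The truncations form a sequence, so 𝓔 agrees with the propagator on all of them outside a
    -- single null set. Both limits along it are then weak* limits of the same sequence.
    filter_upwards [c𝓔 _ f (fun n => sigmaOne_subset_sumSpace hω.isWeight hω.isModerate (hmem n))
      hf htrunc, ae_all_iff.2 fun n => h𝓔.eq_on_sigmaOne _ (hmem n)] with t h₁ h₂
    refine h₁.unique ?_
    simp only [h₂]
    exact weakStarTendsto_oscPropagator htrunc c t
  unique_norm := fun hp' _ h𝓔 c𝓔 _ hf =>
    ae_eq_of_isNormContinuous hω.isWeight hω.isModerate (hq.trans_le hqp).ne' hp' hq.ne'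
      (ne_top_of_le_ne_top hp' hqp) hL h𝓔 (isPropagatorExtension_oscPropagator hω hq hqp c hL)
      c𝓔 (isNormContinuous_oscPropagator hω hq hqp c hL) hf

end Strichartz

theorem theorem4p4 (d : ℕ) (c : ℂ) (T : ℝ) (hT : 0 < T)
    (ω : (Fin d → ℝ) × (Fin d → ℝ) → ℝ) (hω : IsModerateRadialWeight ω)
    (p q : ℝ≥0∞) (hq : 0 < q) (hqp : q ≤ p) :
    (∀ r₀ : ℝ≥0∞, 0 < r₀ → r₀⁻¹ = (d : ℝ≥0∞) * (q⁻¹ - p⁻¹) →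
      StrichartzExtension c T ω p q (weakTimeNorm T r₀)) ∧
    (∀ r₀ : ℝ≥0∞, 0 < r₀ → (d : ℝ≥0∞) * (q⁻¹ - p⁻¹) < r₀⁻¹ →
      StrichartzExtension c T ω p q (strongTimeNorm T r₀)) := by
  have hqi : q⁻¹ ≠ ∞ := ENNReal.inv_ne_top.2 hq.ne'
  have hpq : p⁻¹ ≤ q⁻¹ := ENNReal.inv_le_inv.2 hqp
  -- Since 1/p ≤ 1/q < ∞, the truncated subtraction in [0, ∞] is the genuine difference, and the
  -- exponent conditions can be read in ℝ.
  have ha : ((d : ℝ≥0∞) * (q⁻¹ - p⁻¹)).toReal = d * (q⁻¹.toReal - p⁻¹.toReal) := by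
    rw [ENNReal.toReal_mul, ENNReal.toReal_sub_of_le hpq hqi, ENNReal.toReal_natCast]
  refine ⟨fun r₀ hr hr₀ => ?_, fun r₀ hr hr₀ => ?_⟩
  · exact strichartzExtension_of_isDispersiveTimeNorm hω hq hqp c
      (isDispersiveTimeNorm_weak T hr.ne' (by rw [hr₀, ha]))
  · have har := ENNReal.toReal_strict_mono (ENNReal.inv_ne_top.2 hr.ne') hr₀
    refine strichartzExtension_of_isDispersiveTimeNorm hω hq hqp c
      (isDispersiveTimeNorm_strong T (ha ▸ ENNReal.toReal_nonneg) hr.ne' (ha ▸ har))
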